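/- Let $0<q<1$, $N\in\mathbb{N}$, and let $a_1,\dots,a_N>0$ and $\alpha_1,\dots,\alpha_N\in[0,1)$ be real with $\alpha_i<a_j$ for all $i,j$. Write $(x;q)_\infty=\prod_{n\ge 0}(1-xq^n)$, $(x;q)_n=(x;q)_\infty/(xq^n;q)_\infty$, and $1/(q;q)_n=(q^{n+1};q)_\infty/(q;q)_\infty$ for $n\in\mathbb{Z}$ (so it is $0$ for $n<0$). **Notation.** A signature of length $n$ is a non-increasing $n$-tuple of integers; it is a partition if its entries are non-negative. $\mathbb{G}_N$ is the set of $\underline\lambda_N=(\lambda^{(1)},\dots,\lambda^{(N)})$ with $\lambda^{(n)}$ a signature of length $n$ and $\lambda^{(m+1)}_{\ell+1}\le\lambda^{(m)}_\ell\le\lambda^{(m+1)}_\ell$ for $1\le\ell\le m\le N-1$; $\mathbb{G}^{(0)}_N$ is the subset in which all $\lambda^{(n)}$ are partitions. For $\lambda=(\lambda_1,\dots,\lambda_n)$ put $-\lambda=(-\lambda_n,\dots,-\lambda_1)$, and put $-\underline\lambda_N=(-\lambda^{(1)},\dots,-\lambda^{(N)})$. For signatures $\lambda,\mu$ of lengths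 $n,n-1$ let $$P_{\lambda/\mu}(x)=x^{\sum_i\lambda_i-\sum_i\mu_i}\prod_{i=1}^{n-1}\frac{(q;q)_{\lambda_i-\lambda_{i+1}}}{(q;q)_{\lambda_i-\mu_i}(q;q)_{\mu_i-\lambda_{i+1}}},\qquad P_\lambda(x_1,\dots,x_N)=\sum\prod_{j=1}^N P_{\lambda^{(j)}/\lambda^{(j-1)}}(x_j),$$ where the sum is over the elements of $\mathbb{G}_N$ with $\lambda^{(N)}=\lambda$, and $\lambda^{(0)}=\varnothing$. For a partition $\lambda$ of length $N$ let $$Q_\lambda(x)=\frac{P_\lambda(x)}{(q;q)_{\lambda_N}\prod_{i=1}^{N-1}(q;q)_{\lambda_i-\lambda_{i+1}}}.$$ For a signature $\lambda$ of length $N$ and $t\ge0$ let, with $\mathbb{T}$ the positively oriented unit circle, $$Q_\lambda(\alpha,t)=\prod_{i=1}^{N-1}(q^{\lambda_i-\lambda_{i+1}+1};q)_\infty\int_{\mathbb{T}^N}\prod_{i=1}^N\frac{dz_i}{z_i}\,P_\lambda(1/z)\,\Pi(z;\alpha,t)\,m_N^q(z),$$ $$\Pi(z;\alpha,t)=\prod_{i,j=1}^N\frac{1}{(\alpha_i/z_j;q)_\infty}\prod_{j=1}^N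 e^{z_jt},\qquad m^q_N(z)=\frac{1}{(2\pi i)^N N!}\prod_{1\le i<j\le N}(z_i/z_j;q)_\infty(z_j/z_i;q)_\infty.$$ The two-sided $q$-Whittaker process is, for $\underline\lambda_N\in\mathbb{G}_N$, $$P_t(\underline\lambda_N)=\frac{\prod_{j=1}^NP_{\lambda^{(j)}/\lambda^{(j-1)}}(a_j)\cdot Q_{\lambda^{(N)}}(\alpha,t)}{\Pi(a;\alpha,t)}.$$ **Statement.** (i) Let $\underline\lambda_N\in\mathbb{G}_N$ and $\underline\mu_N=-\underline\lambda_N$. If $\underline\mu_N\notin\mathbb{G}^{(0)}_N$, then $P_0(\underline\lambda_N)=0$. If $\underline\mu_N\in\mathbb{G}^{(0)}_N$, then $$P_0(\underline\lambda_N)=\frac{\prod_{j=1}^NP_{\mu^{(j)}/\mu^{(j-1)}}(1/a_j)\cdot Q_{\mu^{(N)}}(\alpha)}{\Pi(a;\alpha,0)},$$ that is, $P_0$ is the (ordinary) $q$-Whittaker process with parameters $1/a_j$ and pure $\alpha$-specialisation, evaluated at $-\underline\lambda_N$. In particular $P_0$ is a probability density on $-\mathbb{G}^{(0)}_N\subseteq\mathbb{G}_N$: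 it is real and non-negative, and its sum over $-\mathbb{G}_N^{(0)}$ is $1$. (ii) Suppose that all $\alpha_k$ except possibly one are zero, and let $\alpha$ be the value of the exceptional one. Then, for every $\underline\lambda_N\in\mathbb{G}_N$, with the convention $\lambda^{(0)}_0=0$, $$P_0(\underline\lambda_N)=\prod_{j=1}^N\left(\frac{\alpha}{a_j};q\right)_\infty\frac{(\alpha/a_j)^{\lambda^{(j-1)}_{j-1}-\lambda^{(j)}_j}}{(q;q)_{\lambda^{(j-1)}_{j-1}-\lambda^{(j)}_j}}\cdot\prod_{k=1}^N\prod_{j=1}^{k-1}\delta_{\lambda^{(k)}_j,0}.$$ (iii) In the situation of (ii), let $\underline\lambda_N$ be distributed according to $P_0$ and let $X_j=\lambda^{(j)}_j-j$ for $1\le j\le N$. Then, almost surely, $-1-X_1=Y_1$ and $X_{i-1}-X_i-1=Y_i$ for $2\le i\le N$, where $Y_1,\dots,Y_N$ are independent and $Y_i$ is $q$-Poisson with parameter $\alpha/a_i$, i.e. $\mathbb{P}[Y_i=n]=(\alpha/a_i;q)_\infty(\alpha/a_i)^n/(q;q)_n$ for $n\ge0$. This is the random initial condition of $q$-TASEP.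 -/

import Mathlib

noncomputable section

namespace QWhittaker

/-! Infinite and finite `q`-Pochhammer symbols. -/

/-- `(a;q)_∞ = ∏_{n ≥ 0} (1 - a qⁿ)` -/
def qPochInf {K : Type*} [Field K] [TopologicalSpace K] (a q : K) : K :=
  ∏' n : ℕ, (1 - a * q ^ n)

/-- `(a;q)_n = (a;q)_∞ / (a qⁿ;q)_∞` -/
def qPoch {K : Type*} [Field K] [TopologicalSpace K] (a q : K) (n : ℤ) : K :=
  qPochInf a q / qPochInf (a * q ^ n) q

/-- `1 / (q;q)_n = (q^{n+1};q)_∞ / (q;q)_∞`, which makes sense for every integer `n` and vanishes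
for `n < 0`. -/
def qPochInv {K : Type*} [Field K] [TopologicalSpace K] (q : K) (n : ℤ) : K :=
  qPochInf (q * q ^ n) q / qPochInf q q

/-! Signatures, partitions and Gelfand-Tsetlin cones. Indices are shifted by one: the part `λ_i` of
the text is `lam (i - 1)`. -/

/-- `lam` is a signature of length `n`: `λ₁ ≥ ⋯ ≥ λ_n` are integers. -/
def IsSignature {n : ℕ} (lam : Fin n → ℤ) : Prop := Antitone lam

/-- `lam` is a partition of length `n`: `λ₁ ≥ ⋯ ≥ λ_n ≥ 0`. -/
def IsPartition {n : ℕ} (lam : Fin n → ℤ) : Prop := Antitone lam ∧ ∀ i, 0 ≤ lam i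

/-- `λ_{i+1} ≤ μ_i ≤ λ_i` for `1 ≤ i ≤ n` -/
def Interlaces {n : ℕ} (lam : Fin (n + 1) → ℤ) (mu : Fin n → ℤ) : Prop :=
  ∀ i : Fin n, lam i.succ ≤ mu i ∧ mu i ≤ lam i.castSucc

/-- Triangular arrays of integers `(λ⁽⁰⁾, λ⁽¹⁾, …, λ⁽ᴺ⁾)`, where the row `λ⁽ⁿ⁾` has length `n`
(so that `λ⁽⁰⁾` is the empty row). -/
abbrev GTArray (N : ℕ) : Type := (n : Fin (N + 1)) → Fin (n : ℕ) → ℤ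

/-- the row `λ⁽ʲ⁺¹⁾` -/
def GTArray.upper {N : ℕ} (x : GTArray N) (j : Fin N) : Fin ((j : ℕ) + 1) → ℤ := x j.succ

/-- the row `λ⁽ʲ⁾` -/
def GTArray.lower {N : ℕ} (x : GTArray N) (j : Fin N) : Fin (j : ℕ) → ℤ := x j.castSucc

/-- the top row `λ⁽ᴺ⁾` -/
def GTArray.top {N : ℕ} (x : GTArray N) : Fin N → ℤ := x (Fin.last N)

/-- The Gelfand-Tsetlin cone `𝔾_N` for signatures. -/
def gtCone (N : ℕ) : Set (GTArray N) :=
  {x | (∀ n, IsSignature (x n)) ∧ ∀ j : Fin N, Interlaces (x.upper j) (x.lower j)}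

/-- The Gelfand-Tsetlin cone `𝔾_N⁽⁰⁾` for partitions. -/
def gtConePartition (N : ℕ) : Set (GTArray N) :=
  {x | (∀ n, IsPartition (x n)) ∧ ∀ j : Fin N, Interlaces (x.upper j) (x.lower j)}

/-- `-λ = (-λ_n, …, -λ₁)` -/
def negSig {n : ℕ} (lam : Fin n → ℤ) : Fin n → ℤ := fun i => -lam i.rev

/-- `-(λ⁽¹⁾, …, λ⁽ᴺ⁾) = (-λ⁽¹⁾, …, -λ⁽ᴺ⁾)` -/
def negGT {N : ℕ} (x : GTArray N) : GTArray N := fun n => negSig (x n)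

/-- The set `-𝔾_N⁽⁰⁾` of the negations of the elements of `𝔾_N⁽⁰⁾`. -/
def negGtConePartition (N : ℕ) : Set (GTArray N) := negGT '' gtConePartition N

/-! `q`-Whittaker functions. -/

/-- The skew `q`-Whittaker function `P_{λ/μ}(a)` in one variable. The powers of `a` are collected
into the single power `a^{|λ| - |μ|}`, so that the value at `a = 0` is that of the polynomial. -/
def skewP {K : Type*} [Field K] [TopologicalSpace K] (q : K) {n : ℕ}
    (lam : Fin (n + 1) → ℤ) (mu : Fin n → ℤ) (a : K) : K :=
  a ^ ((∑ i, lam i) - ∑ i, mu i) *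
    ∏ i : Fin n, (qPoch q q (lam i.castSucc - lam i.succ) *
      qPochInv q (lam i.castSucc - mu i) * qPochInv q (mu i - lam i.succ))

/-- The `q`-Whittaker function `P_λ(x₁, …, x_n)`: the sum over all rows
`λ = λ⁽ⁿ⁾, λ⁽ⁿ⁻¹⁾, …, λ⁽¹⁾` with `λ⁽ᵏ⁺¹⁾_{i+1} ≤ λ⁽ᵏ⁾_i ≤ λ⁽ᵏ⁺¹⁾_i` of the product of the
`P_{λ⁽ʲ⁾/λ⁽ʲ⁻¹⁾}(x_j)`, written as an iterated sum. -/
def whittakerP {K : Type*} [Field K] [TopologicalSpace K] (q : K) :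
    {n : ℕ} → (Fin n → ℤ) → (Fin n → K) → K
  | 0, _, _ => 1
  | n + 1, lam, x =>
      ∑ mu ∈ Fintype.piFinset fun i : Fin n => Finset.Icc (lam i.succ) (lam i.castSucc),
        skewP q lam mu (x (Fin.last n)) * whittakerP q mu fun i => x i.castSucc

/-- `⟨P_λ, P_λ⟩ = (q;q)_{λ_N} ∏_{i=1}^{N-1} (q;q)_{λ_i - λ_{i+1}}` for a partition `λ` -/
def normP {K : Type*} [Field K] [TopologicalSpace K] (q : K) {N : ℕ} (lam : Fin N → ℤ) : K :=
  ∏ i : Fin N, if h : (i : ℕ) + 1 < N then qPoch q q (lam i - lam ⟨i + 1, h⟩)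
    else qPoch q q (lam i)

/-- `Q_λ(x) = P_λ(x) / ⟨P_λ, P_λ⟩` for a partition `λ` -/
def whittakerQ {K : Type*} [Field K] [TopologicalSpace K] (q : K) {N : ℕ}
    (lam : Fin N → ℤ) (x : Fin N → K) : K :=
  whittakerP q lam x / normP q lam

/-- `Π(x;y) = ∏_{i,j} 1 / (x_i y_j;q)_∞` -/
def cauchyKernel {K : Type*} [Field K] [TopologicalSpace K] (q : K) {N : ℕ}
    (x y : Fin N → K) : K :=
  ∏ i, ∏ j, 1 / qPochInf (x i * y j) q

/-- The ordinary (ascending) `q`-Whittaker process on `𝔾_N⁽⁰⁾` with parameters `x` and pure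
`α`-specialisation `y`. -/
def alphaProcess {K : Type*} [Field K] [TopologicalSpace K] (q : K) {N : ℕ}
    (x y : Fin N → K) (m : GTArray N) : K :=
  (∏ j : Fin N, skewP q (m.upper j) (m.lower j) (x j)) * whittakerQ q m.top y /
    cauchyKernel q x y

/-! The two-sided `q`-Whittaker process. -/

/-- The `q`-Sklyanin measure. -/
def sklyanin (q : ℂ) {N : ℕ} (z : Fin N → ℂ) : ℂ :=
  1 / ((2 * (Real.pi : ℂ) * Complex.I) ^ N * (N.factorial : ℂ)) *
    ∏ i : Fin N, ∏ j ∈ Finset.Ioi i, (qPochInf (z i / z j) q * qPochInf (z j / z i) q)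

/-- `Π(z;α,t) = ∏_{i,j} 1 / (α_i / z_j;q)_∞ · ∏_j e^{z_j t}` -/
def twoSidedKernel (q : ℂ) {N : ℕ} (z α : Fin N → ℂ) (t : ℝ) : ℂ :=
  (∏ i, ∏ j, 1 / qPochInf (α i / z j) q) * ∏ j, Complex.exp (z j * t)

/-- `Q_λ(α,t)` for a signature `λ`, an integral over the torus `|z_1| = ⋯ = |z_N| = 1`. -/
def twoSidedQ (q : ℂ) {N : ℕ} (lam : Fin N → ℤ) (α : Fin N → ℂ) (t : ℝ) : ℂ :=
  (∏ i : Fin N, if h : (i : ℕ) + 1 < N then qPochInf (q ^ (lam i - lam ⟨i + 1, h⟩ + 1)) q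
    else 1) *
    torusIntegral (fun z : Fin N → ℂ => (∏ i, 1 / z i) * whittakerP q lam (fun i => 1 / z i) *
      twoSidedKernel q z α t * sklyanin q z) 0 1

/-- The two-sided `q`-Whittaker process `P_t` with real parameters `q`, `a`, `α`. -/
def twoSidedProcess (q : ℝ) {N : ℕ} (a α : Fin N → ℝ) (t : ℝ) (x : GTArray N) : ℂ :=
  (∏ j : Fin N, skewP (q : ℂ) (x.upper j) (x.lower j) (a j : ℂ)) *
    twoSidedQ (q : ℂ) x.top (fun i => (α i : ℂ)) t /
    twoSidedKernel (q : ℂ) (fun i => (a i : ℂ)) (fun i => (α i : ℂ)) t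

/-- The measure on `𝔾_N` with density `P_t`. -/
def twoSidedMeasure (q : ℝ) {N : ℕ} (a α : Fin N → ℝ) (t : ℝ) :
    MeasureTheory.Measure (gtCone N) :=
  MeasureTheory.Measure.sum fun x : gtCone N =>
    ENNReal.ofReal (twoSidedProcess q a α t x).re • MeasureTheory.Measure.dirac x

/-! `q`-Poisson weights and the random initial condition of `q`-TASEP. -/

/-- The `q`-Poisson weight `(b;q)_∞ bⁿ / (q;q)_n`; it is `0` for `n < 0`. -/
def qPoissonWeight (q b : ℝ) (n : ℤ) : ℝ := qPochInf b q * (b ^ n * qPochInv q n)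

/-- The `q`-Poisson distribution with parameter `b`. -/
def qPoissonMeasure (q b : ℝ) : MeasureTheory.Measure ℕ :=
  MeasureTheory.Measure.sum fun n : ℕ =>
    ENNReal.ofReal (qPoissonWeight q b n) • MeasureTheory.Measure.dirac n

/-- The diagonal entries `λ_j⁽ʲ⁾`, `0 ≤ j ≤ N`, with the convention `λ_0⁽⁰⁾ = 0`. -/
def GTArray.diag {N : ℕ} (x : GTArray N) : Fin (N + 1) → ℤ :=
  Fin.cases 0 fun j => x.upper j (Fin.last j)

/-- The positions `X_j = λ_j⁽ʲ⁾ - j`, `1 ≤ j ≤ N`, of the `q`-TASEP particles. -/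
def GTArray.particle {N : ℕ} (x : GTArray N) (j : Fin N) : ℤ :=
  x.upper j (Fin.last j) - ((j : ℤ) + 1)

/-- The random initial condition of `q`-TASEP: `-1 - X_1 = Y_1` and `X_{i-1} - X_i - 1 = Y_i`
for `2 ≤ i ≤ N`, where `Y_1, …, Y_N` are independent and `Y_i` is `q`-Poisson with parameter
`b_i`. -/
def IsQPoissonInitial {Ω : Type*} [MeasurableSpace Ω] (μ : MeasureTheory.Measure Ω) (q : ℝ)
    {N : ℕ} (b : Fin N → ℝ) (X : Fin N → Ω → ℤ) : Prop :=
  ∃ Y : Fin N → Ω → ℕ, (∀ i, Measurable (Y i)) ∧ ProbabilityTheory.iIndepFun Y μ ∧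
    (∀ i, μ.map (Y i) = qPoissonMeasure q (b i)) ∧
    ∀ᵐ ω ∂μ, (∀ i : Fin N, (i : ℕ) = 0 → -1 - X i ω = (Y i ω : ℤ)) ∧
      ∀ i j : Fin N, (j : ℕ) = (i : ℕ) + 1 → X i ω - X j ω - 1 = (Y j ω : ℤ)

end QWhittaker

end

/-! Put w = 1/z. At t = 0, Q_λ(α,0) is, up to its prefactor, the average over the unit torus of Δ(w)
P_λ(w) ∏ 1/(α_i w_j;q)_∞, where Δ(w) = ∏_{i≠j} (w_i/w_j;q)_∞ (`delta`). The Pieri rule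
`gCoeff_mul_whittakerP` expands P_λ ∏_j 1/(α w_j;q)_∞ into Σ_ν α^{|ν|-|λ|} φ_{ν/λ} P_ν, over
horizontal strips ν/λ. Used once per α, it leaves averages of Δ P_ν, which vanish unless ν = 0
(`torusAvg_whittakerP`). What survives is a sum over chains of horizontal strips from λ up to 0.
Negation turns these into chains from 0 up to -λ (`horCoeff_negSig`), with the weights of the
branching rule for Q_{-λ}(α) (`alphaWeight_succ`). This is `torusAvg_whittakerP_mul`. The average of
Δ itself (`torusAvg_delta`) fixes the constant.

The Pieri rule is derived from its simpler companion for ∏ (1 + u w_j) (`whittakerP_vert`), which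
follows from the branching rule by a two-state transfer matrix computation. Both sides of the
horizontal rule, as power series in α, satisfy D(qα) = ∏ (1 - α w_j) D(α) with the same constant
term, and such an equation has only one solution.

The averages rest on the q-difference operator Σ_i ∏_{j≠i} (1 - w_i/w_j)⁻¹ T_{q,w_i}, which
preserves averages against Δ: shift one contour by q, then apply Lagrange interpolation. Let g_k be
the coefficient of α^k in ∏ 1/(α w_j;q)_∞. Applied to (∏ w_i)^c times at most n factors g_k in n + 1
variables, the operator multiplies by q^c, so the average is zero when c ≠ 0. The Pieri rule carries
this to every P_λ whose last part is non-zero, while homogeneity settles last part zero with λ ≠ 0.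
Applied to Σ_k w_k^{-m} g_m(w), the operator shows that certain averages do not depend on m; letting
m → ∞ gives a recursion for the average of Δ in the number of variables.

Total mass 1 is the Cauchy identity, obtained by iterating the Pieri rule and summing the branching
rule over arrays. With a single α only one-row partitions survive and the q-factorials telescope
into a product of q-Poisson weights. An array in the support is determined by its diagonal
increments, so these are independent q-Poisson variables. -/

namespace QWhittaker

open Filter Topology MeasureTheory

/-! ### q-Pochhammer symbols and the q-exponential series. -/

section QPochhammer

variable {𝕜 : Type*} [RCLike 𝕜] {q : 𝕜}

theorem summable_norm_qPochInf_factor (hq : ‖q‖ < 1) (a : 𝕜) :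
    Summable fun n : ℕ => ‖-(a * q ^ n)‖ := by
  simpa [norm_mul, norm_pow] using
    (summable_geometric_of_lt_one (norm_nonneg q) hq).mul_left ‖a‖

theorem multipliable_qPochInf (hq : ‖q‖ < 1) (a : 𝕜) :
    Multipliable fun n : ℕ => 1 - a * q ^ n := by
  simpa [sub_eq_add_neg] using
    multipliable_one_add_of_summable (summable_norm_qPochInf_factor hq a)

theorem qPochInf_step (hq : ‖q‖ < 1) (a : 𝕜) :
    qPochInf a q = (1 - a) * qPochInf (a * q) q := by
  unfold qPochInf
  rw [tprod_eq_zero_mul']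
  · simp [pow_succ', mul_assoc]
  · simpa [pow_succ', mul_assoc] using multipliable_qPochInf hq (a * q)

theorem qPochInf_ne_zero (hq : ‖q‖ < 1) {a : 𝕜} (ha : ∀ n : ℕ, a * q ^ n ≠ 1) :
    qPochInf a q ≠ 0 := by
  have := tprod_one_add_ne_zero_of_summable (f := fun n : ℕ => -(a * q ^ n))
    (fun n => by rw [← sub_eq_add_neg, sub_ne_zero]; exact (ha n).symm)
    (summable_norm_qPochInf_factor hq a)
  simpa [qPochInf, sub_eq_add_neg] using this

theorem qPochInf_ne_zero_of_norm_lt (hq : ‖q‖ < 1) {a : 𝕜} (ha : ‖a‖ < 1) :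
    qPochInf a q ≠ 0 := by
  refine qPochInf_ne_zero hq fun n h => ?_
  have h1 : ‖a * q ^ n‖ < 1 := by
    rw [norm_mul, norm_pow]
    calc ‖a‖ * ‖q‖ ^ n ≤ ‖a‖ * 1 := by
          gcongr
          exact pow_le_one₀ (norm_nonneg _) hq.le
      _ < 1 := by simpa using ha
  rw [h] at h1
  simp at h1

@[simp]
theorem qPochInf_zero : qPochInf (0 : 𝕜) q = 1 := by simp [qPochInf]

theorem qPochInf_one (hq : ‖q‖ < 1) : qPochInf (1 : 𝕜) q = 0 := by
  rw [qPochInf_step hq]; simp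

theorem hasProdLocallyUniformlyOn_qPochInf (hq : ‖q‖ < 1) (R : ℝ) :
    HasProdLocallyUniformlyOn (fun (n : ℕ) (a : 𝕜) => 1 - a * q ^ n) (fun a => qPochInf a q)
      (Metric.ball 0 R) := by
  have := Summable.hasProdLocallyUniformlyOn_nat_one_add (f := fun (n : ℕ) (a : 𝕜) => -(a * q ^ n))
    (K := Metric.ball (0 : 𝕜) R) Metric.isOpen_ball
    ((summable_geometric_of_lt_one (norm_nonneg q) hq).mul_left R)
    (.of_forall fun n a ha => by
      rw [norm_neg, norm_mul, norm_pow]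
      gcongr
      exact (mem_ball_zero_iff.1 ha).le) (fun n => by fun_prop)
  simpa [qPochInf, sub_eq_add_neg] using this

theorem continuous_qPochInf (hq : ‖q‖ < 1) : Continuous fun a : 𝕜 => qPochInf a q := by
  rw [continuous_iff_continuousAt]
  intro a
  have h := hasProdLocallyUniformlyOn_iff_tendstoLocallyUniformlyOn.1
    (hasProdLocallyUniformlyOn_qPochInf hq (‖a‖ + 1))
  refine (h.continuousOn (.of_forall fun s => ?_)).continuousAt
    (Metric.isOpen_ball.mem_nhds (by simp))
  exact continuousOn_finsetProd _ fun i _ => by fun_prop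

theorem differentiable_qPochInf {q : ℂ} (hq : ‖q‖ < 1) :
    Differentiable ℂ fun a : ℂ => qPochInf a q := by
  intro a
  refine ((hasProdLocallyUniformlyOn_qPochInf hq (‖a‖ + 1)).differentiableOn
    (.of_forall fun s => ?_) Metric.isOpen_ball).differentiableAt
    (Metric.isOpen_ball.mem_nhds (by simp))
  simpa [Finset.prod_fn] using DifferentiableOn.finsetProd (fun _ _ => by fun_prop)

theorem qPochInf_self_ne_zero (hq : ‖q‖ < 1) : qPochInf q q ≠ 0 :=
  qPochInf_ne_zero_of_norm_lt hq hq

theorem qPoch_self (n : ℤ) : qPoch q q n = (qPochInv q n)⁻¹ := by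
  simp [qPoch, qPochInv]

@[simp]
theorem qPochInv_zero (hq : ‖q‖ < 1) : qPochInv q 0 = 1 := by
  simp [qPochInv, div_self (qPochInf_self_ne_zero hq)]

theorem qPochInv_sub_one (hq0 : q ≠ 0) (hq : ‖q‖ < 1) (n : ℤ) :
    qPochInv q (n - 1) = (1 - q ^ n) * qPochInv q n := by
  have h : q * q ^ (n - 1) = q ^ n := by
    rw [zpow_sub_one₀ hq0]; field_simp
  rw [qPochInv, qPochInv, h, qPochInf_step hq, mul_comm q, mul_div_assoc]

theorem qPochInv_step (hq0 : q ≠ 0) (hq : ‖q‖ < 1) (n : ℤ) :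
    qPochInv q n = (1 - q ^ (n + 1)) * qPochInv q (n + 1) := by
  rw [← qPochInv_sub_one hq0 hq, add_sub_cancel_right]

/-- The factor 1 - q^0 of the recursion produces the zero at -1, and the recursion carries it to all
smaller integers. -/
theorem qPochInv_neg_nat (hq0 : q ≠ 0) (hq : ‖q‖ < 1) (n : ℕ) :
    qPochInv q (-(n : ℤ) - 1) = 0 := by
  induction n with
  | zero =>
    have := qPochInv_sub_one hq0 hq 0
    simpa using this
  | succ n ih =>
    rw [qPochInv_sub_one hq0 hq]
    have : (-((n + 1 : ℕ) : ℤ)) = -(n : ℤ) - 1 := by push_cast; ring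
    rw [this, ih, mul_zero]

theorem qPochInv_of_neg (hq0 : q ≠ 0) (hq : ‖q‖ < 1) {n : ℤ} (hn : n < 0) : qPochInv q n = 0 := by
  obtain ⟨m, hm⟩ := Int.eq_ofNat_of_zero_le (show 0 ≤ -n - 1 by omega)
  have : n = -(m : ℤ) - 1 := by omega
  rw [this, qPochInv_neg_nat hq0 hq]

theorem one_sub_pow_ne_zero (hq : ‖q‖ < 1) {n : ℕ} (hn : n ≠ 0) : 1 - q ^ n ≠ 0 := by
  intro h
  have h1 : ‖q ^ n‖ < 1 := by
    rw [norm_pow]; exact pow_lt_one₀ (norm_nonneg _) hq hn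
  rw [← sub_eq_zero.1 h] at h1
  simp at h1

theorem qPochInv_ne_zero (hq : ‖q‖ < 1) {n : ℤ} (hn : 0 ≤ n) : qPochInv q n ≠ 0 := by
  obtain ⟨m, rfl⟩ := Int.eq_ofNat_of_zero_le hn
  refine div_ne_zero (qPochInf_ne_zero_of_norm_lt hq ?_) (qPochInf_self_ne_zero hq)
  rw [zpow_natCast, ← pow_succ', norm_pow]
  exact pow_lt_one₀ (norm_nonneg _) hq (by omega)

theorem qPoch_ne_zero (hq : ‖q‖ < 1) {n : ℤ} (hn : 0 ≤ n) : qPoch q q n ≠ 0 := by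
  rw [qPoch_self]; exact inv_ne_zero (qPochInv_ne_zero hq hn)

theorem qPoch_mul_qPochInv (hq : ‖q‖ < 1) {n : ℤ} (hn : 0 ≤ n) :
    qPoch q q n * qPochInv q n = 1 := by
  rw [qPoch_self, inv_mul_cancel₀ (qPochInv_ne_zero hq hn)]

@[simp]
theorem qPoch_zero (hq : ‖q‖ < 1) : qPoch q q 0 = 1 := by
  simp [qPoch_self, qPochInv_zero hq]

theorem qPoch_add_one (hq0 : q ≠ 0) (hq : ‖q‖ < 1) {n : ℤ} (hn : 0 ≤ n) :
    qPoch q q (n + 1) = (1 - q ^ (n + 1)) * qPoch q q n := by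
  have h1 := qPochInv_step hq0 hq n
  have h2 := qPochInv_ne_zero hq hn
  rw [h1] at h2
  rw [qPoch_self, qPoch_self, h1, mul_inv, ← mul_assoc, mul_inv_cancel₀ (left_ne_zero_of_mul h2),
    one_mul]

theorem tendsto_qPochInv_atTop (hq : ‖q‖ < 1) :
    Tendsto (fun n : ℕ => qPochInv q (n : ℤ)) atTop (𝓝 (1 / qPochInf q q)) := by
  have h1 : Tendsto (fun n : ℕ => q * q ^ n) atTop (𝓝 (q * 0)) :=
    (tendsto_pow_atTop_nhds_zero_of_norm_lt_one hq).const_mul q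
  have h2 := ((continuous_qPochInf hq).tendsto (q * 0)).comp h1
  simp only [mul_zero, qPochInf_zero] at h2
  simpa [qPochInv] using h2.div_const (qPochInf q q)

theorem exists_norm_qPochInv_le (hq : ‖q‖ < 1) :
    ∃ B : ℝ, 0 ≤ B ∧ ∀ n : ℕ, ‖qPochInv q (n : ℤ)‖ ≤ B := by
  obtain ⟨B, hB⟩ := (tendsto_qPochInv_atTop hq).norm.bddAbove_range
  exact ⟨B, (norm_nonneg _).trans (hB ⟨0, rfl⟩), fun n => hB ⟨n, rfl⟩⟩

theorem summable_norm_qExp (hq : ‖q‖ < 1) {x : 𝕜} (hx : ‖x‖ < 1) :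
    Summable fun n : ℕ => ‖x ^ n * qPochInv q (n : ℤ)‖ := by
  obtain ⟨B, hB0, hB⟩ := exists_norm_qPochInv_le hq
  refine Summable.of_nonneg_of_le (fun n => norm_nonneg _) (fun n => ?_)
    ((summable_geometric_of_lt_one (norm_nonneg x) hx).mul_right B)
  rw [norm_mul, norm_pow]
  gcongr
  exact hB n

/-- The `q`-binomial theorem `1 / (x;q)_∞ = ∑ xⁿ / (q;q)_n`. -/
theorem hasSum_qExp (hq0 : q ≠ 0) (hq : ‖q‖ < 1) {x : 𝕜} (hx : ‖x‖ < 1) :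
    HasSum (fun n : ℕ => x ^ n * qPochInv q (n : ℤ)) (1 / qPochInf x q) := by
  have hqn : ∀ n, ‖x * q ^ n‖ < 1 := fun n => by
    rw [norm_mul, norm_pow]
    calc ‖x‖ * ‖q‖ ^ n ≤ ‖x‖ * 1 := by
          gcongr; exact pow_le_one₀ (norm_nonneg _) hq.le
      _ < 1 := by simpa using hx
  set f : 𝕜 → 𝕜 := fun y => ∑' n : ℕ, y ^ n * qPochInv q (n : ℤ) with hf
  have hs : ∀ y : 𝕜, ‖y‖ < 1 → Summable fun n : ℕ => y ^ n * qPochInv q (n : ℤ) :=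
    fun y hy => (summable_norm_qExp hq hy).of_norm
  -- The series satisfies f(yq) = (1 - y) f(y). Iterating this, and using f(x qⁿ) → f(0) = 1, gives
  -- (x;q)_∞ f(x) = 1.
  have hstep : ∀ y : 𝕜, ‖y‖ < 1 → ‖y * q‖ < 1 → f (y * q) = (1 - y) * f y := by
    intro y hy hyq
    have h1 : ∀ n : ℕ, (y * q) ^ (n + 1) * qPochInv q ((n + 1 : ℕ) : ℤ) =
        y ^ (n + 1) * qPochInv q ((n + 1 : ℕ) : ℤ) - y * (y ^ n * qPochInv q (n : ℤ)) := by
      intro n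
      have := qPochInv_step hq0 hq (n : ℤ)
      rw [this, mul_pow]
      push_cast
      rw [show q ^ ((n : ℤ) + 1) = q ^ (n + 1) by exact_mod_cast zpow_natCast q (n + 1)]
      ring
    have e1 : f (y * q) = 1 + ∑' n : ℕ, (y * q) ^ (n + 1) * qPochInv q ((n + 1 : ℕ) : ℤ) := by
      rw [hf]; dsimp only
      rw [(hs _ hyq).tsum_eq_zero_add]; simp [qPochInv_zero hq]
    have e2 : f y = 1 + ∑' n : ℕ, y ^ (n + 1) * qPochInv q ((n + 1 : ℕ) : ℤ) := by
      rw [hf]; dsimp only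
      rw [(hs _ hy).tsum_eq_zero_add]; simp [qPochInv_zero hq]
    rw [e1, tsum_congr h1, Summable.tsum_sub ((summable_nat_add_iff 1).2 (hs y hy))
      ((hs y hy).mul_left y), tsum_mul_left, sub_mul, one_mul]
    change _ = f y - y * f y
    rw [← add_sub_assoc, ← e2]
  have hiter : ∀ n, f (x * q ^ n) = (∏ k ∈ Finset.range n, (1 - x * q ^ k)) * f x := by
    intro n
    induction n with
    | zero => simp
    | succ n ih =>
      have := hqn (n + 1)
      rw [pow_succ, ← mul_assoc] at this ⊢
      rw [hstep _ (hqn n) this, ih, Finset.prod_range_succ]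
      ring
  have hlim : Tendsto (fun n : ℕ => f (x * q ^ n)) atTop (𝓝 1) := by
    have : ∑' k : ℕ, (if k = 0 then (1 : 𝕜) else 0) = 1 := by simp
    rw [← this]
    obtain ⟨B, hB0, hB⟩ := exists_norm_qPochInv_le hq
    refine tendsto_tsum_of_dominated_convergence (bound := fun k => ‖x‖ ^ k * B)
      ((summable_geometric_of_lt_one (norm_nonneg x) hx).mul_right B) ?_ ?_
    · intro k
      have h1 : Tendsto (fun n : ℕ => x * q ^ n) atTop (𝓝 (x * 0)) :=
        (tendsto_pow_atTop_nhds_zero_of_norm_lt_one hq).const_mul x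
      have h2 := (h1.pow k).mul_const (qPochInv q (k : ℤ))
      rcases Nat.eq_zero_or_pos k with rfl | hk
      · simp [qPochInv_zero hq]
      · simpa [hk.ne'] using h2
    · refine .of_forall fun n k => ?_
      rw [norm_mul, norm_pow]
      gcongr
      · rw [norm_mul, norm_pow]
        exact mul_le_of_le_one_right (norm_nonneg _) (pow_le_one₀ (norm_nonneg _) hq.le)
      · exact hB k
  have hprod : Tendsto (fun n : ℕ => (∏ k ∈ Finset.range n, (1 - x * q ^ k)) * f x) atTop
      (𝓝 (qPochInf x q * f x)) :=
    ((multipliable_qPochInf hq x).hasProd.tendsto_prod_nat).mul_const _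
  have key : qPochInf x q * f x = 1 :=
    tendsto_nhds_unique hprod (hlim.congr hiter)
  have : f x = 1 / qPochInf x q := by
    rw [eq_div_iff (qPochInf_ne_zero_of_norm_lt hq hx), mul_comm, key]
  rw [← this]
  exact (hs x hx).hasSum

end QPochhammer

/-! ### Real q: passage to complex numbers, and signs. -/

section Real

theorem ofReal_qPochInf {q : ℝ} (hq : ‖q‖ < 1) (a : ℝ) :
    ((qPochInf a q : ℝ) : ℂ) = qPochInf (a : ℂ) (q : ℂ) := by
  have := (multipliable_qPochInf hq a).map_tprod Complex.ofRealHom Complex.continuous_ofReal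
  simpa [qPochInf] using this

theorem ofReal_qPoch {q : ℝ} (hq : ‖q‖ < 1) (a : ℝ) (n : ℤ) :
    ((qPoch a q n : ℝ) : ℂ) = qPoch (a : ℂ) (q : ℂ) n := by
  simp [qPoch, ofReal_qPochInf hq]

theorem ofReal_qPochInv {q : ℝ} (hq : ‖q‖ < 1) (n : ℤ) :
    ((qPochInv q n : ℝ) : ℂ) = qPochInv (q : ℂ) n := by
  simp [qPochInv, ofReal_qPochInf hq]

theorem qPochInf_pos {q : ℝ} (hq0 : 0 < q) (hq1 : q < 1) {a : ℝ} (ha : a < 1) :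
    0 < qPochInf a q := by
  have hq : ‖q‖ < 1 := by rwa [Real.norm_of_nonneg hq0.le]
  have hfac : ∀ n : ℕ, 0 < 1 - a * q ^ n := fun n => by
    have h1 : q ^ n ≤ 1 := pow_le_one₀ hq0.le hq1.le
    have h2 : 0 < q ^ n := pow_pos hq0 n
    nlinarith
  refine lt_of_le_of_ne ?_ (qPochInf_ne_zero hq fun n h => ?_).symm
  · exact ge_of_tendsto' (multipliable_qPochInf hq a).hasProd.tendsto_prod_nat
      fun n => Finset.prod_nonneg fun k _ => (hfac k).le
  · have := hfac n
    rw [h] at this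
    simp at this

theorem qPochInv_nonneg {q : ℝ} (hq0 : 0 < q) (hq1 : q < 1) (n : ℤ) : 0 ≤ qPochInv q n := by
  have hq : ‖q‖ < 1 := by rwa [Real.norm_of_nonneg hq0.le]
  rcases lt_or_ge n 0 with hn | hn
  · rw [qPochInv_of_neg hq0.ne' hq hn]
  · obtain ⟨m, rfl⟩ := Int.eq_ofNat_of_zero_le hn
    refine div_nonneg (qPochInf_pos hq0 hq1 ?_).le (qPochInf_pos hq0 hq1 hq1).le
    rw [zpow_natCast, ← pow_succ']
    exact pow_lt_one₀ hq0.le hq1 (by omega)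

theorem qPoch_nonneg {q : ℝ} (hq0 : 0 < q) (hq1 : q < 1) (n : ℤ) : 0 ≤ qPoch q q n := by
  rw [qPoch_self]; exact inv_nonneg.2 (qPochInv_nonneg hq0 hq1 n)

end Real

/-! ### Two-state transfer matrix identities behind the Pieri rules. -/

section Transfer

variable {R : Type*} [CommRing R]

/-- The partition function of a two-state chain with initial state `b`. -/
def chainSum {n : ℕ} (f : Fin (n + 1) → Bool → R) (M : Fin n → Bool → Bool → R) (b : Bool) : R :=
  ∑ e : Fin n → Bool, (∏ i, f i ((Fin.cons b e : Fin (n + 1) → Bool) i)) *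
    ∏ i : Fin n, M i ((Fin.cons b e : Fin (n + 1) → Bool) i.castSucc)
      ((Fin.cons b e : Fin (n + 1) → Bool) i.succ)

theorem sum_bool_fun_succ {n : ℕ} (F : (Fin (n + 1) → Bool) → R) :
    ∑ e, F e = ∑ e : Fin n → Bool, F (Fin.cons false e) + ∑ e : Fin n → Bool, F (Fin.cons true e) := by
  rw [← (Fin.consEquiv fun _ : Fin (n + 1) => Bool).sum_comp, Fintype.sum_prod_type,
    Fintype.sum_bool, add_comm]
  rfl

theorem sum_chain {n : ℕ} (f : Fin (n + 1) → Bool → R) (M : Fin n → Bool → Bool → R) :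
    ∑ e : Fin (n + 1) → Bool, (∏ i, f i (e i)) * ∏ i : Fin n, M i (e i.castSucc) (e i.succ) =
      chainSum f M false + chainSum f M true := by
  rw [sum_bool_fun_succ]; rfl

theorem chainSum_zero (f : Fin 1 → Bool → R) (M : Fin 0 → Bool → Bool → R) (b : Bool) :
    chainSum f M b = f 0 b := by
  simp [chainSum]

theorem prod_mul_prod_succ {n : ℕ} (F : Fin (n + 2) → R) (G : Fin (n + 1) → R) :
    (∏ i, F i) * ∏ i, G i = F 0 * (G 0 * ((∏ i : Fin (n + 1), F i.succ) * ∏ i : Fin n, G i.succ)) := by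
  rw [Fin.prod_univ_succ F, Fin.prod_univ_succ G]; ring

theorem chainSum_succ {n : ℕ} (f : Fin (n + 2) → Bool → R) (M : Fin (n + 1) → Bool → Bool → R)
    (b : Bool) :
    chainSum f M b = f 0 b *
      (M 0 b false * chainSum (fun i => f i.succ) (fun i => M i.succ) false +
        M 0 b true * chainSum (fun i => f i.succ) (fun i => M i.succ) true) := by
  unfold chainSum
  rw [sum_bool_fun_succ, Finset.mul_sum, Finset.mul_sum, mul_add, Finset.mul_sum, Finset.mul_sum]
  congr 1 <;>
  · refine Finset.sum_congr rfl fun e _ => ?_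
    rw [prod_mul_prod_succ]
    rfl

/-- Local weights of the vertical strip chain. -/
def vertWeight (p r : R) : Bool → Bool → R
  | false, false => 1 - p
  | false, true => (1 - p) * (1 - r)
  | true, false => 1 - p * r
  | true, true => 1 - r

/-- The equality of total sums up to 1 + s does not induct by itself, so the initial state is
recorded. The matrix with rows (1, 1 - p₀) and (s, s + p₀) intertwines the two transfer matrices,
and both of its columns sum to 1 + s. -/
theorem chainSum_vert (s : R) {n : ℕ} (p r : Fin (n + 1) → R) :
    let L := chainSum (fun _ b => if b then s else 1) (fun i => vertWeight (p i) (r i))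
    let K := chainSum (fun i b => if b then s * (1 - r i) else 1 - p i)
      (fun (i : Fin n) b b' => if b = false ∧ b' = true then 1 - r i.castSucc * p i.succ else 1)
    L false = K false + (1 - p 0) * K true ∧ L true = s * K false + (s + p 0) * K true := by
  induction n with
  | zero =>
    simp only [chainSum_succ, chainSum_zero, vertWeight]
    constructor <;> simp <;> ring
  | succ n ih =>
    obtain ⟨h1, h2⟩ := ih (fun i => p i.succ) (fun i => r i.succ)
    simp only at h1 h2 ⊢
    rw [chainSum_succ (n := n + 1) (fun _ b => if b = true then s else 1) _ false,
      chainSum_succ (n := n + 1) (fun _ b => if b = true then s else 1) _ true, h1, h2,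
      chainSum_succ (n := n) (fun i b => if b = true then s * (1 - r i) else 1 - p i) _ false,
      chainSum_succ (n := n) (fun i b => if b = true then s * (1 - r i) else 1 - p i) _ true]
    simp only [vertWeight, Fin.succ_castSucc, Fin.succ_zero_eq_one, Fin.castSucc_zero]
    constructor <;> simp <;> ring

theorem sum_vert_chain (s : R) {n : ℕ} (p r : Fin (n + 1) → R) :
    ∑ e : Fin (n + 2) → Bool, (∏ i, if e i then s else 1) *
        ∏ i : Fin (n + 1), vertWeight (p i) (r i) (e i.castSucc) (e i.succ) =
      (1 + s) * ∑ e : Fin (n + 1) → Bool, (∏ i, if e i then s * (1 - r i) else 1 - p i) *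
        ∏ i : Fin n, if e i.castSucc = false ∧ e i.succ = true
          then 1 - r i.castSucc * p i.succ else 1 := by
  obtain ⟨h1, h2⟩ := chainSum_vert s p r
  rw [sum_chain (fun _ b => if b then s else 1) (fun i => vertWeight (p i) (r i)),
    sum_chain (fun i b => if b then s * (1 - r i) else 1 - p i)
      (fun (i : Fin n) b b' => if b = false ∧ b' = true then 1 - r i.castSucc * p i.succ else 1),
    h1, h2]
  ring

/-- Summing over the first bit gives the factor X₀(1 - Y₀) whichever value the second bit has, so
sites can be removed one at a time. -/
theorem sum_hor_chain {n : ℕ} (X : Fin (n + 1) → R) (Y : Fin n → R) :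
    ∑ e : Fin (n + 1) → Bool, (∏ i, if e i then -(1 - X i) else 1) *
        ∏ i : Fin n, (if e i.succ then 1 else 1 - Y i) *
          (if e i.castSucc = false ∧ e i.succ = true then 1 - X i.castSucc * Y i else 1) =
      (∏ i, X i) * ∏ i, (1 - Y i) := by
  rw [sum_chain (fun i b => if b then -(1 - X i) else 1)
    (fun (i : Fin n) b b' => (if b' then 1 else 1 - Y i) *
          (if b = false ∧ b' = true then 1 - X i.castSucc * Y i else 1))]
  induction n with
  | zero => simp [chainSum_zero]
  | succ n ih =>
    rw [chainSum_succ, chainSum_succ, Fin.prod_univ_succ X, Fin.prod_univ_succ fun i => 1 - Y i]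
    have := ih (fun i => X i.succ) (fun i => Y i.succ)
    simp only [Fin.succ_castSucc] at this ⊢
    generalize chainSum (fun i b => if b = true then -(1 - X (Fin.succ i)) else 1) _ false = A at *
    generalize chainSum (fun i b => if b = true then -(1 - X (Fin.succ i)) else 1) _ true = B at *
    simp only [Fin.castSucc_zero]
    have e : X 0 * (∏ i : Fin (n + 1), X i.succ) * ((1 - Y 0) * ∏ i : Fin n, (1 - Y i.succ)) =
      X 0 * (1 - Y 0) * (A + B) := by rw [this]; ring
    rw [e]
    simp
    ring

end Transfer

/-! ### Branching and the vertical strip Pieri rule. -/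

section Pieri

variable {𝕜 : Type*} [RCLike 𝕜] {q : 𝕜}

/-- The integer vector of a 0-1 sequence. -/
def bitVec {n : ℕ} (e : Fin n → Bool) : Fin n → ℤ := fun i => if e i then 1 else 0

/-- The coefficient of `P_{λ+ε}` in the product of `P_λ` with an elementary symmetric polynomial. -/
def vertCoeff (q : 𝕜) : {n : ℕ} → (Fin n → ℤ) → (Fin n → Bool) → 𝕜
  | 0, _, _ => 1
  | n + 1, lam, e => ∏ i : Fin n, if e i.castSucc = false ∧ e i.succ = true
      then 1 - q ^ (lam i.castSucc - lam i.succ) else 1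

theorem skewP_eq_zero (hq0 : q ≠ 0) (hq : ‖q‖ < 1) {n : ℕ} {lam : Fin (n + 1) → ℤ} {mu : Fin n → ℤ}
    (h : ¬ Interlaces lam mu) (w : 𝕜) : skewP q lam mu w = 0 := by
  unfold Interlaces at h
  push Not at h
  obtain ⟨i, hi⟩ := h
  refine mul_eq_zero_of_right _ (Finset.prod_eq_zero (Finset.mem_univ i) ?_)
  by_cases h1 : lam i.succ ≤ mu i
  · rw [qPochInv_of_neg hq0 hq (n := lam i.castSucc - mu i) (by linarith [hi h1])]; simp
  · rw [qPochInv_of_neg hq0 hq (n := mu i - lam i.succ) (by linarith)]; simp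

theorem mem_interlaceBox {n : ℕ} {lam : Fin (n + 1) → ℤ} {mu : Fin n → ℤ} :
    mu ∈ Fintype.piFinset (fun i : Fin n => Finset.Icc (lam i.succ) (lam i.castSucc)) ↔
      Interlaces lam mu := by
  simp [Interlaces, Fintype.mem_piFinset]

theorem Interlaces.antitone {n : ℕ} {lam : Fin (n + 1) → ℤ} {mu : Fin n → ℤ}
    (h : Interlaces lam mu) : Antitone mu := by
  cases n with
  | zero => exact fun a => a.elim0
  | succ n =>
    refine Fin.antitone_iff_succ_le.2 fun i => ?_
    exact (h i.succ).2.trans (by rw [← Fin.succ_castSucc]; exact (h i.castSucc).1)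

theorem finite_support_skewP (hq0 : q ≠ 0) (hq : ‖q‖ < 1) {n : ℕ} (lam : Fin (n + 1) → ℤ) (w : 𝕜)
    (F : (Fin n → ℤ) → 𝕜) : (Function.support fun mu => skewP q lam mu w * F mu).Finite := by
  refine (Fintype.piFinset fun i : Fin n =>
    Finset.Icc (lam i.succ) (lam i.castSucc)).finite_toSet.subset fun mu hmu => ?_
  by_contra h
  refine hmu ?_
  dsimp only
  rw [skewP_eq_zero hq0 hq (fun h' => h (mem_interlaceBox.2 h')), zero_mul]

theorem summable_skewP (hq0 : q ≠ 0) (hq : ‖q‖ < 1) {n : ℕ} (lam : Fin (n + 1) → ℤ) (w : 𝕜)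
    (F : (Fin n → ℤ) → 𝕜) : Summable fun mu => skewP q lam mu w * F mu :=
  summable_of_hasFiniteSupport (finite_support_skewP hq0 hq lam w F)

/-- The summand vanishes off the interlacing box, so the sum may run over all integer rows and the
summation variable may be translated freely. -/
theorem whittakerP_succ (hq0 : q ≠ 0) (hq : ‖q‖ < 1) {n : ℕ} (lam : Fin (n + 1) → ℤ)
    (x : Fin (n + 1) → 𝕜) :
    whittakerP q lam x =
      ∑' mu, skewP q lam mu (x (Fin.last n)) * whittakerP q mu fun i => x i.castSucc := by
  rw [whittakerP, tsum_eq_sum]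
  intro mu hmu
  rw [skewP_eq_zero hq0 hq (fun h' => hmu (mem_interlaceBox.2 h')), zero_mul]

/-- Change of one factor of `skewP` when bits b, b' are added to two neighbouring parts of the upper
row, with A = λ_i - κ_i and B = κ_i - λ_{i+1}. The reference values A + 1 and B make every ratio a
polynomial. -/
theorem vert_local (hq0 : q ≠ 0) (hq : ‖q‖ < 1) {m A B : ℤ} (hm : 0 ≤ m) (hAB : A + B = m)
    (b b' : Bool) :
    (if b = false ∧ b' = true then 1 - q ^ m else 1) *
      (qPoch q q (m + (if b then 1 else 0) - (if b' then 1 else 0)) *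
        qPochInv q (A + if b then 1 else 0) * qPochInv q (B - if b' then 1 else 0)) =
    vertWeight (q ^ (A + 1)) (q ^ B) b b' * (qPoch q q m * qPochInv q (A + 1) * qPochInv q B) := by
  have hA := qPochInv_step hq0 hq A
  have hB := qPochInv_sub_one hq0 hq B
  have hpr : q ^ (A + 1) * q ^ B = q ^ (m + 1) := by
    rw [← zpow_add₀ hq0]; congr 1; omega
  rcases b with _ | _ <;> rcases b' with _ | _ <;> simp only [vertWeight, Bool.false_eq_true,
    if_true, if_false, and_true, and_false, add_zero, sub_zero, one_mul, reduceCtorEq,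
    add_sub_cancel_right]
  · rw [hA]; ring
  · rw [hB, hA]
    rcases hm.lt_or_eq with h | h
    · have := qPoch_add_one hq0 hq (n := m - 1) (by omega)
      rw [sub_add_cancel] at this
      rw [this]; ring
    -- For m = 0 the left side is zero because of 1 - q^0. On the right B = -A, so either some
    -- 1/(q;q) has a negative index or one of 1 - q^{A+1}, 1 - q^B is zero.
    · subst h
      have hB' : B = - A := by omega
      subst hB'
      rcases lt_trichotomy (A + 1) 0 with h | h | h
      · rw [qPochInv_of_neg hq0 hq h]; ring
      · rw [h]; simp
      · rcases eq_or_ne A 0 with rfl | h'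
        · simp
        · rw [qPochInv_of_neg hq0 hq (n := -A) (by omega)]; ring
  · rw [qPoch_add_one hq0 hq hm, hpr]; ring
  · rw [hB]; ring

theorem vert_local' (hq0 : q ≠ 0) (hq : ‖q‖ < 1) (c : 𝕜) (A B : ℤ) (b : Bool) :
    c * qPochInv q (A + if b then 1 else 0) * qPochInv q (B - if b then 1 else 0) =
      (if b then 1 - q ^ B else 1 - q ^ (A + 1)) * (c * qPochInv q (A + 1) * qPochInv q B) := by
  have hA := qPochInv_step hq0 hq A
  have hB := qPochInv_sub_one hq0 hq B
  rcases b with _ | _ <;> simp only [Bool.false_eq_true, if_true, if_false, add_zero, sub_zero]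
  · rw [hA]; ring
  · rw [hB]; ring

theorem pow_sum_bitVec {n : ℕ} (e : Fin n → Bool) {w : 𝕜} (hw : w ≠ 0) :
    w ^ (∑ i, bitVec e i) = ∏ i, if e i then w else 1 := by
  induction n with
  | zero => simp
  | succ n ih =>
    rw [Fin.sum_univ_succ, Fin.prod_univ_succ, zpow_add₀ hw]
    have := ih (fun i => e i.succ)
    simp only [bitVec] at this ⊢
    rw [this]
    congr 1
    split_ifs <;> simp

/-- One branching level of the vertical Pieri rule: a strip added to the upper row is exchanged for
a strip removed from the lower row, at the price of 1 + uw. After the common factor W * Z is taken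
out, this is `sum_vert_chain` with s = uw. -/
theorem skewP_vert (hq0 : q ≠ 0) (hq : ‖q‖ < 1) {n : ℕ} {lam : Fin (n + 1) → ℤ}
    (hlam : Antitone lam) (kap : Fin n → ℤ) {w : 𝕜} (hw : w ≠ 0) (u : 𝕜) :
    ∑ e : Fin (n + 1) → Bool, vertCoeff q lam e * (∏ i, if e i then u else 1) *
        skewP q (lam + bitVec e) kap w =
      (1 + u * w) * ∑ e : Fin n → Bool, skewP q lam (kap - bitVec e) w *
        (vertCoeff q (kap - bitVec e) e * ∏ i, if e i then u else 1) := by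
  set W := w ^ ((∑ i, lam i) - ∑ i, kap i) with hW
  set Z := ∏ i : Fin n, (qPoch q q (lam i.castSucc - lam i.succ) *
    qPochInv q (lam i.castSucc - kap i + 1) * qPochInv q (kap i - lam i.succ)) with hZ
  have hL : ∀ e : Fin (n + 1) → Bool, vertCoeff q lam e * (∏ i, if e i then u else 1) *
        skewP q (lam + bitVec e) kap w = W * Z * ((∏ i, if e i then u * w else 1) *
        ∏ i : Fin n, vertWeight (q ^ (lam i.castSucc - kap i + 1)) (q ^ (kap i - lam i.succ))
          (e i.castSucc) (e i.succ)) := by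
    intro e
    have h1 : ∑ i, (lam + bitVec e) i - ∑ i, kap i = (∑ i, lam i - ∑ i, kap i) + ∑ i, bitVec e i := by
      simp only [Pi.add_apply, Finset.sum_add_distrib]; ring
    have h2 : (∏ i, if e i then u * w else 1) =
        (∏ i, if e i then u else 1) * ∏ i, if e i then w else 1 := by
      rw [← Finset.prod_mul_distrib]
      refine Finset.prod_congr rfl fun i _ => ?_
      split_ifs <;> simp
    have h3 : vertCoeff q lam e * (∏ i : Fin n,
        (qPoch q q ((lam + bitVec e) i.castSucc - (lam + bitVec e) i.succ) *
          qPochInv q ((lam + bitVec e) i.castSucc - kap i) *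
          qPochInv q (kap i - (lam + bitVec e) i.succ))) = Z *
        ∏ i : Fin n, vertWeight (q ^ (lam i.castSucc - kap i + 1)) (q ^ (kap i - lam i.succ))
          (e i.castSucc) (e i.succ) := by
      rw [vertCoeff, hZ, ← Finset.prod_mul_distrib, ← Finset.prod_mul_distrib]
      refine Finset.prod_congr rfl fun i _ => ?_
      have := vert_local hq0 hq (m := lam i.castSucc - lam i.succ) (A := lam i.castSucc - kap i)
        (B := kap i - lam i.succ) (by
          have := hlam (Fin.castSucc_le_succ i); omega) (by ring) (e i.castSucc) (e i.succ)
      rw [mul_comm (vertWeight _ _ _ _)] at this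
      rw [← this]
      have e1 : (lam + bitVec e) i.castSucc - (lam + bitVec e) i.succ = lam i.castSucc - lam i.succ +
          (if e i.castSucc then 1 else 0) - (if e i.succ then 1 else 0) := by
        simp only [Pi.add_apply, bitVec]; ring
      have e2 : (lam + bitVec e) i.castSucc - kap i =
          lam i.castSucc - kap i + if e i.castSucc then 1 else 0 := by
        simp only [Pi.add_apply, bitVec]; ring
      have e3 : kap i - (lam + bitVec e) i.succ =
          kap i - lam i.succ - if e i.succ then 1 else 0 := by
        simp only [Pi.add_apply, bitVec]; ring
      rw [e1, e2, e3]
    rw [skewP, h1, zpow_add₀ hw, pow_sum_bitVec e hw, h2]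
    linear_combination (W * (∏ i, if e i then u else 1) * ∏ i, if e i then w else 1) * h3
  have hR : ∀ e : Fin n → Bool, skewP q lam (kap - bitVec e) w *
        (vertCoeff q (kap - bitVec e) e * ∏ i, if e i then u else 1) =
      W * Z * ((∏ i, if e i then u * w * (1 - q ^ (kap i - lam i.succ))
        else 1 - q ^ (lam i.castSucc - kap i + 1)) * vertCoeff q (kap - bitVec e) e) := by
    intro e
    have h1 : ∑ i, lam i - ∑ i, (kap - bitVec e) i = (∑ i, lam i - ∑ i, kap i) + ∑ i, bitVec e i := by
      simp only [Pi.sub_apply, Finset.sum_sub_distrib]; ring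
    have h3 : (∏ i : Fin n, (qPoch q q (lam i.castSucc - lam i.succ) *
        qPochInv q (lam i.castSucc - (kap - bitVec e) i) *
        qPochInv q ((kap - bitVec e) i - lam i.succ))) * (∏ i, if e i then w else 1) *
        (∏ i, if e i then u else 1) = Z *
        ∏ i, if e i then u * w * (1 - q ^ (kap i - lam i.succ))
          else 1 - q ^ (lam i.castSucc - kap i + 1) := by
      rw [hZ, ← Finset.prod_mul_distrib, ← Finset.prod_mul_distrib, ← Finset.prod_mul_distrib]
      refine Finset.prod_congr rfl fun i _ => ?_
      have := vert_local' hq0 hq (qPoch q q (lam i.castSucc - lam i.succ)) (lam i.castSucc - kap i)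
        (kap i - lam i.succ) (e i)
      have e1 : lam i.castSucc - (kap - bitVec e) i =
        lam i.castSucc - kap i + if e i then 1 else 0 := by simp [bitVec]; ring
      have e2 : (kap - bitVec e) i - lam i.succ =
        kap i - lam i.succ - if e i then 1 else 0 := by simp [bitVec]; ring
      rw [e1, e2, this]
      split_ifs <;> ring
    rw [skewP, h1, zpow_add₀ hw, pow_sum_bitVec e hw]
    linear_combination (W * vertCoeff q (kap - bitVec e) e) * h3
  rw [Finset.sum_congr rfl fun e _ => hL e, Finset.sum_congr rfl fun e _ => hR e,
    ← Finset.mul_sum, ← Finset.mul_sum, mul_left_comm (1 + u * w)]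
  congr 1
  cases n with
  | zero => rw [sum_bool_fun_succ]; simp [vertCoeff]
  | succ n =>
    rw [sum_vert_chain]
    congr 1
    refine Finset.sum_congr rfl fun e _ => ?_
    congr 1
    rw [vertCoeff]
    refine Finset.prod_congr rfl fun i _ => ?_
    split_ifs with h
    · rw [← zpow_add₀ hq0]
      congr 2
      simp only [Pi.sub_apply, bitVec, h.1, h.2, Fin.succ_castSucc]
      simp
      ring
    · rfl

/-- Multiplication of `P_λ` by `∏ (1 + u w_j)`. -/
theorem whittakerP_vert (hq0 : q ≠ 0) (hq : ‖q‖ < 1) {n : ℕ} {lam : Fin n → ℤ}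
    (hlam : Antitone lam) {w : Fin n → 𝕜} (hw : ∀ i, w i ≠ 0) (u : 𝕜) :
    (∏ j, (1 + u * w j)) * whittakerP q lam w =
      ∑ e : Fin n → Bool, vertCoeff q lam e * (∏ i, if e i then u else 1) *
        whittakerP q (lam + bitVec e) w := by
  induction n with
  | zero => simp [vertCoeff, whittakerP]
  | succ n ih =>
    set x := w (Fin.last n)
    set w' : Fin n → 𝕜 := fun i => w i.castSucc
    have h1 : ∀ mu : Fin n → ℤ, (∏ j, (1 + u * w' j)) * (skewP q lam mu x * whittakerP q mu w') =
        ∑ e : Fin n → Bool, skewP q lam mu x * (vertCoeff q mu e * (∏ i, if e i then u else 1) *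
          whittakerP q (mu + bitVec e) w') := by
      intro mu
      by_cases h : Interlaces lam mu
      · rw [← Finset.mul_sum, ← ih h.antitone (fun i => hw _)]; ring
      · simp [skewP_eq_zero hq0 hq h]
    -- Translation by κ = μ + ε collects the terms by the row κ that carries the smaller function,
    -- which is the form required by `skewP_vert`.
    have h2 : ∀ (e : Fin n → Bool), ∑' mu, skewP q lam mu x * (vertCoeff q mu e *
        (∏ i, if e i then u else 1) * whittakerP q (mu + bitVec e) w') =
        ∑' kap, skewP q lam (kap - bitVec e) x * (vertCoeff q (kap - bitVec e) e *
        (∏ i, if e i then u else 1)) * whittakerP q kap w' := by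
      intro e
      rw [← (Equiv.subRight (bitVec e)).tsum_eq]
      refine tsum_congr fun kap => ?_
      simp [mul_assoc]
    have h3 : ∀ (e : Fin n → Bool), Summable fun kap : Fin n → ℤ =>
        skewP q lam (kap - bitVec e) x * (vertCoeff q (kap - bitVec e) e *
        (∏ i, if e i then u else 1)) * whittakerP q kap w' := by
      intro e
      have := summable_skewP hq0 hq lam x (fun mu => (vertCoeff q mu e *
        (∏ i, if e i then u else 1)) * whittakerP q (mu + bitVec e) w')
      rw [← (Equiv.subRight (bitVec e)).summable_iff] at this
      simpa [Function.comp_def, mul_assoc] using this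
    have h4 : ∀ kap : Fin n → ℤ, (1 + u * x) * ∑ e : Fin n → Bool, skewP q lam (kap - bitVec e) x *
        (vertCoeff q (kap - bitVec e) e * (∏ i, if e i then u else 1)) * whittakerP q kap w' =
        ∑ e : Fin (n + 1) → Bool, vertCoeff q lam e * (∏ i, if e i then u else 1) *
        (skewP q (lam + bitVec e) kap x * whittakerP q kap w') := by
      intro kap
      rw [← Finset.sum_mul, ← mul_assoc, ← skewP_vert hq0 hq hlam kap (hw _) u, Finset.sum_mul]
      exact Finset.sum_congr rfl fun e _ => by ring
    rw [whittakerP_succ hq0 hq, Fin.prod_univ_castSucc, mul_comm (∏ j : Fin n, _), mul_assoc,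
      ← tsum_mul_left, tsum_congr h1, Summable.tsum_finsetSum fun e _ => summable_skewP hq0 hq _ _ _,
      Finset.sum_congr rfl fun e _ => h2 e, ← Summable.tsum_finsetSum fun e _ => h3 e,
      ← tsum_mul_left, tsum_congr h4,
      Summable.tsum_finsetSum fun e _ => (summable_skewP hq0 hq _ _ _).mul_left _]
    refine Finset.sum_congr rfl fun e _ => ?_
    rw [tsum_mul_left, ← whittakerP_succ hq0 hq]

end Pieri

/-! ### Horizontal strip coefficients. -/

section HorizontalStrips

variable {𝕜 : Type*} [RCLike 𝕜] {q : 𝕜}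

theorem prod_zpow {ι : Type*} {x : 𝕜} (hx : x ≠ 0) (s : Finset ι) (f : ι → ℤ) :
    ∏ i ∈ s, x ^ f i = x ^ ∑ i ∈ s, f i := by
  classical
  induction s using Finset.induction_on with
  | empty => simp
  | insert a s ha ih => rw [Finset.prod_insert ha, Finset.sum_insert ha, zpow_add₀ hx, ih]

/-- The coefficient of `α^{|ν| - |λ|} P_ν` in the product of `P_λ` with `∏ 1 / (α w_j;q)_∞`. -/
noncomputable def horCoeff (q : 𝕜) {n : ℕ} (lam nu : Fin (n + 1) → ℤ) : 𝕜 :=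
  qPochInv q (nu 0 - lam 0) * ∏ i : Fin n, (qPoch q q (lam i.castSucc - lam i.succ) *
    qPochInv q (lam i.castSucc - nu i.succ) * qPochInv q (nu i.succ - lam i.succ))

/-- `ν / λ` is a horizontal strip. -/
def IsHorStrip {n : ℕ} (lam nu : Fin (n + 1) → ℤ) : Prop :=
  lam 0 ≤ nu 0 ∧ ∀ i : Fin n, lam i.succ ≤ nu i.succ ∧ nu i.succ ≤ lam i.castSucc

theorem horCoeff_eq_zero (hq0 : q ≠ 0) (hq : ‖q‖ < 1) {n : ℕ} {lam nu : Fin (n + 1) → ℤ}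
    (h : ¬ IsHorStrip lam nu) : horCoeff q lam nu = 0 := by
  unfold IsHorStrip at h
  by_cases h0 : lam 0 ≤ nu 0
  · have h' : ¬ ∀ i : Fin n, lam i.succ ≤ nu i.succ ∧ nu i.succ ≤ lam i.castSucc :=
      fun h' => h ⟨h0, h'⟩
    push Not at h'
    obtain ⟨i, hi⟩ := h'
    refine mul_eq_zero_of_right _ (Finset.prod_eq_zero (Finset.mem_univ i) ?_)
    by_cases h1 : lam i.succ ≤ nu i.succ
    · rw [qPochInv_of_neg hq0 hq (n := lam i.castSucc - nu i.succ) (by linarith [hi h1])]; simp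
    · rw [qPochInv_of_neg hq0 hq (n := nu i.succ - lam i.succ) (by linarith)]; simp
  · rw [horCoeff, qPochInv_of_neg hq0 hq (by linarith), zero_mul]

theorem horCoeff_ne_zero (hq : ‖q‖ < 1) {n : ℕ} {lam nu : Fin (n + 1) → ℤ}
    (hlam : Antitone lam) (h : IsHorStrip lam nu) : horCoeff q lam nu ≠ 0 := by
  refine mul_ne_zero (qPochInv_ne_zero hq (by linarith [h.1]))
    (Finset.prod_ne_zero_iff.2 fun i _ => ?_)
  have := hlam (Fin.castSucc_le_succ i)
  exact mul_ne_zero (mul_ne_zero (qPoch_ne_zero hq (by linarith))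
    (qPochInv_ne_zero hq (by linarith [h.2 i]))) (qPochInv_ne_zero hq (by linarith [h.2 i]))

theorem IsHorStrip.le {n : ℕ} {lam nu : Fin (n + 1) → ℤ} (h : IsHorStrip lam nu) : lam ≤ nu := by
  intro i
  refine Fin.cases h.1 (fun i => (h.2 i).1) i

theorem IsHorStrip.antitone {n : ℕ} {lam nu : Fin (n + 1) → ℤ} (h : IsHorStrip lam nu) :
    Antitone nu :=
  Fin.antitone_iff_succ_le.2 fun i => (h.2 i).2.trans (h.le _)

theorem horCoeff_self (hq : ‖q‖ < 1) {n : ℕ} {lam : Fin (n + 1) → ℤ} (hlam : Antitone lam) :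
    horCoeff q lam lam = 1 := by
  rw [horCoeff, sub_self, qPochInv_zero hq, one_mul]
  refine Finset.prod_eq_one fun i _ => ?_
  have := hlam (Fin.castSucc_le_succ i)
  rw [sub_self, qPochInv_zero hq, mul_one, qPoch_mul_qPochInv hq (by linarith)]

/-- A finite set containing all horizontal strips over `lam` of size at most `m`. -/
noncomputable def horBox {n : ℕ} (lam : Fin (n + 1) → ℤ) (m : ℕ) : Finset (Fin (n + 1) → ℤ) :=
  Fintype.piFinset (Fin.cons (Finset.Icc (lam 0) (lam 0 + m))
    fun i : Fin n => Finset.Icc (lam i.succ) (lam i.castSucc))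

theorem mem_horBox {n : ℕ} {lam nu : Fin (n + 1) → ℤ} {m : ℕ} :
    nu ∈ horBox lam m ↔ IsHorStrip lam nu ∧ nu 0 ≤ lam 0 + m := by
  rw [horBox, Fintype.mem_piFinset, Fin.forall_fin_succ]
  simp [IsHorStrip]
  tauto

/-- The first part is the only one not bounded by λ. Bounding it by the size leaves finitely many
strips of each size. -/
theorem IsHorStrip.zero_le {n : ℕ} {lam nu : Fin (n + 1) → ℤ} (h : IsHorStrip lam nu) :
    nu 0 - lam 0 ≤ ∑ i, nu i - ∑ i, lam i := by
  rw [Fin.sum_univ_succ, Fin.sum_univ_succ]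
  have : ∑ i : Fin n, lam i.succ ≤ ∑ i : Fin n, nu i.succ :=
    Finset.sum_le_sum fun i _ => h.le _
  linarith

theorem mem_horBox_of_size {n : ℕ} {lam nu : Fin (n + 1) → ℤ} {m : ℕ} (h : IsHorStrip lam nu)
    (hm : ∑ i, nu i - ∑ i, lam i ≤ m) : nu ∈ horBox lam m :=
  mem_horBox.2 ⟨h, by linarith [h.zero_le]⟩

/-- The equation D(qα) = ∏ (1 - α w_j) D(α) at the level of coefficients: ρ is reached by a
horizontal strip followed by a signed vertical strip, and the signed sum is the coefficient for ρ
times a power of q. It reduces to `sum_hor_chain`, with X_i = q^{ρ_i - λ_i}. -/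
theorem sum_vertCoeff_horCoeff (hq0 : q ≠ 0) (hq : ‖q‖ < 1) {n : ℕ} (lam rho : Fin (n + 1) → ℤ) :
    ∑ e : Fin (n + 1) → Bool, (∏ i, if e i then (-1 : 𝕜) else 1) *
        (horCoeff q lam (rho - bitVec e) * vertCoeff q (rho - bitVec e) e) =
      q ^ (∑ i, rho i - ∑ i, lam i) * horCoeff q lam rho := by
  set Z := qPochInv q (rho 0 - lam 0) * ∏ i : Fin n, (qPoch q q (lam i.castSucc - lam i.succ) *
    qPochInv q (lam i.castSucc - rho i.succ + 1) * qPochInv q (rho i.succ - lam i.succ)) with hZ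
  have h1 : ∀ e : Fin (n + 1) → Bool, (∏ i, if e i then (-1 : 𝕜) else 1) *
        (horCoeff q lam (rho - bitVec e) * vertCoeff q (rho - bitVec e) e) =
      Z * ((∏ i, if e i then -(1 - q ^ (rho i - lam i)) else 1) *
        ∏ i : Fin n, (if e i.succ then 1 else 1 - q ^ (lam i.castSucc - rho i.succ + 1)) *
          (if e i.castSucc = false ∧ e i.succ = true then
            1 - q ^ (rho i.castSucc - lam i.castSucc) * q ^ (lam i.castSucc - rho i.succ + 1)
            else 1)) := by
    intro e
    have hv : vertCoeff q (rho - bitVec e) e = ∏ i : Fin n,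
        (if e i.castSucc = false ∧ e i.succ = true then
            1 - q ^ (rho i.castSucc - lam i.castSucc) * q ^ (lam i.castSucc - rho i.succ + 1)
            else 1) := by
      refine Finset.prod_congr rfl fun i _ => ?_
      split_ifs with h
      · rw [← zpow_add₀ hq0]
        congr 2
        simp only [Pi.sub_apply, bitVec, h.1, h.2]
        simp
        ring
      · rfl
    have h0 : qPochInv q ((rho - bitVec e) 0 - lam 0) = (if e 0 then 1 - q ^ (rho 0 - lam 0) else 1) *
        qPochInv q (rho 0 - lam 0) := by
      simp only [Pi.sub_apply, bitVec]
      split_ifs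
      · rw [← qPochInv_sub_one hq0 hq]; congr 1; ring
      · simp
    have hi : ∀ i : Fin n, qPoch q q (lam i.castSucc - lam i.succ) *
        qPochInv q (lam i.castSucc - (rho - bitVec e) i.succ) *
        qPochInv q ((rho - bitVec e) i.succ - lam i.succ) =
        ((if e i.succ then 1 - q ^ (rho i.succ - lam i.succ) else 1) *
          (if e i.succ then 1 else 1 - q ^ (lam i.castSucc - rho i.succ + 1))) *
        (qPoch q q (lam i.castSucc - lam i.succ) *
          qPochInv q (lam i.castSucc - rho i.succ + 1) * qPochInv q (rho i.succ - lam i.succ)) := by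
      intro i
      have := vert_local' hq0 hq (qPoch q q (lam i.castSucc - lam i.succ))
        (lam i.castSucc - rho i.succ) (rho i.succ - lam i.succ) (e i.succ)
      have e1 : lam i.castSucc - (rho - bitVec e) i.succ =
        lam i.castSucc - rho i.succ + if e i.succ then 1 else 0 := by simp [bitVec]; ring
      have e2 : (rho - bitVec e) i.succ - lam i.succ =
        rho i.succ - lam i.succ - if e i.succ then 1 else 0 := by simp [bitVec]; ring
      rw [e1, e2, this]
      split_ifs <;> ring
    rw [horCoeff, hv, h0, Finset.prod_congr rfl fun i _ => hi i, Finset.prod_mul_distrib,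
      Finset.prod_mul_distrib, hZ, Finset.prod_mul_distrib (s := Finset.univ) (f := fun i : Fin n =>
        if e i.succ then (1 : 𝕜) else 1 - q ^ (lam i.castSucc - rho i.succ + 1))]
    have hs : (∏ i, if e i then -(1 - q ^ (rho i - lam i)) else 1) =
        (∏ i, if e i then (-1 : 𝕜) else 1) * ((if e 0 then 1 - q ^ (rho 0 - lam 0) else 1) *
          ∏ i : Fin n, if e i.succ then 1 - q ^ (rho i.succ - lam i.succ) else 1) := by
      rw [← Fin.prod_univ_succ fun i => if e i then 1 - q ^ (rho i - lam i) else 1,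
        ← Finset.prod_mul_distrib]
      refine Finset.prod_congr rfl fun i _ => ?_
      split_ifs <;> simp
    rw [hs]
    ring
  rw [Finset.sum_congr rfl fun e _ => h1 e, ← Finset.mul_sum,
    sum_hor_chain (fun i => q ^ (rho i - lam i)) fun i => q ^ (lam i.castSucc - rho i.succ + 1)]
  have h2 : ∏ i, q ^ (rho i - lam i) = q ^ (∑ i, rho i - ∑ i, lam i) := by
    rw [← Finset.sum_sub_distrib, prod_zpow hq0]
  have h3 : horCoeff q lam rho = Z * ∏ i : Fin n, (1 - q ^ (lam i.castSucc - rho i.succ + 1)) := by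
    rw [horCoeff, hZ, mul_assoc, ← Finset.prod_mul_distrib]
    congr 1
    refine Finset.prod_congr rfl fun i _ => ?_
    rw [qPochInv_step hq0 hq (lam i.castSucc - rho i.succ)]
    ring
  rw [h2, h3]
  ring

end HorizontalStrips

/-! ### The horizontal strip Pieri rule by power series in α. -/

section Series

open PowerSeries

variable {𝕜 : Type*} [RCLike 𝕜] {q : 𝕜}

/-- The power series of `∏ 1 / (α w_j;q)_∞` in `α`. -/
noncomputable def gSeries (q : 𝕜) {n : ℕ} (w : Fin n → 𝕜) : 𝕜⟦X⟧ :=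
  ∏ j, PowerSeries.mk fun k => w j ^ k * qPochInv q (k : ℤ)

/-- The coefficients of `∏ 1 / (α w_j;q)_∞` in `α`. -/
noncomputable def gCoeff (q : 𝕜) {n : ℕ} (w : Fin n → 𝕜) (k : ℕ) : 𝕜 := coeff k (gSeries q w)

theorem qExp_rescale (hq0 : q ≠ 0) (hq : ‖q‖ < 1) (x : 𝕜) :
    (PowerSeries.mk fun k => (q * x) ^ k * qPochInv q (k : ℤ)) =
      (1 - C x * X) * PowerSeries.mk fun k => x ^ k * qPochInv q (k : ℤ) := by
  ext k
  rw [sub_mul, one_mul, map_sub, mul_assoc, coeff_C_mul]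
  cases k with
  | zero => simp
  | succ k =>
    rw [coeff_succ_X_mul, coeff_mk, coeff_mk, coeff_mk, qPochInv_step hq0 hq (k : ℤ)]
    push_cast
    rw [show q ^ ((k : ℤ) + 1) = q ^ (k + 1) by exact_mod_cast zpow_natCast q (k + 1)]
    ring

theorem rescale_gSeries (hq0 : q ≠ 0) (hq : ‖q‖ < 1) {n : ℕ} (w : Fin n → 𝕜) :
    rescale q (gSeries q w) = (∏ j, (1 - C (w j) * X)) * gSeries q w := by
  rw [gSeries, map_prod, ← Finset.prod_mul_distrib]
  refine Finset.prod_congr rfl fun j _ => ?_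
  rw [← qExp_rescale hq0 hq]
  ext k
  simp [coeff_rescale, mul_pow, mul_assoc]

theorem coeff_zero_gSeries (hq : ‖q‖ < 1) {n : ℕ} (w : Fin n → 𝕜) :
    coeff 0 (gSeries q w) = 1 := by
  rw [coeff_zero_eq_constantCoeff_apply, gSeries, map_prod]
  simp [← coeff_zero_eq_constantCoeff_apply, qPochInv_zero hq]

/-- If all lower coefficients vanish, the coefficient of Xⁿ gives qⁿ d_n = d_n, and qⁿ ≠ 1 for n >
0. -/
theorem series_eq_zero_of_rescale (hq : ‖q‖ < 1) {E D : 𝕜⟦X⟧} (hE : coeff 0 E = 1)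
    (hD : coeff 0 D = 0) (h : rescale q D = E * D) : D = 0 := by
  ext n
  rw [map_zero]
  induction n using Nat.strong_induction_on with
  | _ n ih =>
    rcases Nat.eq_zero_or_pos n with rfl | hn
    · exact hD
    · have h1 := congrArg (coeff n) h
      rw [coeff_rescale, coeff_mul, Finset.sum_eq_single (0, n)] at h1
      · rw [hE, one_mul] at h1
        have h2 := one_sub_pow_ne_zero hq hn.ne'
        have h3 : (1 - q ^ n) * coeff n D = 0 := by rw [sub_mul, one_mul, h1, sub_self]
        exact (mul_eq_zero.1 h3).resolve_left h2
      · rintro ⟨a, b⟩ hab hne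
        rw [Finset.HasAntidiagonal.mem_antidiagonal] at hab
        simp only at hab ⊢
        rw [ih b, mul_zero]
        rcases Nat.eq_zero_or_pos a with rfl | ha
        · exact absurd (by simp; omega) hne
        · omega
      · intro h; exact absurd (Finset.HasAntidiagonal.mem_antidiagonal.2 (zero_add n)) h

/-- The number of ones of a 0-1 sequence. -/
def bitCard {n : ℕ} (e : Fin n → Bool) : ℕ := ∑ i, if e i then 1 else 0

theorem bitCard_cast {n : ℕ} (e : Fin n → Bool) : (bitCard e : ℤ) = ∑ i, bitVec e i := by
  simp [bitCard, bitVec]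

/-- `whittakerP_vert` holds for every value u, hence as an identity of polynomials over an infinite
field, hence of power series. -/
theorem vert_series (hq0 : q ≠ 0) (hq : ‖q‖ < 1) {n : ℕ} {lam : Fin n → ℤ}
    (hlam : Antitone lam) {w : Fin n → 𝕜} (hw : ∀ i, w i ≠ 0) :
    (∏ j, (1 - C (w j) * X)) * C (whittakerP q lam w) =
      ∑ e : Fin n → Bool, C ((∏ i, if e i then (-1 : 𝕜) else 1) * vertCoeff q lam e *
        whittakerP q (lam + bitVec e) w) * X ^ bitCard e := by
  have key : (∏ j, (1 - Polynomial.C (w j) * Polynomial.X)) * Polynomial.C (whittakerP q lam w) =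
      ∑ e : Fin n → Bool, Polynomial.C ((∏ i, if e i then (-1 : 𝕜) else 1) * vertCoeff q lam e *
        whittakerP q (lam + bitVec e) w) * Polynomial.X ^ bitCard e := by
    refine Polynomial.funext fun u => ?_
    have := whittakerP_vert hq0 hq hlam hw (-u)
    simp only [Polynomial.eval_mul, Polynomial.eval_prod, Polynomial.eval_sub, Polynomial.eval_one,
      Polynomial.eval_C, Polynomial.eval_X, Polynomial.eval_finsetSum, Polynomial.eval_pow]
    have e1 : ∀ j, 1 - w j * u = 1 + -u * w j := fun j => by ring
    simp only [e1]
    rw [this]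
    refine Finset.sum_congr rfl fun e _ => ?_
    have e2 : (∏ i, if e i then -u else 1) = (∏ i, if e i then (-1 : 𝕜) else 1) * u ^ bitCard e := by
      rw [bitCard, ← Finset.prod_pow_eq_pow_sum, ← Finset.prod_mul_distrib]
      refine Finset.prod_congr rfl fun i _ => ?_
      split_ifs <;> simp
    rw [e2]
    ring
  have := congrArg (fun p : Polynomial 𝕜 => (p : 𝕜⟦X⟧)) key
  simp only [Polynomial.coe_mul] at this
  have hp : ∀ (s : Finset (Fin n)), ((∏ j ∈ s, (1 - Polynomial.C (w j) * Polynomial.X) :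
      Polynomial 𝕜) : 𝕜⟦X⟧) = ∏ j ∈ s, (1 - C (w j) * X) := by
    intro s
    rw [← Polynomial.coeToPowerSeries.ringHom_apply, map_prod]
    simp
  have hs : ∀ F : (Fin n → Bool) → Polynomial 𝕜, ((∑ e, F e : Polynomial 𝕜) : 𝕜⟦X⟧) =
      ∑ e, (F e : 𝕜⟦X⟧) := by
    intro F
    simp_rw [← Polynomial.coeToPowerSeries.ringHom_apply]
    rw [map_sum]
  rw [hp, hs] at this
  simpa only [Polynomial.coe_mul, Polynomial.coe_C, Polynomial.coe_pow, Polynomial.coe_X] using this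

theorem mem_horBox_of_ne (hq0 : q ≠ 0) (hq : ‖q‖ < 1) {n : ℕ} {lam nu : Fin (n + 1) → ℤ} {m : ℤ}
    {c : 𝕜} (hnu : (if ∑ i, nu i - ∑ i, lam i = m then horCoeff q lam nu * c else 0) ≠ 0) :
    nu ∈ horBox lam m.toNat := by
  rw [ne_eq, ite_eq_right_iff, Classical.not_imp] at hnu
  have hs : IsHorStrip lam nu := by
    by_contra h
    exact hnu.2 (by rw [horCoeff_eq_zero hq0 hq h, zero_mul])
  exact mem_horBox_of_size hs (by have := hnu.1; omega)

theorem summable_hor (hq0 : q ≠ 0) (hq : ‖q‖ < 1) {n : ℕ} (lam : Fin (n + 1) → ℤ) (m : ℤ)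
    (F : (Fin (n + 1) → ℤ) → 𝕜) :
    Summable fun nu => if ∑ i, nu i - ∑ i, lam i = m then horCoeff q lam nu * F nu else 0 :=
  summable_of_hasFiniteSupport ((Finset.finite_toSet (horBox lam m.toNat)).subset
    fun _ h => mem_horBox_of_ne hq0 hq h)

/-- The series `∑ α^{|ν| - |λ|} φ_{ν/λ} P_ν`. -/
noncomputable def horSeries (q : 𝕜) {n : ℕ} (lam : Fin (n + 1) → ℤ) (w : Fin (n + 1) → 𝕜) : 𝕜⟦X⟧ :=
  PowerSeries.mk fun m => ∑' nu, if ∑ i, nu i - ∑ i, lam i = m then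
    horCoeff q lam nu * whittakerP q nu w else 0

theorem rescale_horSeries (hq0 : q ≠ 0) (hq : ‖q‖ < 1) {n : ℕ} (lam : Fin (n + 1) → ℤ)
    {w : Fin (n + 1) → 𝕜} (hw : ∀ i, w i ≠ 0) :
    rescale q (horSeries q lam w) = (∏ j, (1 - C (w j) * X)) * horSeries q lam w := by
  ext m
  -- There are infinitely many strips over λ, but the coefficient of X^m involves only those of size
  -- at most m. A finite truncation avoids infinite sums of power series.
  set Tm : 𝕜⟦X⟧ := ∑ nu ∈ horBox lam m, C (horCoeff q lam nu * whittakerP q nu w) *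
    X ^ (∑ i, nu i - ∑ i, lam i).toNat with hTm
  have hT : ∀ b ≤ m, coeff b (horSeries q lam w) = coeff b Tm := by
    intro b hb
    rw [horSeries, coeff_mk, tsum_eq_sum (s := horBox lam m), hTm, map_sum]
    · refine Finset.sum_congr rfl fun nu hnu => ?_
      rw [coeff_C_mul_X_pow]
      have := (mem_horBox.1 hnu).1.zero_le
      have := (mem_horBox.1 hnu).1.1
      congr 1
      simp only [eq_iff_iff]
      omega
    · intro nu hnu
      by_contra h
      have h1 := mem_horBox.1 (mem_horBox_of_ne hq0 hq h)
      exact hnu (mem_horBox.2 ⟨h1.1, by have := h1.2; omega⟩)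
  have hE : coeff m ((∏ j, (1 - C (w j) * X)) * horSeries q lam w) =
      coeff m ((∏ j, (1 - C (w j) * X)) * Tm) := by
    rw [coeff_mul, coeff_mul]
    refine Finset.sum_congr rfl fun p hp => ?_
    rw [hT _ (by rw [Finset.HasAntidiagonal.mem_antidiagonal] at hp; omega)]
  have h1 : (∏ j, (1 - C (w j) * X)) * Tm = ∑ nu ∈ horBox lam m, ∑ e : Fin (n + 1) → Bool,
      C (horCoeff q lam nu * ((∏ i, if e i then (-1 : 𝕜) else 1) * vertCoeff q nu e *
        whittakerP q (nu + bitVec e) w)) * X ^ ((∑ i, nu i - ∑ i, lam i).toNat + bitCard e) := by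
    rw [hTm, Finset.mul_sum]
    refine Finset.sum_congr rfl fun nu hnu => ?_
    have h2 := vert_series hq0 hq (mem_horBox.1 hnu).1.antitone hw
    have h3 : (∏ j, (1 - C (w j) * X)) * (C (horCoeff q lam nu * whittakerP q nu w) *
        X ^ (∑ i, nu i - ∑ i, lam i).toNat) = C (horCoeff q lam nu) *
        X ^ (∑ i, nu i - ∑ i, lam i).toNat *
        ((∏ j, (1 - C (w j) * X)) * C (whittakerP q nu w)) := by
      rw [map_mul]; ring
    rw [h3, h2, Finset.mul_sum]
    refine Finset.sum_congr rfl fun e _ => ?_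
    rw [map_mul C (horCoeff q lam nu), pow_add]
    ring
  have h2 : coeff m ((∏ j, (1 - C (w j) * X)) * Tm) = ∑ e : Fin (n + 1) → Bool,
      ∑' nu, if ∑ i, nu i - ∑ i, lam i = (m : ℤ) - bitCard e then horCoeff q lam nu *
        ((∏ i, if e i then (-1 : 𝕜) else 1) * vertCoeff q nu e *
        whittakerP q (nu + bitVec e) w) else 0 := by
    rw [h1, Finset.sum_comm, map_sum]
    refine Finset.sum_congr rfl fun e _ => ?_
    rw [map_sum, tsum_eq_sum (s := horBox lam m)]
    · refine Finset.sum_congr rfl fun nu hnu => ?_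
      rw [coeff_C_mul_X_pow]
      have := (mem_horBox.1 hnu).1.zero_le
      have := (mem_horBox.1 hnu).1.1
      congr 1
      simp only [eq_iff_iff]
      omega
    · intro nu hnu
      by_contra h
      have h1 := mem_horBox.1 (mem_horBox_of_ne hq0 hq h)
      exact hnu (mem_horBox.2 ⟨h1.1, by have := h1.2; omega⟩)
  -- Substituting ρ = ν + ε groups the terms by the final row, where `sum_vertCoeff_horCoeff`
  -- applies.
  have h3 : ∀ e : Fin (n + 1) → Bool,
      (∑' nu, if ∑ i, nu i - ∑ i, lam i = (m : ℤ) - bitCard e then horCoeff q lam nu *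
        ((∏ i, if e i then (-1 : 𝕜) else 1) * vertCoeff q nu e *
        whittakerP q (nu + bitVec e) w) else 0) =
      ∑' rho, if ∑ i, rho i - ∑ i, lam i = (m : ℤ) then ((∏ i, if e i then (-1 : 𝕜) else 1) *
        (horCoeff q lam (rho - bitVec e) * vertCoeff q (rho - bitVec e) e)) * whittakerP q rho w
        else 0 := by
    intro e
    rw [← (Equiv.subRight (bitVec e)).tsum_eq]
    refine tsum_congr fun rho => ?_
    have h4 : (∑ i, (rho - bitVec e) i - ∑ i, lam i = (m : ℤ) - bitCard e) ↔
        ∑ i, rho i - ∑ i, lam i = (m : ℤ) := by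
      rw [bitCard_cast]
      simp only [Pi.sub_apply, Finset.sum_sub_distrib]
      omega
    simp only [Equiv.subRight_apply, h4, sub_add_cancel]
    refine if_congr Iff.rfl ?_ rfl
    ring
  have h3s : ∀ e : Fin (n + 1) → Bool,
      Summable fun rho : Fin (n + 1) → ℤ => if ∑ i, rho i - ∑ i, lam i = (m : ℤ) then
        ((∏ i, if e i then (-1 : 𝕜) else 1) *
        (horCoeff q lam (rho - bitVec e) * vertCoeff q (rho - bitVec e) e)) * whittakerP q rho w
        else 0 := by
    intro e
    refine summable_of_hasFiniteSupport (((Finset.finite_toSet (horBox lam m)).image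
      (fun nu => nu + bitVec e)).subset fun rho hrho => ?_)
    rw [Function.mem_support, ne_eq, ite_eq_right_iff, Classical.not_imp] at hrho
    refine ⟨rho - bitVec e, ?_, by simp⟩
    have hs : IsHorStrip lam (rho - bitVec e) := by
      by_contra h
      exact hrho.2 (by rw [horCoeff_eq_zero hq0 hq h]; ring)
    refine mem_horBox_of_size hs ?_
    have := hrho.1
    have h5 := bitCard_cast e
    simp only [Pi.sub_apply, Finset.sum_sub_distrib]
    omega
  rw [hE, h2, Finset.sum_congr rfl fun e _ => h3 e, ← Summable.tsum_finsetSum fun e _ => h3s e,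
    coeff_rescale, horSeries, coeff_mk, ← tsum_mul_left]
  refine tsum_congr fun rho => ?_
  by_cases h : ∑ i, rho i - ∑ i, lam i = (m : ℤ)
  · simp only [h, if_true]
    rw [← Finset.sum_mul, sum_vertCoeff_horCoeff hq0 hq, h, zpow_natCast]
    ring
  · simp [h]

theorem coeff_zero_horSeries (hq0 : q ≠ 0) (hq : ‖q‖ < 1) {n : ℕ} {lam : Fin (n + 1) → ℤ}
    (hlam : Antitone lam) (w : Fin (n + 1) → 𝕜) :
    coeff 0 (horSeries q lam w) = whittakerP q lam w := by
  rw [horSeries, coeff_mk, tsum_eq_single lam]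
  · simp [horCoeff_self hq hlam]
  · intro nu hnu
    rw [ite_eq_right_iff]
    intro h
    by_cases hs : IsHorStrip lam nu
    · refine absurd ?_ hnu
      have h1 : ∑ i, lam i = ∑ i, nu i := by simp at h; linarith
      exact funext fun i =>
        ((Finset.sum_eq_sum_iff_of_le fun i _ => hs.le i).1 h1 i (Finset.mem_univ _)).symm
    · rw [horCoeff_eq_zero hq0 hq hs, zero_mul]

/-- The Pieri rule for the multiplication with `∏ 1 / (α w_j;q)_∞`. -/
theorem gCoeff_mul_whittakerP (hq0 : q ≠ 0) (hq : ‖q‖ < 1) {n : ℕ} {lam : Fin (n + 1) → ℤ}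
    (hlam : Antitone lam) {w : Fin (n + 1) → 𝕜} (hw : ∀ i, w i ≠ 0) (m : ℕ) :
    gCoeff q w m * whittakerP q lam w = ∑' nu, if ∑ i, nu i - ∑ i, lam i = m then
      horCoeff q lam nu * whittakerP q nu w else 0 := by
  -- The difference of the two sides satisfies the homogeneous equation and has constant term P_λ -
  -- P_λ = 0.
  have h := series_eq_zero_of_rescale hq (E := ∏ j, (1 - C (w j) * X))
    (D := horSeries q lam w - gSeries q w * C (whittakerP q lam w)) ?_ ?_ ?_
  · have h1 := congrArg (coeff m) (sub_eq_zero.1 h)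
    rw [coeff_mul_C, horSeries, coeff_mk] at h1
    rw [gCoeff, h1]
  · rw [coeff_zero_eq_constantCoeff_apply, map_prod]
    simp
  · rw [map_sub, coeff_zero_horSeries hq0 hq hlam, coeff_mul_C, coeff_zero_gSeries hq, one_mul,
      sub_self]
  · rw [map_sub, map_mul, rescale_horSeries hq0 hq lam hw, rescale_gSeries hq0 hq]
    have : rescale q (C (whittakerP q lam w)) = C (whittakerP q lam w) := by
      ext k
      rw [coeff_rescale, coeff_C]
      split_ifs with hk <;> simp [hk]
    rw [this]
    ring

end Series

/-! ### Averages over the torus and deformation of contours. -/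

section TorusAverage

/-- The point `(e^{-iθ_1}, …, e^{-iθ_n})` of the torus. -/
noncomputable def torusPt {n : ℕ} (θ : Fin n → ℝ) : Fin n → ℂ :=
  fun i => Complex.exp (-(θ i * Complex.I))

/-- The average of a function over the torus. -/
noncomputable def torusAvg {n : ℕ} (f : (Fin n → ℂ) → ℂ) : ℂ :=
  ((2 * Real.pi : ℝ) ^ n : ℂ)⁻¹ *
    ∫ θ in Set.Icc (0 : Fin n → ℝ) fun _ => 2 * Real.pi, f (torusPt θ)

/-- The torus `|w_1| = ⋯ = |w_n| = 1`. -/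
def unitTorus (n : ℕ) : Set (Fin n → ℂ) := {w | ∀ i, ‖w i‖ = 1}

/-- The points of `ℂⁿ` with non-zero coordinates. -/
def unitsSet (n : ℕ) : Set (Fin n → ℂ) := {w | ∀ i, w i ≠ 0}

theorem unitTorus_subset (n : ℕ) : unitTorus n ⊆ unitsSet n := fun w hw i h => by
  have := hw i
  rw [h] at this
  simp at this

theorem norm_exp_neg_mul_I (t : ℝ) : ‖Complex.exp (-(t * Complex.I))‖ = 1 := by
  rw [← neg_mul, ← Complex.ofReal_neg, Complex.norm_exp_ofReal_mul_I]

theorem torusPt_mem {n : ℕ} (θ : Fin n → ℝ) : torusPt θ ∈ unitTorus n :=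
  fun i => norm_exp_neg_mul_I (θ i)

theorem continuous_torusPt {n : ℕ} : Continuous (torusPt (n := n)) := by
  unfold torusPt; fun_prop

theorem continuous_comp_torusPt {n : ℕ} {f : (Fin n → ℂ) → ℂ} (hf : ContinuousOn f (unitTorus n)) :
    Continuous fun θ => f (torusPt θ) :=
  hf.comp_continuous continuous_torusPt torusPt_mem

theorem integrable_comp_torusPt {n : ℕ} {f : (Fin n → ℂ) → ℂ}
    (hf : ContinuousOn f (unitTorus n)) :
    IntegrableOn (fun θ => f (torusPt θ)) (Set.Icc (0 : Fin n → ℝ) fun _ => 2 * Real.pi) :=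
  (continuous_comp_torusPt hf).continuousOn.integrableOn_compact isCompact_Icc

theorem torusAvg_congr {n : ℕ} {f g : (Fin n → ℂ) → ℂ} (h : Set.EqOn f g (unitTorus n)) :
    torusAvg f = torusAvg g := by
  unfold torusAvg
  simp_rw [fun θ => h (torusPt_mem θ)]

theorem torusAvg_add {n : ℕ} {f g : (Fin n → ℂ) → ℂ} (hf : ContinuousOn f (unitTorus n))
    (hg : ContinuousOn g (unitTorus n)) :
    torusAvg (fun w => f w + g w) = torusAvg f + torusAvg g := by
  unfold torusAvg
  rw [integral_add (integrable_comp_torusPt hf) (integrable_comp_torusPt hg), mul_add]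

theorem torusAvg_sub {n : ℕ} {f g : (Fin n → ℂ) → ℂ} (hf : ContinuousOn f (unitTorus n))
    (hg : ContinuousOn g (unitTorus n)) :
    torusAvg (fun w => f w - g w) = torusAvg f - torusAvg g := by
  unfold torusAvg
  rw [integral_sub (integrable_comp_torusPt hf) (integrable_comp_torusPt hg), mul_sub]

theorem torusAvg_const_mul {n : ℕ} (c : ℂ) (f : (Fin n → ℂ) → ℂ) :
    torusAvg (fun w => c * f w) = c * torusAvg f := by
  unfold torusAvg
  rw [integral_const_mul, mul_left_comm]

theorem torusAvg_sum {n : ℕ} {ι : Type*} (s : Finset ι) {f : ι → (Fin n → ℂ) → ℂ}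
    (hf : ∀ i ∈ s, ContinuousOn (f i) (unitTorus n)) :
    torusAvg (fun w => ∑ i ∈ s, f i w) = ∑ i ∈ s, torusAvg (f i) := by
  unfold torusAvg
  rw [integral_finsetSum _ fun i hi => integrable_comp_torusPt (hf i hi), Finset.mul_sum]

theorem two_pi_ne_zero' : ((2 * Real.pi : ℝ) : ℂ) ≠ 0 :=
  Complex.ofReal_ne_zero.2 Real.two_pi_pos.ne'

theorem torusAvg_const {n : ℕ} (c : ℂ) : torusAvg (fun _ : Fin n → ℂ => c) = c := by
  unfold torusAvg
  rw [setIntegral_const, measureReal_def, Real.volume_Icc_pi_toReal]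
  · simp only [Pi.zero_apply, sub_zero, Finset.prod_const, Finset.card_univ, Fintype.card_fin,
      Complex.real_smul]
    have := two_pi_ne_zero'
    push_cast at this ⊢
    field_simp
  · intro i
    exact Real.two_pi_pos.le

theorem torusAvg_dim0 (f : (Fin 0 → ℂ) → ℂ) : torusAvg f = f 0 := by
  have : f = fun _ => f 0 := funext fun w => by rw [Subsingleton.elim w 0]
  rw [this, torusAvg_const]

/-- Substitution w = 1/z: the angle changes sign, which is why `torusPt` uses e^{-iθ}, and each dz/z
contributes i dθ. -/
theorem torusIntegral_eq_torusAvg {n : ℕ} (f : (Fin n → ℂ) → ℂ) :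
    torusIntegral (fun z => (∏ i, 1 / z i) * f fun i => 1 / z i) 0 1 =
      (2 * (Real.pi : ℂ) * Complex.I) ^ n * torusAvg f := by
  unfold torusIntegral torusAvg
  have h : ∀ θ : Fin n → ℝ, ((∏ i, (((1 : Fin n → ℝ) i : ℝ) : ℂ) * Complex.exp (θ i * Complex.I) *
      Complex.I) • ((∏ i, 1 / torusMap 0 1 θ i) * f fun i => 1 / torusMap 0 1 θ i) : ℂ) =
      Complex.I ^ n * f (torusPt θ) := by
    intro θ
    have h1 : (fun i => 1 / torusMap 0 1 θ i) = torusPt θ := by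
      funext i
      simp [torusMap, torusPt, Complex.exp_neg]
    have h2 : (∏ i, (((1 : Fin n → ℝ) i : ℝ) : ℂ) * Complex.exp (θ i * Complex.I) * Complex.I) *
        (∏ i, 1 / torusMap 0 1 θ i) = Complex.I ^ n := by
      rw [← Finset.prod_mul_distrib]
      have : ∀ i, (((1 : Fin n → ℝ) i : ℝ) : ℂ) * Complex.exp (θ i * Complex.I) * Complex.I *
          (1 / torusMap 0 1 θ i) = Complex.I := by
        intro i
        have := Complex.exp_ne_zero (θ i * Complex.I)
        simp [torusMap]
        field_simp
      rw [Finset.prod_congr rfl fun i _ => this i]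
      simp
    rw [smul_eq_mul, ← mul_assoc, h2, h1]
  simp_rw [h]
  rw [integral_const_mul, ← mul_assoc]
  congr 1
  have := two_pi_ne_zero'
  push_cast at this ⊢
  rw [mul_pow _ Complex.I]
  field_simp

theorem insertNth_torusPt {n : ℕ} (i : Fin (n + 1)) (t : ℝ) (θ : Fin n → ℝ) :
    torusPt (i.insertNth t θ : Fin (n + 1) → ℝ) =
      (i.insertNth (Complex.exp (-(t * Complex.I))) (torusPt θ) : Fin (n + 1) → ℂ) := by
  funext j
  refine Fin.succAboveCases i ?_ (fun k => ?_) j <;> simp [torusPt]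

theorem integral_Icc_pi_succ {n : ℕ} (i : Fin (n + 1)) {F : (Fin (n + 1) → ℝ) → ℂ}
    (hF : Continuous F) :
    (∫ θ in Set.Icc (0 : Fin (n + 1) → ℝ) fun _ => 2 * Real.pi, F θ) =
      ∫ θ in Set.Icc (0 : Fin n → ℝ) fun _ => 2 * Real.pi, ∫ t in Set.Icc (0 : ℝ) (2 * Real.pi),
        F (i.insertNth t θ) := by
  set em := (MeasurableEquiv.piFinSuccAbove (fun _ : Fin (n + 1) => ℝ) i).symm with hem
  have hmp : MeasurePreserving em (volume.prod volume) volume :=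
    (volume_preserving_piFinSuccAbove (fun _ : Fin (n + 1) => ℝ) i).symm _
  have hpre : em ⁻¹' (Set.Icc (0 : Fin (n + 1) → ℝ) fun _ => 2 * Real.pi) =
      Set.Icc (0 : ℝ) (2 * Real.pi) ×ˢ Set.Icc (0 : Fin n → ℝ) (fun _ => 2 * Real.pi) := by
    exact ((Fin.insertNthOrderIso (fun _ => ℝ) i).preimage_Icc _ _).trans
      (Set.Icc_prod_eq _ _)
  have hc : Continuous fun p : ℝ × (Fin n → ℝ) => F (i.insertNth p.1 p.2) := by
    refine hF.comp (continuous_pi fun j => ?_)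
    refine Fin.succAboveCases i ?_ (fun k => ?_) j <;> simp <;> fun_prop
  have hint : IntegrableOn (fun p : ℝ × (Fin n → ℝ) => F (i.insertNth p.1 p.2))
      (Set.Icc (0 : ℝ) (2 * Real.pi) ×ˢ Set.Icc (0 : Fin n → ℝ) (fun _ => 2 * Real.pi))
      (volume.prod volume) :=
    hc.continuousOn.integrableOn_compact (isCompact_Icc.prod isCompact_Icc)
  have h0 : (∫ θ in Set.Icc (0 : Fin (n + 1) → ℝ) fun _ => 2 * Real.pi, F θ) =
      ∫ p in Set.Icc (0 : ℝ) (2 * Real.pi) ×ˢ Set.Icc (0 : Fin n → ℝ) (fun _ => 2 * Real.pi),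
        F (i.insertNth p.1 p.2) ∂(volume.prod volume) := by
    rw [← hmp.map_eq, setIntegral_map_equiv, hpre]
    rfl
  rw [h0, ← Measure.prod_restrict, integral_prod_symm]
  rw [Measure.prod_restrict]
  exact hint

theorem torusAvg_succ_right {n : ℕ} (i : Fin (n + 1)) {f : (Fin (n + 1) → ℂ) → ℂ}
    (hf : ContinuousOn f (unitTorus (n + 1))) :
    torusAvg f = torusAvg fun y => ((2 * Real.pi : ℝ) : ℂ)⁻¹ *
      ∫ t in Set.Icc (0 : ℝ) (2 * Real.pi), f (i.insertNth (Complex.exp (-(t * Complex.I))) y) := by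
  unfold torusAvg
  rw [integral_Icc_pi_succ i (continuous_comp_torusPt hf), integral_const_mul, pow_succ,
    mul_inv, mul_assoc]
  simp_rw [insertNth_torusPt]

theorem integral_exp_eq_circleIntegral (h : ℂ → ℂ) (r : ℝ) (hr : r ≠ 0) :
    (∮ z in C(0, r⁻¹), z⁻¹ • h z⁻¹) =
      Complex.I * ∫ t in Set.Icc (0 : ℝ) (2 * Real.pi), h (r * Complex.exp (-(t * Complex.I))) := by
  rw [circleIntegral, integral_Icc_eq_integral_Ioc, ← intervalIntegral.integral_of_le
    Real.two_pi_pos.le, ← intervalIntegral.integral_const_mul]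
  refine intervalIntegral.integral_congr fun t _ => ?_
  have h1 : (circleMap 0 r⁻¹ t)⁻¹ = r * Complex.exp (-(t * Complex.I)) := by
    simp [circleMap, Complex.exp_neg, mul_comm]
  have h2 : circleMap 0 r⁻¹ t ≠ 0 := circleMap_ne_center (inv_ne_zero hr)
  rw [← h1]
  simp only [deriv_circleMap, smul_eq_mul]
  clear h1
  generalize circleMap 0 r⁻¹ t = z at h2
  field_simp

/-- In z = 1/x the two sides are integrals of h(1/z) dz/z over circles of radius 1/r and 1, equal by
Cauchy's theorem in the annulus between them. -/
theorem integral_circle_scale {h : ℂ → ℂ} (hh : ∀ x, x ≠ 0 → DifferentiableAt ℂ h x) {r : ℝ}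
    (hr : 0 < r) :
    (∫ t in Set.Icc (0 : ℝ) (2 * Real.pi), h (r * Complex.exp (-(t * Complex.I)))) =
      ∫ t in Set.Icc (0 : ℝ) (2 * Real.pi), h (Complex.exp (-(t * Complex.I))) := by
  have hd : ∀ z : ℂ, z ≠ 0 → DifferentiableAt ℂ (fun z => h z⁻¹) z := fun z hz =>
    (hh _ (inv_ne_zero hz)).comp z (differentiableAt_inv hz)
  have key : ∀ a b : ℝ, 0 < a → a ≤ b →
      (∮ z in C(0, b), z⁻¹ • h z⁻¹) = ∮ z in C(0, a), z⁻¹ • h z⁻¹ := by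
    intro a b ha hab
    have := Complex.circleIntegral_sub_center_inv_smul_eq_of_differentiable_on_annulus_off_countable
      (c := 0) ha hab (f := fun z => h z⁻¹) Set.countable_empty
      (fun z hz => (hd z fun h0 => hz.2 (by simp [h0, ha])).continuousAt.continuousWithinAt)
      (fun z hz => hd z fun h0 => hz.1.2 (by simp [h0, ha.le]))
    simpa using this
  have h1 : (∮ z in C(0, r⁻¹), z⁻¹ • h z⁻¹) = ∮ z in C(0, (1 : ℝ)⁻¹), z⁻¹ • h z⁻¹ := by
    rcases le_total r⁻¹ (1 : ℝ)⁻¹ with h | h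
    · exact (key _ _ (inv_pos.2 hr) h).symm
    · exact key _ _ (by norm_num) h
  rw [integral_exp_eq_circleIntegral h r hr.ne', integral_exp_eq_circleIntegral h 1 one_ne_zero] at h1
  have := mul_left_cancel₀ Complex.I_ne_zero h1
  simpa using this

/-- The integral over the circle of radius r does not depend on r > 0; let r tend to 0. -/
theorem integral_circle_mean {h : ℂ → ℂ} (hh : Differentiable ℂ h) :
    (∫ t in Set.Icc (0 : ℝ) (2 * Real.pi), h (Complex.exp (-(t * Complex.I)))) =
      (2 * Real.pi : ℝ) * h 0 := by
  have h1 : ∀ r : ℝ, 0 < r →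
      (∫ t in Set.Icc (0 : ℝ) (2 * Real.pi), h (r * Complex.exp (-(t * Complex.I)))) =
      ∫ t in Set.Icc (0 : ℝ) (2 * Real.pi), h (Complex.exp (-(t * Complex.I))) :=
    fun r hr => integral_circle_scale (fun x _ => hh x) hr
  have hcont : Continuous fun r : ℝ =>
      ∫ t in Set.Icc (0 : ℝ) (2 * Real.pi), h (r * Complex.exp (-(t * Complex.I))) := by
    refine continuous_parametric_integral_of_continuous ?_ isCompact_Icc
    have := hh.continuous
    fun_prop
  have h2 := (hcont.tendsto 0).mono_left (nhdsWithin_le_nhds (s := Set.Ioi 0))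
  have h3 := tendsto_nhds_unique h2 ((tendsto_const_nhds (x :=
    ∫ t in Set.Icc (0 : ℝ) (2 * Real.pi), h (Complex.exp (-(t * Complex.I))))).congr'
    (eventually_nhdsWithin_of_forall fun r hr => (h1 r hr).symm))
  rw [← h3]
  simp [Real.two_pi_pos.le]

theorem differentiable_insertNth {n : ℕ} (i : Fin (n + 1)) (y : Fin n → ℂ) :
    Differentiable ℂ fun x : ℂ => (i.insertNth x y : Fin (n + 1) → ℂ) := by
  rw [differentiable_pi]
  intro j
  refine Fin.succAboveCases i ?_ (fun k => ?_) j <;> simp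

theorem isOpen_unitsSet (n : ℕ) : IsOpen (unitsSet n) := by
  have : unitsSet n = ⋂ i, {w | w i ≠ 0} := by ext w; simp [unitsSet]
  rw [this]
  exact isOpen_iInter_of_finite fun i =>
    isOpen_ne_fun (continuous_apply i) continuous_const

theorem insertNth_mem_unitsSet {n : ℕ} {i : Fin (n + 1)} {x : ℂ} {y : Fin n → ℂ} (hx : x ≠ 0)
    (hy : y ∈ unitsSet n) : (i.insertNth x y : Fin (n + 1) → ℂ) ∈ unitsSet (n + 1) := by
  intro j
  refine Fin.succAboveCases i ?_ (fun k => ?_) j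
  · simpa using hx
  · simpa using hy k

theorem DifferentiableOn.continuousOn_unitTorus {n : ℕ} {f : (Fin n → ℂ) → ℂ}
    (hf : DifferentiableOn ℂ f (unitsSet n)) : ContinuousOn f (unitTorus n) :=
  hf.continuousOn.mono (unitTorus_subset n)

/-- The torus average of a holomorphic function does not change when one variable is scaled. -/
theorem torusAvg_scale {n : ℕ} (i : Fin n) {f : (Fin n → ℂ) → ℂ}
    (hf : DifferentiableOn ℂ f (unitsSet n)) {r : ℝ} (hr : 0 < r) :
    torusAvg (fun w => f (Function.update w i (r * w i))) = torusAvg f := by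
  cases n with
  | zero => exact i.elim0
  | succ n =>
    have hmaps : Set.MapsTo (fun w : Fin (n + 1) → ℂ => Function.update w i (r * w i))
        (unitTorus (n + 1)) (unitsSet (n + 1)) := by
      intro w hw j
      have hw' := unitTorus_subset _ hw
      by_cases h : j = i
      · subst h
        simpa [hr.ne'] using hw' j
      · simpa [h] using hw' j
    have hc : Continuous fun w : Fin (n + 1) → ℂ => Function.update w i (r * w i) :=
      continuous_id.update i (by fun_prop)
    rw [torusAvg_succ_right i (f := fun w => f (Function.update w i (r * w i)))
        (hf.continuousOn.comp hc.continuousOn hmaps),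
      torusAvg_succ_right i (DifferentiableOn.continuousOn_unitTorus hf)]
    refine torusAvg_congr fun y hy => ?_
    congr 1
    have := integral_circle_scale (h := fun x => f (i.insertNth x y)) (fun x hx =>
      (hf.differentiableAt ((isOpen_unitsSet _).mem_nhds
        (insertNth_mem_unitsSet hx (unitTorus_subset _ hy)))).comp x
        (differentiable_insertNth i y x)) hr
    simpa using this

end TorusAverage

/-! ### The symmetric weight and Lagrange interpolation. -/

section Delta

variable {q : ℂ}

/-- The symmetric weight `∏_{i ≠ j} (w_i / w_j;q)_∞`. -/
noncomputable def delta (q : ℂ) {n : ℕ} (w : Fin n → ℂ) : ℂ :=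
  ∏ i, ∏ j, if i = j then 1 else qPochInf (w i / w j) q

/-- The weight with `(w_i / w_j;q)_∞` replaced by `(s w_i / w_j;q)_∞` and `(w_j / w_i;q)_∞` replaced
by `(t w_j / w_i;q)_∞` for a fixed `i`. -/
noncomputable def deltaTwist (q s t : ℂ) {n : ℕ} (i : Fin (n + 1)) (w : Fin (n + 1) → ℂ) : ℂ :=
  delta q (fun b => w (i.succAbove b)) *
    ∏ b, (qPochInf (s * w i / w (i.succAbove b)) q * qPochInf (t * w (i.succAbove b) / w i) q)

theorem delta_eq_deltaTwist {n : ℕ} (i : Fin (n + 1)) (w : Fin (n + 1) → ℂ) :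
    delta q w = deltaTwist q 1 1 i w := by
  unfold delta deltaTwist delta
  rw [Fin.prod_univ_succAbove _ i, Fin.prod_univ_succAbove _ i,
    Finset.prod_congr rfl fun a _ => Fin.prod_univ_succAbove _ i, Finset.prod_mul_distrib,
    Finset.prod_mul_distrib]
  simp only [if_true, one_mul, Fin.succAbove_ne, (Fin.succAbove_ne i _).symm, if_false,
    Fin.succAbove_right_injective.eq_iff]
  ring

/-- Together with `deltaTwist_mul_right`, this makes the twisted weights division-free forms of Δ ∏
(1 - w_i/w_j)⁻¹ and Δ ∏ (1 - w_j/w_i)⁻¹. They remain holomorphic where coordinates coincide. -/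
theorem deltaTwist_mul_left (hq : ‖q‖ < 1) (t : ℂ) {n : ℕ} (i : Fin (n + 1)) (w : Fin (n + 1) → ℂ) :
    deltaTwist q 1 t i w = deltaTwist q q t i w * ∏ b, (1 - w i / w (i.succAbove b)) := by
  unfold deltaTwist
  rw [mul_assoc, ← Finset.prod_mul_distrib]
  congr 1
  refine Finset.prod_congr rfl fun b _ => ?_
  rw [one_mul, qPochInf_step hq (w i / _)]
  have : w i / w (i.succAbove b) * q = q * w i / w (i.succAbove b) := by ring
  rw [this]
  ring

theorem deltaTwist_mul_right (hq : ‖q‖ < 1) (s : ℂ) {n : ℕ} (i : Fin (n + 1))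
    (w : Fin (n + 1) → ℂ) :
    deltaTwist q s 1 i w = deltaTwist q s q i w * ∏ b, (1 - w (i.succAbove b) / w i) := by
  unfold deltaTwist
  rw [mul_assoc, ← Finset.prod_mul_distrib]
  congr 1
  refine Finset.prod_congr rfl fun b _ => ?_
  rw [one_mul, qPochInf_step hq (w (i.succAbove b) / _)]
  have : w (i.succAbove b) / w i * q = q * w (i.succAbove b) / w i := by ring
  rw [this]
  ring

theorem delta_eq_zero (hq : ‖q‖ < 1) {n : ℕ} {w : Fin n → ℂ} (hw : w ∈ unitsSet n)
    {a b : Fin n} (hab : a ≠ b) (h : w a = w b) : delta q w = 0 := by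
  refine Finset.prod_eq_zero (Finset.mem_univ a) (Finset.prod_eq_zero (Finset.mem_univ b) ?_)
  rw [if_neg hab, h, div_self (hw b), qPochInf_one hq]

/-- Covers points with coinciding coordinates, where Lagrange interpolation is unavailable: the
untwisted one of the two factors is (1;q)_∞ = 0. -/
theorem deltaTwist_eq_zero (hq : ‖q‖ < 1) {s t : ℂ} (hst : s = 1 ∨ t = 1) {n : ℕ} (i : Fin (n + 1))
    {w : Fin (n + 1) → ℂ} (hw : w ∈ unitsSet (n + 1)) (h : ¬ Function.Injective w) :
    deltaTwist q s t i w = 0 := by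
  rw [Function.Injective] at h
  push Not at h
  obtain ⟨a, b, h1, h2⟩ := h
  have key : ∀ b', w i = w (i.succAbove b') → deltaTwist q s t i w = 0 := by
    intro b' h
    refine mul_eq_zero_of_right _ (Finset.prod_eq_zero (Finset.mem_univ b') ?_)
    rcases hst with rfl | rfl
    · rw [one_mul, h, div_self (hw _), qPochInf_one hq, zero_mul]
    · rw [one_mul, h, div_self (hw _), qPochInf_one hq, mul_zero]
  rcases Fin.eq_self_or_eq_succAbove i a with rfl | ⟨a', rfl⟩
  · rcases Fin.eq_self_or_eq_succAbove a b with rfl | ⟨b', rfl⟩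
    · exact absurd rfl h2
    · exact key b' h1
  · rcases Fin.eq_self_or_eq_succAbove i b with rfl | ⟨b', rfl⟩
    · exact key a' h1.symm
    · refine mul_eq_zero_of_left (delta_eq_zero hq (a := a') (b := b') (fun _ => hw _) ?_ h1) _
      rintro rfl; exact h2 rfl

/-- Lagrange interpolation of f at the nodes v_i, evaluated at 0. -/
theorem sum_lagrange_zero {n : ℕ} {v : Fin (n + 1) → ℂ} (hv : Function.Injective v)
    {f : Polynomial ℂ} (hf : f.natDegree < n + 1) :
    ∑ i, f.eval (v i) * ∏ b, (v (i.succAbove b) / (v (i.succAbove b) - v i)) = f.eval 0 := by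
  have h := Lagrange.eq_interpolate (s := Finset.univ) (v := v) (f := f) hv.injOn
    ((Polynomial.degree_le_natDegree).trans_lt (by
      rw [Finset.card_univ, Fintype.card_fin]; exact_mod_cast hf))
  conv_rhs => rw [h]
  rw [Lagrange.interpolate_apply, Polynomial.eval_finsetSum]
  refine Finset.sum_congr rfl fun i _ => ?_
  rw [Polynomial.eval_mul, Polynomial.eval_C, Lagrange.basis, Polynomial.eval_prod]
  congr 1
  have h1 : (Finset.univ : Finset (Fin (n + 1))).erase i = Finset.univ.image i.succAbove := by
    ext j
    simp only [Finset.mem_erase, Finset.mem_univ, and_true, Finset.mem_image, true_and]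
    exact (Fin.exists_succAbove_eq_iff).symm
  rw [h1, Finset.prod_image fun a _ b _ h => Fin.succAbove_right_injective h]
  refine Finset.prod_congr rfl fun b _ => ?_
  have hne : v (i.succAbove b) - v i ≠ 0 := sub_ne_zero.2 fun h => Fin.succAbove_ne i b (hv h)
  have hne' : v i - v (i.succAbove b) ≠ 0 := fun h => hne (by rw [← neg_sub, h, neg_zero])
  rw [Lagrange.basisDivisor]
  simp only [Polynomial.eval_mul, Polynomial.eval_C, Polynomial.eval_sub, Polynomial.eval_X]
  rw [zero_sub, ← neg_sub (v (i.succAbove b)), inv_neg]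
  field_simp

theorem sum_deltaTwist_eval (hq : ‖q‖ < 1) {n : ℕ} {w : Fin (n + 1) → ℂ}
    (hw : w ∈ unitsSet (n + 1)) {f : Polynomial ℂ} (hf : f.natDegree < n + 1) :
    ∑ i, deltaTwist q q 1 i w * f.eval (w i) = delta q w * f.eval 0 := by
  by_cases h : Function.Injective w
  · rw [← sum_lagrange_zero h hf, Finset.mul_sum]
    refine Finset.sum_congr rfl fun i _ => ?_
    rw [delta_eq_deltaTwist i, deltaTwist_mul_left hq]
    have : (∏ b, (1 - w i / w (i.succAbove b))) *
        ∏ b, (w (i.succAbove b) / (w (i.succAbove b) - w i)) = 1 := by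
      rw [← Finset.prod_mul_distrib]
      refine Finset.prod_eq_one fun b _ => ?_
      have h1 : w (i.succAbove b) - w i ≠ 0 := sub_ne_zero.2 fun h' => Fin.succAbove_ne i b (h h')
      have h2 := hw (i.succAbove b)
      field_simp
    linear_combination (-deltaTwist q q 1 i w * f.eval (w i)) * this
  · rw [delta_eq_deltaTwist 0, deltaTwist_eq_zero hq (Or.inl rfl) 0 hw h, zero_mul]
    exact Finset.sum_eq_zero fun i _ => by
      rw [deltaTwist_eq_zero hq (Or.inr rfl) i hw h, zero_mul]

/-- Interpolation of the constant 1 at the nodes 1/w_i; the inversion exchanges the roles of w_i and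
w_j in the denominators. -/
theorem sum_deltaTwist_right (hq : ‖q‖ < 1) {n : ℕ} {w : Fin (n + 1) → ℂ}
    (hw : w ∈ unitsSet (n + 1)) : ∑ i, deltaTwist q 1 q i w = delta q w := by
  by_cases h : Function.Injective w
  · have h0 : Function.Injective fun i => (w i)⁻¹ := fun a b hab => h (inv_injective hab)
    have h1 := sum_lagrange_zero h0 (f := 1) (by simp)
    simp only [Polynomial.eval_one, one_mul] at h1
    have h2 : delta q w = delta q w * ∑ x, ∏ b, ((w (x.succAbove b))⁻¹ /
        ((w (x.succAbove b))⁻¹ - (w x)⁻¹)) := by rw [h1, mul_one]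
    rw [h2, Finset.mul_sum]
    refine Finset.sum_congr rfl fun i _ => ?_
    rw [delta_eq_deltaTwist i, deltaTwist_mul_right hq]
    have : (∏ b, (1 - w (i.succAbove b) / w i)) *
        ∏ b, ((w (i.succAbove b))⁻¹ / ((w (i.succAbove b))⁻¹ - (w i)⁻¹)) = 1 := by
      rw [← Finset.prod_mul_distrib]
      refine Finset.prod_eq_one fun b _ => ?_
      have h1 : w i - w (i.succAbove b) ≠ 0 := sub_ne_zero.2 fun h' => Fin.succAbove_ne i b (h h').symm
      have h2 := hw (i.succAbove b)
      have h3 := hw i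
      field_simp
    rw [mul_assoc, this, mul_one]
  · rw [delta_eq_deltaTwist 0, deltaTwist_eq_zero hq (Or.inl rfl) 0 hw h]
    exact Finset.sum_eq_zero fun i _ => deltaTwist_eq_zero hq (Or.inl rfl) i hw h

theorem differentiableOn_finsetProd {E ι : Type*} [NormedAddCommGroup E] [NormedSpace ℂ E]
    {s : Set E} {u : Finset ι} {f : ι → E → ℂ} (h : ∀ i ∈ u, DifferentiableOn ℂ (f i) s) :
    DifferentiableOn ℂ (fun x => ∏ i ∈ u, f i x) s := by
  classical
  induction u using Finset.induction_on with
  | empty => simp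
  | insert a u ha ih =>
    simp only [Finset.prod_insert ha]
    exact (h a (Finset.mem_insert_self _ _)).mul
      (ih fun i hi => h i (Finset.mem_insert_of_mem hi))

theorem differentiableOn_qPochInf_div (hq : ‖q‖ < 1) (s : ℂ) {n : ℕ} (i j : Fin n) :
    DifferentiableOn ℂ (fun w : Fin n → ℂ => qPochInf (s * w i / w j) q) (unitsSet n) := by
  have h : DifferentiableOn ℂ (fun w : Fin n → ℂ => s * w i / w j) (unitsSet n) :=
    DifferentiableOn.fun_mul (by fun_prop)
      (DifferentiableOn.fun_inv (by fun_prop) fun w hw => hw j)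
  exact (differentiable_qPochInf hq).comp_differentiableOn h

theorem differentiableOn_delta (hq : ‖q‖ < 1) (n : ℕ) :
    DifferentiableOn ℂ (delta q (n := n)) (unitsSet n) := by
  unfold delta
  refine differentiableOn_finsetProd fun i _ => differentiableOn_finsetProd fun j _ => ?_
  by_cases h : i = j
  · simp [h]
  · simpa only [h, if_false, one_mul] using differentiableOn_qPochInf_div hq 1 i j

theorem differentiableOn_deltaTwist (hq : ‖q‖ < 1) (s t : ℂ) {n : ℕ} (i : Fin (n + 1)) :
    DifferentiableOn ℂ (deltaTwist q s t i) (unitsSet (n + 1)) := by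
  unfold deltaTwist
  refine DifferentiableOn.mul ?_ (differentiableOn_finsetProd fun b _ => DifferentiableOn.mul
    (differentiableOn_qPochInf_div hq s _ _) (differentiableOn_qPochInf_div hq t _ _))
  refine (differentiableOn_delta hq n).comp (t := unitsSet n)
    (f := fun (w : Fin (n + 1) → ℂ) b => w (i.succAbove b)) ?_ fun w hw b => hw _
  fun_prop

/-- The shift w_i ↦ q w_i moves the twist by q from the factors w_j/w_i to the factors w_i/w_j.
Combined with contour scaling, this makes the q-difference operator preserve averages. -/
theorem deltaTwist_update (hq0 : q ≠ 0) {n : ℕ} (i : Fin (n + 1)) (w : Fin (n + 1) → ℂ) :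
    deltaTwist q 1 q i (Function.update w i (q * w i)) = deltaTwist q q 1 i w := by
  have h : ∀ b, Function.update w i (q * w i) (i.succAbove b) = w (i.succAbove b) := fun b =>
    Function.update_of_ne (Fin.succAbove_ne i b) _ _
  unfold deltaTwist
  simp only [h, Function.update_self, one_mul]
  congr 1
  refine Finset.prod_congr rfl fun b _ => ?_
  rw [mul_div_mul_left _ _ hq0]

end Delta

/-! ### Invariance of averages under the q-difference operator. -/

section DualIdentity

variable {q : ℝ}

/-- The `q`-difference operator `∑_i ∏_{j ≠ i} (1 - w_i / w_j)⁻¹ T_{q,w_i}` preserves averages with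
respect to the weight `delta`. -/
theorem sum_torusAvg_deltaTwist (hq0 : 0 < q) (hq1 : q < 1) {n : ℕ}
    {F : (Fin (n + 1) → ℂ) → ℂ} (hF : DifferentiableOn ℂ F (unitsSet (n + 1))) :
    ∑ i, torusAvg (fun w => deltaTwist (q : ℂ) q 1 i w * F (Function.update w i (q * w i))) =
      torusAvg fun w => delta (q : ℂ) w * F w := by
  have hq : ‖(q : ℂ)‖ < 1 := by rwa [Complex.norm_real, Real.norm_of_nonneg hq0.le]
  have hqc : (q : ℂ) ≠ 0 := Complex.ofReal_ne_zero.2 hq0.ne'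
  have h1 : ∀ i, torusAvg (fun w => deltaTwist (q : ℂ) q 1 i w * F (Function.update w i (q * w i))) =
      torusAvg fun w => deltaTwist (q : ℂ) 1 q i w * F w := by
    intro i
    have h := torusAvg_scale (f := fun w => deltaTwist (q : ℂ) 1 q i w * F w) i
      ((differentiableOn_deltaTwist hq 1 q i).mul hF) hq0
    simp_rw [deltaTwist_update hqc] at h
    exact h
  rw [Finset.sum_congr rfl fun i _ => h1 i, ← torusAvg_sum]
  · refine torusAvg_congr fun w hw => ?_
    rw [← Finset.sum_mul, sum_deltaTwist_right hq (unitTorus_subset _ hw)]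
  · exact fun i _ => DifferentiableOn.continuousOn_unitTorus
      ((differentiableOn_deltaTwist hq 1 q i).mul hF)

end DualIdentity

/-! ### Holomorphy and scaling of the integrands. -/

section Holomorphy

variable {q : ℂ}

theorem differentiable_gCoeff {n : ℕ} (k : ℕ) :
    Differentiable ℂ fun w : Fin n → ℂ => gCoeff q w k := by
  unfold gCoeff gSeries
  simp_rw [PowerSeries.coeff_prod, PowerSeries.coeff_mk]
  fun_prop

theorem differentiableOn_whittakerP {n : ℕ} (lam : Fin n → ℤ) :
    DifferentiableOn ℂ (fun w : Fin n → ℂ => whittakerP q lam w) (unitsSet n) := by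
  induction n with
  | zero => simp [whittakerP]
  | succ n ih =>
    simp only [whittakerP]
    refine DifferentiableOn.fun_sum fun mu _ => DifferentiableOn.mul ?_ ?_
    · unfold skewP
      refine DifferentiableOn.mul_const (fun w hw => ?_) _
      exact ((differentiableAt_zpow.2 (Or.inl (hw _))).comp (f := fun v : Fin (n + 1) → ℂ =>
        v (Fin.last n)) w (by fun_prop)).differentiableWithinAt
    · refine (ih mu).comp (f := fun (w : Fin (n + 1) → ℂ) (i : Fin n) => w i.castSucc) ?_
        fun w hw b => hw _
      fun_prop

theorem gSeries_update (hq0 : q ≠ 0) (hq : ‖q‖ < 1) {n : ℕ} (w : Fin n → ℂ) (i : Fin n) :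
    gSeries q (Function.update w i (q * w i)) =
      (1 - PowerSeries.C (w i) * PowerSeries.X) * gSeries q w := by
  unfold gSeries
  rw [← Finset.mul_prod_erase _ _ (Finset.mem_univ i), ← Finset.mul_prod_erase Finset.univ
    (fun j => PowerSeries.mk fun k => w j ^ k * qPochInv q (k : ℤ)) (Finset.mem_univ i), ← mul_assoc,
    ← qExp_rescale hq0 hq, Function.update_self]
  congr 1
  refine Finset.prod_congr rfl fun j hj => ?_
  rw [Function.update_of_ne (Finset.ne_of_mem_erase hj)]

/-- T_{q,w_i} g_k = g_k - w_i g_{k-1}, of degree at most 1 in w_i when the g's are held fixed. The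
coefficient of X times the series stands for g_{k-1} and is 0 at k = 0. -/
theorem gCoeff_update (hq0 : q ≠ 0) (hq : ‖q‖ < 1) {n : ℕ} (w : Fin n → ℂ) (i : Fin n) (k : ℕ) :
    gCoeff q (Function.update w i (q * w i)) k =
      gCoeff q w k - w i * PowerSeries.coeff k (PowerSeries.X * gSeries q w) := by
  rw [gCoeff, gSeries_update hq0 hq, sub_mul, one_mul, map_sub, mul_assoc, PowerSeries.coeff_C_mul]
  rfl

theorem gCoeff_zero (hq : ‖q‖ < 1) {n : ℕ} (w : Fin n → ℂ) : gCoeff q w 0 = 1 :=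
  coeff_zero_gSeries hq w

theorem whittakerP_scale {n : ℕ} (lam : Fin n → ℤ) {c : ℂ} (hc : c ≠ 0) (w : Fin n → ℂ) :
    whittakerP q lam (fun i => c * w i) = c ^ (∑ i, lam i) * whittakerP q lam w := by
  induction n with
  | zero => simp [whittakerP]
  | succ n ih =>
    rw [whittakerP, whittakerP, Finset.mul_sum]
    refine Finset.sum_congr rfl fun mu _ => ?_
    rw [ih mu fun i => w i.castSucc, skewP, skewP, mul_zpow, zpow_sub₀ hc]
    have := zpow_ne_zero (∑ i, mu i) hc
    field_simp

theorem whittakerP_const {𝕜 : Type*} [RCLike 𝕜] {q : 𝕜} (hq : ‖q‖ < 1) {n : ℕ} (c : ℤ)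
    (w : Fin n → 𝕜) :
    whittakerP q (fun _ => c) w = ∏ i, w i ^ c := by
  induction n with
  | zero => simp [whittakerP]
  | succ n ih =>
    rw [whittakerP, Finset.sum_eq_single fun _ => c, ih, Fin.prod_univ_castSucc, skewP]
    · simp only [sub_self, qPochInv_zero hq, qPoch_zero hq, mul_one, Finset.prod_const_one,
        Finset.sum_const, Finset.card_univ, Fintype.card_fin, nsmul_eq_mul]
      rw [mul_comm]
      congr 2
      push_cast
      ring
    · intro mu hmu hne
      refine absurd (funext fun i => ?_) hne
      have := Fintype.mem_piFinset.1 hmu i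
      simpa using this
    · intro h
      exact absurd (Fintype.mem_piFinset.2 fun i => by simp) h

end Holomorphy

/-! ### Vanishing for powers of the determinant character. -/

section Vanishing

variable {q : ℝ}

theorem norm_ofReal_lt {q : ℝ} (hq0 : 0 < q) (hq1 : q < 1) : ‖(q : ℂ)‖ < 1 := by
  rwa [Complex.norm_real, Real.norm_of_nonneg hq0.le]

theorem ofReal_zpow_ne_one (hq0 : 0 < q) (hq1 : q < 1) {c : ℤ} (hc : c ≠ 0) : (q : ℂ) ^ c ≠ 1 := by
  intro h
  have : q ^ c = 1 := by exact_mod_cast h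
  exact hc ((zpow_eq_one_iff_right₀ hq0.le hq1.ne).1 this)

theorem differentiableOn_prod_zpow {n : ℕ} (c : ℤ) :
    DifferentiableOn ℂ (fun w : Fin n → ℂ => ∏ i, w i ^ c) (unitsSet n) :=
  differentiableOn_finsetProd fun i _ w hw =>
    ((differentiableAt_zpow.2 (Or.inl (hw i))).comp (f := fun v : Fin n → ℂ => v i) w
      (by fun_prop)).differentiableWithinAt

theorem differentiable_prod_gCoeff {q : ℂ} {n : ℕ} (l : List ℕ) :
    Differentiable ℂ fun w : Fin n → ℂ => (l.map (gCoeff q w)).prod := by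
  induction l with
  | nil => simp
  | cons k l ih =>
    simp only [List.map_cons, List.prod_cons]
    exact (differentiable_gCoeff k).mul ih

/-- The shift turns the function into q^c (∏ w_j)^c f(w_i), with f of degree at most n. There are n
+ 1 nodes, so interpolation returns f(0), the original product of the g's. The average A therefore
satisfies q^c A = A. -/
theorem torusAvg_det_gCoeff (hq0 : 0 < q) (hq1 : q < 1) {n : ℕ} {c : ℤ} (hc : c ≠ 0) {l : List ℕ}
    (hl : l.length ≤ n) :
    torusAvg (fun w : Fin (n + 1) → ℂ => delta (q : ℂ) w *
      ((∏ i, w i ^ c) * (l.map (gCoeff (q : ℂ) w)).prod)) = 0 := by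
  have hq := norm_ofReal_lt hq0 hq1
  have hqc : (q : ℂ) ≠ 0 := Complex.ofReal_ne_zero.2 hq0.ne'
  have hF : DifferentiableOn ℂ (fun w : Fin (n + 1) → ℂ =>
      (∏ i, w i ^ c) * (l.map (gCoeff (q : ℂ) w)).prod) (unitsSet (n + 1)) :=
    (differentiableOn_prod_zpow c).mul (differentiable_prod_gCoeff l).differentiableOn
  have h1 := sum_torusAvg_deltaTwist hq0 hq1 hF
  set A := torusAvg (fun w : Fin (n + 1) → ℂ => delta (q : ℂ) w *
      ((∏ i, w i ^ c) * (l.map (gCoeff (q : ℂ) w)).prod)) with hA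
  have h2 : (q : ℂ) ^ c * A = A := by
    conv_rhs => rw [← h1]
    rw [hA, ← torusAvg_const_mul, ← torusAvg_sum]
    · refine torusAvg_congr fun w hw => ?_
      set f : Polynomial ℂ := (l.map fun k => Polynomial.C (gCoeff (q : ℂ) w k) - Polynomial.X *
        Polynomial.C (PowerSeries.coeff k (PowerSeries.X * gSeries (q : ℂ) w))).prod with hf
      have hdeg : f.natDegree < n + 1 := by
        refine lt_of_le_of_lt ?_ (Nat.lt_succ_of_le hl)
        rw [hf]
        refine (Polynomial.natDegree_list_prod_le _).trans ?_
        refine (List.sum_le_card_nsmul _ 1 ?_).trans (by simp)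
        intro d hd
        simp only [List.map_map, List.mem_map, Function.comp_apply] at hd
        obtain ⟨k, _, rfl⟩ := hd
        compute_degree
      have hev : ∀ x, f.eval x = (l.map fun k => gCoeff (q : ℂ) w k - x *
          PowerSeries.coeff k (PowerSeries.X * gSeries (q : ℂ) w)).prod := by
        intro x
        rw [hf, Polynomial.eval_list_prod, List.map_map]
        simp only [Function.comp_def, Polynomial.eval_sub, Polynomial.eval_C, Polynomial.eval_mul,
          Polynomial.eval_X]
      have key := sum_deltaTwist_eval hq (unitTorus_subset _ hw) hdeg
      rw [hev 0] at key
      simp only [zero_mul, sub_zero] at key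
      have hup : ∀ i, (∏ j, Function.update w i (q * w i) j ^ c) = (q : ℂ) ^ c * ∏ j, w j ^ c := by
        intro i
        rw [← Finset.mul_prod_erase _ _ (Finset.mem_univ i), ← Finset.mul_prod_erase Finset.univ
          (fun j => w j ^ c) (Finset.mem_univ i), Function.update_self, mul_zpow, mul_assoc]
        congr 2
        refine Finset.prod_congr rfl fun j hj => ?_
        rw [Function.update_of_ne (Finset.ne_of_mem_erase hj)]
      have hg : ∀ i, (l.map (gCoeff (q : ℂ) (Function.update w i (q * w i)))).prod =
          f.eval (w i) := by
        intro i
        rw [hev]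
        congr 1
        exact List.map_congr_left fun k _ => gCoeff_update hqc hq w i k
      simp_rw [hup, hg]
      calc (q : ℂ) ^ c * (delta (q : ℂ) w * ((∏ i, w i ^ c) * (l.map (gCoeff (q : ℂ) w)).prod))
          = (q : ℂ) ^ c * (∏ i, w i ^ c) * (delta (q : ℂ) w *
              (l.map (gCoeff (q : ℂ) w)).prod) := by ring
        _ = _ := by
          rw [show (l.map (gCoeff (q : ℂ) w)).prod =
            (l.map fun k => gCoeff (q : ℂ) w k).prod from rfl, ← key, Finset.mul_sum]
          exact Finset.sum_congr rfl fun i _ => by ring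
    · intro i _
      refine DifferentiableOn.continuousOn_unitTorus
        ((differentiableOn_deltaTwist hq q 1 i).mul (hF.comp (f := fun w : Fin (n + 1) → ℂ =>
          Function.update w i (q * w i)) ?_ fun w hw j => ?_))
      · refine Differentiable.differentiableOn (differentiable_pi.2 fun j => ?_)
        by_cases h : j = i
        · subst h; simp only [Function.update_self]; fun_prop
        · simp only [Function.update_of_ne h]; fun_prop
      · by_cases h : j = i
        · subst h; simpa [hq0.ne'] using hw j
        · simpa [Function.update_of_ne h] using hw j
  have h3 := ofReal_zpow_ne_one hq0 hq1 hc
  by_contra hne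
  exact h3 (mul_right_cancel₀ hne (by rw [h2, one_mul]))

end Vanishing

/-! ### Orthogonality of non-zero signatures to the constants. -/

section Orthogonality

theorem delta_scale {q : ℂ} {n : ℕ} {c : ℂ} (hc : c ≠ 0) (w : Fin n → ℂ) :
    delta q (fun i => c * w i) = delta q w := by
  unfold delta
  simp_rw [mul_div_mul_left _ _ hc]

theorem torusAvg_scale_finset {n : ℕ} {f : (Fin n → ℂ) → ℂ} (hf : DifferentiableOn ℂ f (unitsSet n))
    {r : ℝ} (hr : 0 < r) (s : Finset (Fin n)) :
    torusAvg (fun w => f fun i => if i ∈ s then r * w i else w i) = torusAvg f := by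
  cases n with
  | zero =>
    congr 1
    funext w
    exact congrArg f (Subsingleton.elim _ _)
  | succ n =>
  induction s using Finset.induction_on with
  | empty => simp
  | insert a s ha ih =>
    rw [← ih]
    have hd : DifferentiableOn ℂ (fun w => f fun i => if i ∈ s then r * w i else w i)
        (unitsSet (n + 1)) := by
      refine hf.comp (f := fun (w : Fin (n + 1) → ℂ) i => if i ∈ s then r * w i else w i) ?_ ?_
      · refine Differentiable.differentiableOn (differentiable_pi.2 fun i => ?_)
        by_cases h : i ∈ s <;> simp only [h, if_true, if_false] <;> fun_prop
      · intro w hw i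
        by_cases h : i ∈ s
        · simpa [h, hr.ne'] using hw i
        · simpa [h] using hw i
    rw [← torusAvg_scale a hd hr]
    congr 1
    funext w
    congr 1
    funext i
    by_cases h : i = a
    · subst h; simp [ha]
    · simp [h]

variable {q : ℝ}

theorem torusAvg_eq_zero_of_homogeneous (hq0 : 0 < q) (hq1 : q < 1) {n : ℕ}
    {F : (Fin n → ℂ) → ℂ} (hF : DifferentiableOn ℂ F (unitsSet n)) {d : ℤ} (hd : d ≠ 0)
    (h : ∀ w, F (fun i => q * w i) = (q : ℂ) ^ d * F w) :
    torusAvg (fun w => delta (q : ℂ) w * F w) = 0 := by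
  have hqc : (q : ℂ) ≠ 0 := Complex.ofReal_ne_zero.2 hq0.ne'
  have h1 := torusAvg_scale_finset ((differentiableOn_delta (norm_ofReal_lt hq0 hq1) n).mul hF) hq0
    Finset.univ
  simp only [Finset.mem_univ, if_true, Pi.mul_apply, delta_scale hqc, h] at h1
  simp_rw [mul_left_comm _ ((q : ℂ) ^ d)] at h1
  rw [torusAvg_const_mul] at h1
  by_contra hne
  exact ofReal_zpow_ne_one hq0 hq1 hd (mul_right_cancel₀ hne (by rw [one_mul]; exact h1))

/-- P_λ is traded for extra factors g until only the constant signature c remains, where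
`torusAvg_det_gCoeff` applies. Each trade frees one more row to equal c and lengthens the list by
one, so j + length stays at most n. -/
theorem torusAvg_whittakerP_gCoeff (hq0 : 0 < q) (hq1 : q < 1) {n : ℕ} {c : ℤ} (hc : c ≠ 0)
    (j : ℕ) (l : List ℕ) (hl : j + l.length ≤ n) (lam : Fin (n + 1) → ℤ) (hlam : Antitone lam)
    (hj : ∀ i : Fin (n + 1), j ≤ i → lam i = c) :
    torusAvg (fun w => delta (q : ℂ) w *
      (whittakerP (q : ℂ) lam w * (l.map (gCoeff (q : ℂ) w)).prod)) = 0 := by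
  have hq := norm_ofReal_lt hq0 hq1
  have hqc : (q : ℂ) ≠ 0 := Complex.ofReal_ne_zero.2 hq0.ne'
  have hcont : ∀ (lam : Fin (n + 1) → ℤ) (l : List ℕ), ContinuousOn (fun w => delta (q : ℂ) w *
      (whittakerP (q : ℂ) lam w * (l.map (gCoeff (q : ℂ) w)).prod)) (unitTorus (n + 1)) :=
    fun lam l => DifferentiableOn.continuousOn_unitTorus ((differentiableOn_delta hq _).mul
      ((differentiableOn_whittakerP lam).mul (differentiable_prod_gCoeff l).differentiableOn))
  induction j generalizing l lam with
  | zero =>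
    have : lam = fun _ => c := funext fun i => hj i (Nat.zero_le _)
    subst this
    simp_rw [whittakerP_const hq]
    exact torusAvg_det_gCoeff hq0 hq1 hc (by simpa using hl)
  | succ j ih =>
    -- Inner induction on the weight above c outside the first row. With λ' = (λ₂, …, λ_n, c) in the
    -- usual indexing, the Pieri rule for g_m P_{λ'}, m = λ₁ - c, contains P_λ, and its other terms
    -- have smaller inner weight.
    induction hs : (∑ i : Fin n, (lam i.succ - c)).toNat using Nat.strong_induction_on
      generalizing lam with
    | _ s ihs =>
    have hlast : lam (Fin.last n) = c := hj _ (by simp; omega)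
    have hge : ∀ i, c ≤ lam i := fun i => hlast ▸ hlam (Fin.le_last i)
    set lam' : Fin (n + 1) → ℤ := Fin.snoc (fun i : Fin n => lam i.succ) c with hlam'
    have h1 : ∀ i : Fin n, lam' i.castSucc = lam i.succ := fun i => by simp [hlam']
    have h2 : lam' (Fin.last n) = c := by simp [hlam']
    have hle : ∀ i, lam' i ≤ lam i := by
      intro i
      refine Fin.lastCases ?_ (fun i => ?_) i
      · rw [h2, hlast]
      · rw [h1]; exact hlam (Fin.castSucc_le_succ i)
    have hanti : Antitone lam' := by
      refine Fin.antitone_iff_succ_le.2 fun i => ?_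
      rw [h1]
      exact hle _
    have hstrip : IsHorStrip lam' lam := ⟨hle _, fun i => ⟨hle _, (h1 i).ge⟩⟩
    have hj' : ∀ i : Fin (n + 1), j ≤ i → lam' i = c := by
      intro i
      refine Fin.lastCases (fun _ => h2) (fun i hi => ?_) i
      rw [h1]
      exact hj _ (by simpa using hi)
    have hsum : ∑ i, lam i - ∑ i, lam' i = ((lam 0 - c).toNat : ℤ) := by
      rw [Fin.sum_univ_succ, Fin.sum_univ_castSucc lam', h2, Int.toNat_of_nonneg (by
        linarith [hge 0])]
      simp_rw [h1]
      ring
    set m := (lam 0 - c).toNat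
    have h0 := ih (m :: l) (by simp only [List.length_cons]; omega) lam' hanti hj'
    have hexp : torusAvg (fun w => delta (q : ℂ) w * (whittakerP (q : ℂ) lam' w *
        ((m :: l).map (gCoeff (q : ℂ) w)).prod)) = ∑ nu ∈ horBox lam' m,
        (if ∑ i, nu i - ∑ i, lam' i = m then horCoeff (q : ℂ) lam' nu else 0) *
          torusAvg (fun w => delta (q : ℂ) w * (whittakerP (q : ℂ) nu w *
            (l.map (gCoeff (q : ℂ) w)).prod)) := by
      simp_rw [← torusAvg_const_mul]
      rw [← torusAvg_sum]
      swap
      · exact fun nu _ => continuousOn_const.mul (hcont nu l)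
      refine torusAvg_congr fun w hw => ?_
      have hP := gCoeff_mul_whittakerP hqc hq hanti (unitTorus_subset _ hw) m
      rw [tsum_eq_sum (s := horBox lam' m) fun nu hnu => by
        by_contra h
        exact hnu (by simpa using mem_horBox_of_ne hqc hq h)] at hP
      simp only [List.map_cons, List.prod_cons]
      calc _ = delta (q : ℂ) w * ((gCoeff (q : ℂ) w m * whittakerP (q : ℂ) lam' w) *
            (l.map (gCoeff (q : ℂ) w)).prod) := by ring
        _ = _ := by
          rw [hP, Finset.sum_mul, Finset.mul_sum]
          refine Finset.sum_congr rfl fun nu _ => ?_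
          split_ifs <;> ring
    rw [hexp, Finset.sum_eq_single_of_mem lam (mem_horBox_of_size hstrip hsum.le), if_pos hsum] at h0
    · exact (mul_eq_zero.1 h0).resolve_left (horCoeff_ne_zero hq hanti hstrip)
    · intro kap hkap hne
      by_cases hk : ∑ i, kap i - ∑ i, lam' i = m
      swap
      · rw [if_neg hk, zero_mul]
      refine mul_eq_zero_of_right _ ?_
      have hks := (mem_horBox.1 hkap).1
      have hkl : ∀ i : Fin n, kap i.succ ≤ lam i.succ := fun i => (hks.2 i).2.trans (h1 i).le
      have hjk : ∀ i : Fin (n + 1), j + 1 ≤ i → kap i = c := by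
        intro i
        refine Fin.cases (fun h => by simp at h) (fun i hi => ?_) i
        exact le_antisymm ((hkl i).trans (hj _ hi).le) ((hj' i.succ (by omega)).ge.trans (hks.le _))
      have hsk : ∑ i, kap i = ∑ i, lam i := by linarith
      refine ihs _ ?_ kap hks.antitone hjk rfl
      -- A strip over λ' has κ_{i+1} ≤ λ'_i = λ_{i+1}. Equality everywhere would force κ = λ, since
      -- the total sizes agree.
      have hlt : ∑ i : Fin n, (kap i.succ - c) < ∑ i : Fin n, (lam i.succ - c) := by
        refine Finset.sum_lt_sum (fun i _ => by linarith [hkl i]) ?_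
        by_contra hcon
        push Not at hcon
        have heq : ∀ i : Fin n, kap i.succ = lam i.succ := fun i =>
          le_antisymm (hkl i) (by linarith [hcon i (Finset.mem_univ i)])
        rw [Fin.sum_univ_succ, Fin.sum_univ_succ lam] at hsk
        simp_rw [heq] at hsk
        exact hne (funext fun i => Fin.cases (by linarith) heq i)
      have hnn : 0 ≤ ∑ i : Fin n, (kap i.succ - c) := by
        refine Finset.sum_nonneg fun i _ => ?_
        have hkl := hjk (Fin.last n) (by simp; omega)
        linarith [hks.antitone (Fin.le_last i.succ)]
      rw [← hs]
      omega

/-- The `q`-Whittaker functions of non-zero signatures are orthogonal to the constants. -/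
theorem torusAvg_whittakerP (hq0 : 0 < q) (hq1 : q < 1) {n : ℕ} {lam : Fin n → ℤ}
    (hlam : Antitone lam) (hne : lam ≠ 0) :
    torusAvg (fun w => delta (q : ℂ) w * whittakerP (q : ℂ) lam w) = 0 := by
  cases n with
  | zero => exact absurd (Subsingleton.elim _ _) hne
  | succ n =>
  by_cases hc : lam (Fin.last n) = 0
  · refine torusAvg_eq_zero_of_homogeneous hq0 hq1 (differentiableOn_whittakerP lam)
      (d := ∑ i, lam i) (fun h => hne ?_)
      fun w => whittakerP_scale lam (Complex.ofReal_ne_zero.2 hq0.ne') w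
    have h0 : ∀ i, 0 ≤ lam i := fun i => hc ▸ hlam (Fin.le_last i)
    exact funext fun i => (Finset.sum_eq_zero_iff_of_nonneg fun i _ => h0 i).1 h i (Finset.mem_univ i)
  · have := torusAvg_whittakerP_gCoeff hq0 hq1 hc n [] (by simp) lam hlam fun i hi => by
      rw [show i = Fin.last n from Fin.ext (by simp; omega)]
    simpa using this

end Orthogonality

/-! ### Convergence of the expansion of the kernel, and termwise averages. -/

section Series

variable {𝕜 : Type*} [RCLike 𝕜] {q : 𝕜}

theorem summable_norm_gCoeff_and (hq0 : q ≠ 0) (hq : ‖q‖ < 1) {n : ℕ} {w : Fin n → 𝕜} {c : 𝕜}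
    (hw : ∀ j, ‖c * w j‖ < 1) :
    Summable (fun k => ‖c ^ k * gCoeff q w k‖) ∧
      HasSum (fun k => c ^ k * gCoeff q w k) (∏ j, 1 / qPochInf (c * w j) q) := by
  have key : ∀ s : Finset (Fin n), Summable (fun k => ‖c ^ k * PowerSeries.coeff k
        (∏ j ∈ s, PowerSeries.mk fun k => w j ^ k * qPochInv q (k : ℤ))‖) ∧
      ∑' k, c ^ k * PowerSeries.coeff k
        (∏ j ∈ s, PowerSeries.mk fun k => w j ^ k * qPochInv q (k : ℤ)) =
        ∏ j ∈ s, 1 / qPochInf (c * w j) q := by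
    intro s
    induction s using Finset.induction_on with
    | empty =>
      simp only [Finset.prod_empty, PowerSeries.coeff_one]
      have h : ∀ k ∉ ({0} : Finset ℕ), (c ^ k * if k = 0 then (1 : 𝕜) else 0) = 0 := by
        intro k hk
        rw [if_neg (by simpa using hk), mul_zero]
      refine ⟨summable_of_ne_finset_zero (s := {0}) fun k hk => by rw [h k hk, norm_zero], ?_⟩
      rw [tsum_eq_sum h]
      simp
    | insert j s hj ih =>
      set f : ℕ → 𝕜 := fun k => (c * w j) ^ k * qPochInv q (k : ℤ) with hf
      set g : ℕ → 𝕜 := fun k => c ^ k * PowerSeries.coeff k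
        (∏ j ∈ s, PowerSeries.mk fun k => w j ^ k * qPochInv q (k : ℤ)) with hg
      have h1 : Summable fun k : ℕ => ‖f k‖ := summable_norm_qExp hq (hw j)
      have h2 : (fun k => c ^ k * PowerSeries.coeff k (∏ i ∈ insert j s,
          PowerSeries.mk fun k => w i ^ k * qPochInv q (k : ℤ))) =
          fun k => ∑ p ∈ Finset.HasAntidiagonal.antidiagonal k, f p.1 * g p.2 := by
        funext k
        rw [Finset.prod_insert hj, PowerSeries.coeff_mul, Finset.mul_sum]
        refine Finset.sum_congr rfl fun p hp => ?_
        rw [PowerSeries.coeff_mk, ← Finset.HasAntidiagonal.mem_antidiagonal.1 hp, pow_add, hf, hg]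
        simp only [mul_pow]
        ring
      simp only [fun k => congrFun h2 k]
      refine ⟨summable_norm_sum_mul_antidiagonal_of_summable_norm h1 ih.1, ?_⟩
      rw [← tsum_mul_tsum_eq_tsum_sum_antidiagonal_of_summable_norm h1 ih.1, ih.2,
        (hasSum_qExp hq0 hq (hw j)).tsum_eq, Finset.prod_insert hj]
  exact ⟨(key Finset.univ).1, (key Finset.univ).2 ▸ (key Finset.univ).1.of_norm.hasSum⟩

theorem hasSum_gCoeff (hq0 : q ≠ 0) (hq : ‖q‖ < 1) {n : ℕ} {w : Fin n → 𝕜} {c : 𝕜}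
    (hw : ∀ j, ‖c * w j‖ < 1) :
    HasSum (fun k => c ^ k * gCoeff q w k) (∏ j, 1 / qPochInf (c * w j) q) :=
  (summable_norm_gCoeff_and hq0 hq hw).2

theorem gCoeff_succAbove {n : ℕ} (i : Fin (n + 1)) {w : Fin (n + 1) → 𝕜} (hw : w i ≠ 0) (m : ℕ) :
    w i ^ (-(m : ℤ)) * gCoeff q w m = ∑ p ∈ Finset.HasAntidiagonal.antidiagonal m, qPochInv q (p.1 : ℤ) *
      (w i ^ (-(p.2 : ℤ)) * gCoeff q (fun b => w (i.succAbove b)) p.2) := by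
  rw [gCoeff, gSeries, Fin.prod_univ_succAbove _ i, PowerSeries.coeff_mul, Finset.mul_sum]
  refine Finset.sum_congr rfl fun p hp => ?_
  rw [PowerSeries.coeff_mk, ← Finset.HasAntidiagonal.mem_antidiagonal.1 hp, gCoeff, gSeries]
  push_cast
  rw [neg_add, zpow_add₀ hw, zpow_neg, zpow_natCast]
  field_simp

/-- g_k has non-negative coefficients in w, so its value at (1, …, 1) is a uniform majorant on the
torus, used for dominated convergence. -/
theorem norm_gCoeff_le {q : ℝ} (hq0 : 0 < q) (hq1 : q < 1) {n : ℕ} {w : Fin n → ℂ}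
    (hw : w ∈ unitTorus n) (k : ℕ) : ‖gCoeff (q : ℂ) w k‖ ≤ gCoeff q (fun _ : Fin n => (1 : ℝ)) k := by
  unfold gCoeff gSeries
  rw [PowerSeries.coeff_prod, PowerSeries.coeff_prod]
  refine (norm_sum_le _ _).trans (Finset.sum_le_sum fun l _ => ?_)
  rw [norm_prod]
  refine Finset.prod_le_prod (fun _ _ => norm_nonneg _) fun j _ => ?_
  rw [PowerSeries.coeff_mk, PowerSeries.coeff_mk, norm_mul, norm_pow, hw j,
    ← ofReal_qPochInv (by rwa [Real.norm_of_nonneg hq0.le]), Complex.norm_real,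
    Real.norm_of_nonneg (qPochInv_nonneg hq0 hq1 _)]

theorem summable_gCoeff_one {q : ℝ} (hq0 : 0 < q) (hq1 : q < 1) (n : ℕ) {c : ℝ} (hc0 : 0 ≤ c)
    (hc : c < 1) : Summable fun k => c ^ k * gCoeff q (fun _ : Fin n => (1 : ℝ)) k :=
  (hasSum_gCoeff hq0.ne' (by rwa [Real.norm_of_nonneg hq0.le]) fun _ => by
    rwa [mul_one, Real.norm_of_nonneg hc0]).summable

theorem hasSum_torusAvg {n : ℕ} {f : ℕ → (Fin n → ℂ) → ℂ} {g : (Fin n → ℂ) → ℂ}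
    (hf : ∀ k, ContinuousOn (f k) (unitTorus n)) {b : ℕ → ℝ} (hb : Summable b)
    (hfb : ∀ k, ∀ w ∈ unitTorus n, ‖f k w‖ ≤ b k) (hg : ∀ w ∈ unitTorus n, HasSum (f · w) (g w)) :
    HasSum (fun k => torusAvg (f k)) (torusAvg g) := by
  unfold torusAvg
  refine HasSum.mul_left _ (hasSum_integral_of_dominated_convergence (fun k _ => b k)
    (fun k => (integrable_comp_torusPt (hf k)).aestronglyMeasurable)
    (fun k => ae_of_all _ fun θ => hfb k _ (torusPt_mem θ)) (ae_of_all _ fun _ => hb) ?_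
    (ae_of_all _ fun θ => hg _ (torusPt_mem θ)))
  exact integrableOn_const isCompact_Icc.measure_lt_top.ne

end Series

/-! ### The average of the weight. -/

section Constant

variable {q : ℝ}

theorem exists_norm_le_unitTorus {n : ℕ} {f : (Fin n → ℂ) → ℂ} (hf : ContinuousOn f (unitTorus n)) :
    ∃ B, ∀ w ∈ unitTorus n, ‖f w‖ ≤ B := by
  have hc : IsCompact (unitTorus n) := by
    have : unitTorus n = Set.univ.pi fun _ => Metric.sphere (0 : ℂ) 1 := by
      ext w; simp [unitTorus]
    rw [this]
    exact isCompact_univ_pi fun _ => isCompact_sphere 0 1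
  exact hc.exists_bound_of_continuousOn hf

theorem differentiableOn_zpow_mul {n : ℕ} (i : Fin n) (c : ℤ) {f : (Fin n → ℂ) → ℂ}
    (hf : Differentiable ℂ f) :
    DifferentiableOn ℂ (fun w : Fin n → ℂ => w i ^ c * f w) (unitsSet n) :=
  DifferentiableOn.fun_mul (fun w hw => ((differentiableAt_zpow.2 (Or.inl (hw i))).comp
    (f := fun v : Fin n → ℂ => v i) w (by fun_prop)).differentiableWithinAt) hf.differentiableOn

/-- Let S_m be the left side. Interpolation of the constant 1 gives S_0; the operator applied to F =
Σ_k w_k^{-(m+1)} g_{m+1} gives (q^{-(m+1)} - 1)(S_{m+1} - S_m) = 0. At least two variables are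
needed, as a polynomial of degree 1 is interpolated. -/
theorem sum_torusAvg_gCoeff (hq0 : 0 < q) (hq1 : q < 1) (n m : ℕ) :
    ∑ i : Fin (n + 2), torusAvg (fun w => deltaTwist (q : ℂ) q 1 i w *
      (w i ^ (-(m : ℤ)) * gCoeff (q : ℂ) w m)) = torusAvg (delta (q : ℂ) (n := n + 2)) := by
  have hq := norm_ofReal_lt hq0 hq1
  have hqc : (q : ℂ) ≠ 0 := Complex.ofReal_ne_zero.2 hq0.ne'
  have hd : ∀ (m : ℕ) (i : Fin (n + 2)), ContinuousOn (fun w => deltaTwist (q : ℂ) q 1 i w *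
      (w i ^ (-(m : ℤ)) * gCoeff (q : ℂ) w m)) (unitTorus (n + 2)) := fun m i =>
    DifferentiableOn.continuousOn_unitTorus ((differentiableOn_deltaTwist hq q 1 i).mul
      (differentiableOn_zpow_mul i _ (differentiable_gCoeff m)))
  induction m with
  | zero =>
    rw [← torusAvg_sum _ fun i _ => hd 0 i]
    refine torusAvg_congr fun w hw => ?_
    have := sum_deltaTwist_eval hq (unitTorus_subset _ hw) (f := 1) (by simp)
    simpa [gCoeff_zero hq] using this
  | succ m ih =>
    rw [← ih]
    set F : (Fin (n + 2) → ℂ) → ℂ := fun w => ∑ k, w k ^ (-((m + 1 : ℕ) : ℤ)) *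
      gCoeff (q : ℂ) w (m + 1) with hF
    have hFd : DifferentiableOn ℂ F (unitsSet (n + 2)) :=
      DifferentiableOn.fun_sum fun k _ => differentiableOn_zpow_mul k _ (differentiable_gCoeff _)
    have h1 := sum_torusAvg_deltaTwist hq0 hq1 hFd
    have h2 : ∀ w ∈ unitTorus (n + 2), ∑ i, deltaTwist (q : ℂ) q 1 i w *
        F (Function.update w i (q * w i)) = delta (q : ℂ) w * F w +
          ((q : ℂ) ^ (-((m + 1 : ℕ) : ℤ)) - 1) * ∑ i, (deltaTwist (q : ℂ) q 1 i w *
            (w i ^ (-((m + 1 : ℕ) : ℤ)) * gCoeff (q : ℂ) w (m + 1)) -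
            deltaTwist (q : ℂ) q 1 i w * (w i ^ (-(m : ℤ)) * gCoeff (q : ℂ) w m)) := by
      intro w hw
      have hw' := unitTorus_subset _ hw
      have h3 := sum_deltaTwist_eval hq hw' (f := Polynomial.C (gCoeff (q : ℂ) w (m + 1)) -
        Polynomial.C (gCoeff (q : ℂ) w m) * Polynomial.X) (lt_of_le_of_lt
          (b := 1) (by compute_degree) (by omega))
      simp only [Polynomial.eval_sub, Polynomial.eval_C, Polynomial.eval_mul, Polynomial.eval_X,
        mul_zero, sub_zero] at h3
      -- The shift changes only the i-th term of the power sum. The unchanged sum reproduces the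
      -- average of F by interpolation, and the correction produces S_{m+1} - S_m.
      have h4 : ∀ i, F (Function.update w i (q * w i)) = (gCoeff (q : ℂ) w (m + 1) -
          gCoeff (q : ℂ) w m * w i) * (∑ k, w k ^ (-((m + 1 : ℕ) : ℤ)) +
            ((q : ℂ) ^ (-((m + 1 : ℕ) : ℤ)) - 1) * w i ^ (-((m + 1 : ℕ) : ℤ))) := by
        intro i
        have h5 : ∑ k, Function.update w i (q * w i) k ^ (-((m + 1 : ℕ) : ℤ)) =
            ∑ k, w k ^ (-((m + 1 : ℕ) : ℤ)) +
            ((q : ℂ) ^ (-((m + 1 : ℕ) : ℤ)) - 1) * w i ^ (-((m + 1 : ℕ) : ℤ)) := by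
          rw [← Finset.add_sum_erase _ _ (Finset.mem_univ i), ← Finset.add_sum_erase Finset.univ
            (fun k => w k ^ (-((m + 1 : ℕ) : ℤ))) (Finset.mem_univ i), Function.update_self, mul_zpow,
            Finset.sum_congr rfl fun j hj => by
              rw [Function.update_of_ne (Finset.ne_of_mem_erase hj)]]
          ring
        simp only [hF]
        rw [← Finset.sum_mul, h5, gCoeff_update hqc hq, PowerSeries.coeff_succ_X_mul, gCoeff, gCoeff]
        ring
      simp_rw [h4]
      have h6 : delta (q : ℂ) w * F w = (∑ i, deltaTwist (q : ℂ) q 1 i w *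
          (gCoeff (q : ℂ) w (m + 1) - gCoeff (q : ℂ) w m * w i)) *
            ∑ k, w k ^ (-((m + 1 : ℕ) : ℤ)) := by
        rw [h3]
        simp only [hF]
        rw [← Finset.sum_mul]
        ring
      rw [h6, Finset.sum_mul, Finset.mul_sum, ← Finset.sum_add_distrib]
      refine Finset.sum_congr rfl fun i _ => ?_
      have h7 : w i ^ (-(m : ℤ)) = w i * w i ^ (-((m + 1 : ℕ) : ℤ)) := by
        rw [← zpow_one_add₀ (hw' i)]
        congr 1
        push_cast
        ring
      rw [h7]
      ring
    rw [← torusAvg_sum, torusAvg_congr h2, torusAvg_add, torusAvg_const_mul, torusAvg_sum,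
      Finset.sum_congr rfl fun i _ => torusAvg_sub (hd (m + 1) i) (hd m i),
      Finset.sum_sub_distrib, add_eq_left] at h1
    · refine sub_eq_zero.1 ((mul_eq_zero.1 h1).resolve_left (sub_ne_zero.2 ?_))
      exact ofReal_zpow_ne_one hq0 hq1 (by push_cast; omega)
    · exact fun i _ => (hd (m + 1) i).sub (hd m i)
    · exact DifferentiableOn.continuousOn_unitTorus ((differentiableOn_delta hq _).mul hFd)
    · exact continuousOn_const.mul (continuousOn_finsetSum _ fun i _ =>
        (hd (m + 1) i).sub (hd m i))
    · intro i _
      refine DifferentiableOn.continuousOn_unitTorus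
        ((differentiableOn_deltaTwist hq q 1 i).mul (hFd.comp (f := fun w : Fin (n + 2) → ℂ =>
          Function.update w i (q * w i)) ?_ fun w hw j => ?_))
      · refine Differentiable.differentiableOn (differentiable_pi.2 fun j => ?_)
        by_cases h : j = i
        · subst h; simp only [Function.update_self]; fun_prop
        · simp only [Function.update_of_ne h]; fun_prop
      · by_cases h : j = i
        · subst h; simpa [hq0.ne'] using hw j
        · simpa [Function.update_of_ne h] using hw j

/-- Summing (q/w_i)^k g_k over k gives ∏ 1/(q w_b/w_i;q)_∞, which cancels the factors twisted by q.
The remaining ∏ (w_i/w_b;q)_∞ is entire in w_i, so averaging over w_i replaces it by its value 1 at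
w_i = 0. -/
theorem hasSum_torusAvg_gCoeff (hq0 : 0 < q) (hq1 : q < 1) {n : ℕ} (i : Fin (n + 1)) :
    HasSum (fun k : ℕ => torusAvg (fun w : Fin (n + 1) → ℂ => (q : ℂ) ^ k *
      (deltaTwist (q : ℂ) 1 q i w * (w i ^ (-(k : ℤ)) *
        gCoeff (q : ℂ) (fun b => w (i.succAbove b)) k)))) (torusAvg (delta (q : ℂ) (n := n))) := by
  have hq := norm_ofReal_lt hq0 hq1
  have hqc : (q : ℂ) ≠ 0 := Complex.ofReal_ne_zero.2 hq0.ne'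
  have hmean : torusAvg (fun w : Fin (n + 1) → ℂ => delta (q : ℂ) (fun b => w (i.succAbove b)) *
      ∏ b, qPochInf (w i / w (i.succAbove b)) (q : ℂ)) = torusAvg (delta (q : ℂ) (n := n)) := by
    rw [torusAvg_succ_right i]
    · refine torusAvg_congr fun y hy => ?_
      simp only [Fin.insertNth_apply_succAbove, Fin.insertNth_apply_same]
      rw [integral_circle_mean (h := fun x => delta (q : ℂ) (fun b => y b) *
        ∏ b, qPochInf (x / y b) (q : ℂ))]
      · simp only [zero_div, qPochInf_zero, Finset.prod_const_one, mul_one]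
        rw [← mul_assoc, inv_mul_cancel₀ two_pi_ne_zero', one_mul]
      · refine Differentiable.const_mul ?_ _
        refine Differentiable.fun_finsetProd fun b _ => ?_
        exact (differentiable_qPochInf hq).comp (differentiable_id.div_const _)
    · refine DifferentiableOn.continuousOn_unitTorus (DifferentiableOn.fun_mul ?_
        (differentiableOn_finsetProd fun b _ => ?_))
      · refine (differentiableOn_delta hq n).comp (t := unitsSet n)
          (f := fun (w : Fin (n + 1) → ℂ) b => w (i.succAbove b)) ?_ fun w hw b => hw _
        fun_prop
      · simpa only [one_mul] using differentiableOn_qPochInf_div hq 1 i (i.succAbove b)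
  rw [← hmean]
  obtain ⟨B, hB⟩ := exists_norm_le_unitTorus
    (DifferentiableOn.continuousOn_unitTorus (differentiableOn_deltaTwist hq 1 q i))
  refine hasSum_torusAvg (fun k => DifferentiableOn.continuousOn_unitTorus ?_)
    ((summable_gCoeff_one hq0 hq1 n hq0.le hq1).mul_left B) (fun k w hw => ?_) fun w hw => ?_
  · refine DifferentiableOn.const_mul ((differentiableOn_deltaTwist hq 1 q i).mul
      (differentiableOn_zpow_mul i _ ?_)) _
    exact (differentiable_gCoeff k).comp (f := fun (w : Fin (n + 1) → ℂ) b => w (i.succAbove b))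
      (by fun_prop)
  · rw [norm_mul, norm_mul, norm_mul, norm_pow, Complex.norm_real, Real.norm_of_nonneg hq0.le,
      norm_zpow, hw i, one_zpow, one_mul]
    have h1 := norm_gCoeff_le hq0 hq1 (w := fun b => w (i.succAbove b)) (fun b => hw _) k
    have h2 := hB w hw
    calc _ ≤ q ^ k * (B * gCoeff q (fun _ : Fin n => (1 : ℝ)) k) := by
          have := (norm_nonneg _).trans h2
          gcongr
      _ = _ := by ring
  · have hw' := unitTorus_subset _ hw
    have h1 := (hasSum_gCoeff hqc hq (w := fun b => w (i.succAbove b)) (c := q * (w i)⁻¹) fun b => by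
      rw [norm_mul, norm_mul, norm_inv, hw i, hw, inv_one, mul_one, mul_one]
      exact hq).mul_left (deltaTwist (q : ℂ) 1 q i w)
    have h3 : deltaTwist (q : ℂ) 1 q i w * ∏ b, 1 / qPochInf ((q : ℂ) * (w i)⁻¹ * w (i.succAbove b)) (q : ℂ) =
        delta (q : ℂ) (fun b => w (i.succAbove b)) *
          ∏ b, qPochInf (w i / w (i.succAbove b)) (q : ℂ) := by
      rw [deltaTwist, mul_assoc, ← Finset.prod_mul_distrib]
      congr 1
      refine Finset.prod_congr rfl fun b _ => ?_
      have h2 : qPochInf ((q : ℂ) * (w i)⁻¹ * w (i.succAbove b)) (q : ℂ) ≠ 0 :=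
        qPochInf_ne_zero_of_norm_lt hq (by
          rw [norm_mul, norm_mul, norm_inv, hw i, hw, inv_one, mul_one, mul_one]
          exact hq)
      rw [one_mul, show (q : ℂ) * w (i.succAbove b) / w i = q * (w i)⁻¹ * w (i.succAbove b) by ring]
      rw [mul_assoc, mul_one_div_cancel h2, mul_one]
    rw [h3] at h1
    refine h1.congr_fun fun k => ?_
    rw [mul_pow, inv_pow, zpow_neg, zpow_natCast]
    ring

/-- Splitting off the variable w_i writes the m-independent quantity of `sum_torusAvg_gCoeff` as Σ_i
Σ_k A_i(k)/(q;q)_{m-k}. As m → ∞ the coefficients tend to 1/(q;q)_∞, and Σ_k A_i(k) is the average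
in one variable fewer, for each of the n + 2 choices of i. -/
theorem torusAvg_delta_succ (hq0 : 0 < q) (hq1 : q < 1) (n : ℕ) :
    torusAvg (delta (q : ℂ) (n := n + 2)) =
      (n + 2) * (1 / qPochInf (q : ℂ) q) * torusAvg (delta (q : ℂ) (n := n + 1)) := by
  have hq := norm_ofReal_lt hq0 hq1
  have hqc : (q : ℂ) ≠ 0 := Complex.ofReal_ne_zero.2 hq0.ne'
  set A : Fin (n + 2) → ℕ → ℂ := fun i k => torusAvg (fun w : Fin (n + 2) → ℂ => (q : ℂ) ^ k *
      (deltaTwist (q : ℂ) 1 q i w * (w i ^ (-(k : ℤ)) *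
        gCoeff (q : ℂ) (fun b => w (i.succAbove b)) k))) with hA
  have hcd : ∀ (i : Fin (n + 2)) (k : ℕ), Differentiable ℂ fun w : Fin (n + 2) → ℂ =>
      gCoeff (q : ℂ) (fun b => w (i.succAbove b)) k := fun i k =>
    (differentiable_gCoeff k).comp (f := fun (w : Fin (n + 2) → ℂ) b => w (i.succAbove b))
      (by fun_prop)
  have hdk : ∀ (i : Fin (n + 2)) (k : ℕ), DifferentiableOn ℂ (fun w : Fin (n + 2) → ℂ => (q : ℂ) ^ k *
      (deltaTwist (q : ℂ) 1 q i w * (w i ^ (-(k : ℤ)) *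
        gCoeff (q : ℂ) (fun b => w (i.succAbove b)) k))) (unitsSet (n + 2)) := fun i k =>
    DifferentiableOn.const_mul ((differentiableOn_deltaTwist hq 1 q i).mul
      (differentiableOn_zpow_mul i _ (hcd i k))) _
  have h1 : ∀ m : ℕ, ∀ i, torusAvg (fun w => deltaTwist (q : ℂ) q 1 i w *
      (w i ^ (-(m : ℤ)) * gCoeff (q : ℂ) w m)) =
      ∑ p ∈ Finset.HasAntidiagonal.antidiagonal m, qPochInv (q : ℂ) (p.1 : ℤ) * A i p.2 := by
    intro m i
    -- Scaling w_i by q changes the (1, q) twist into the (q, 1) twist, and w_i^{-k} absorbs the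
    -- factor q^k.
    have h2 : ∀ p : ℕ × ℕ, A i p.2 = torusAvg (fun w : Fin (n + 2) → ℂ =>
        deltaTwist (q : ℂ) q 1 i w * (w i ^ (-(p.2 : ℤ)) *
          gCoeff (q : ℂ) (fun b => w (i.succAbove b)) p.2)) := by
      intro p
      have h := torusAvg_scale i (hdk i p.2) hq0
      simp only [hA]
      rw [← h]
      refine torusAvg_congr fun w hw => ?_
      simp only [deltaTwist_update hqc, Function.update_self, mul_zpow,
        Function.update_of_ne (Fin.succAbove_ne i _)]
      have := pow_ne_zero p.2 hqc
      rw [zpow_neg, zpow_natCast]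
      field_simp
    simp_rw [h2, ← torusAvg_const_mul]
    rw [← torusAvg_sum]
    · refine torusAvg_congr fun w hw => ?_
      rw [gCoeff_succAbove i (unitTorus_subset _ hw i), Finset.mul_sum]
      exact Finset.sum_congr rfl fun p _ => by ring
    · intro p _
      exact continuousOn_const.mul (DifferentiableOn.continuousOn_unitTorus
        ((differentiableOn_deltaTwist hq q 1 i).mul (differentiableOn_zpow_mul i _ (hcd i p.2))))
  have h2 : ∀ i, Tendsto (fun m : ℕ => ∑ p ∈ Finset.HasAntidiagonal.antidiagonal m,
      qPochInv (q : ℂ) (p.1 : ℤ) * A i p.2) atTop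
      (𝓝 ((1 / qPochInf (q : ℂ) q) * torusAvg (delta (q : ℂ) (n := n + 1)))) := by
    intro i
    obtain ⟨C, hC0, hC⟩ := exists_norm_qPochInv_le hq
    have hs := hasSum_torusAvg_gCoeff hq0 hq1 i
    rw [← hs.tsum_eq, ← tsum_mul_left]
    have h3 : ∀ m : ℕ, ∑ p ∈ Finset.HasAntidiagonal.antidiagonal m, qPochInv (q : ℂ) (p.1 : ℤ) * A i p.2 =
        ∑' k : ℕ, qPochInv (q : ℂ) ((m : ℤ) - k) * A i k := by
      intro m
      rw [Finset.Nat.sum_antidiagonal_eq_sum_range_succ_mk, tsum_eq_sum (s := Finset.range m.succ),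
        ← Finset.sum_range_reflect]
      · refine Finset.sum_congr rfl fun k hk => ?_
        have := Finset.mem_range.1 hk
        simp only
        rw [show m - (m.succ - 1 - k) = k by omega, show ((m.succ - 1 - k : ℕ) : ℤ) = m - k by omega]
      · intro k hk
        rw [qPochInv_of_neg hqc hq (by simp at hk; omega), zero_mul]
    simp_rw [h3]
    refine tendsto_tsum_of_dominated_convergence (bound := fun k => C * ‖A i k‖)
      (hs.summable.norm.mul_left C) (fun k => ?_) (Eventually.of_forall fun m k => ?_)
    · refine Tendsto.mul_const _ ((tendsto_add_atTop_iff_nat k).1 ?_)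
      simpa using tendsto_qPochInv_atTop hq
    · rw [norm_mul]
      refine mul_le_mul_of_nonneg_right ?_ (norm_nonneg _)
      rcases lt_or_ge ((m : ℤ) - k) 0 with h | h
      · rwa [qPochInv_of_neg hqc hq h, norm_zero]
      · obtain ⟨l, hl⟩ := Int.eq_ofNat_of_zero_le h
        rw [hl]
        exact hC l
  have h3 := tendsto_finsetSum Finset.univ fun i _ => h2 i
  have h4 : ∀ m : ℕ, ∑ i, ∑ p ∈ Finset.HasAntidiagonal.antidiagonal m, qPochInv (q : ℂ) (p.1 : ℤ) * A i p.2 =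
      torusAvg (delta (q : ℂ) (n := n + 2)) := by
    intro m
    rw [← sum_torusAvg_gCoeff hq0 hq1 n m]
    exact Finset.sum_congr rfl fun i _ => (h1 m i).symm
  simp_rw [h4] at h3
  rw [tendsto_nhds_unique tendsto_const_nhds h3, Finset.sum_const, Finset.card_univ,
    Fintype.card_fin, nsmul_eq_mul]
  push_cast
  ring

theorem torusAvg_delta (hq0 : 0 < q) (hq1 : q < 1) (n : ℕ) :
    torusAvg (delta (q : ℂ) (n := n + 1)) =
      (n + 1).factorial * (1 / qPochInf (q : ℂ) q) ^ n := by
  induction n with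
  | zero =>
    have : delta (q : ℂ) (n := 1) = fun _ => 1 := by
      funext w
      simp [delta]
    rw [this, torusAvg_const]
    simp
  | succ n ih =>
    rw [torusAvg_delta_succ hq0 hq1, ih, Nat.factorial_succ (n + 1)]
    push_cast
    ring

end Constant

/-! ### Reflection of strips and the branching rule for Q. -/

section Weights

/-- Extension of a row by zeros. -/
def extZ {n : ℕ} (lam : Fin n → ℤ) (i : ℕ) : ℤ := if h : i < n then lam ⟨i, h⟩ else 0

/-- The row of length `m` obtained by truncating a row or extending it by zeros. -/
def resize (m : ℕ) {n : ℕ} (lam : Fin n → ℤ) : Fin m → ℤ := fun i => extZ lam i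

theorem extZ_fin {n : ℕ} (lam : Fin n → ℤ) (i : Fin n) : extZ lam i = lam i := by
  simp [extZ]

theorem extZ_of_le {n : ℕ} (lam : Fin n → ℤ) {i : ℕ} (h : n ≤ i) : extZ lam i = 0 := by
  simp [extZ, h]

theorem extZ_resize {m n : ℕ} {lam : Fin n → ℤ} (h : ∀ i, m ≤ i → extZ lam i = 0) :
    extZ (resize m lam) = extZ lam := by
  funext i
  by_cases hi : i < m
  · rw [extZ, dif_pos hi]; rfl
  · rw [extZ_of_le _ (not_lt.1 hi), h i (not_lt.1 hi)]

theorem resize_of_extZ_eq {m n : ℕ} {lam : Fin n → ℤ} {mu : Fin m → ℤ} (h : extZ lam = extZ mu) :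
    resize m lam = mu := by
  funext i
  rw [resize, h, extZ_fin]

theorem sum_eq_sum_range_extZ {n : ℕ} (lam : Fin n → ℤ) {m : ℕ} (hm : n ≤ m) :
    ∑ i, lam i = ∑ i ∈ Finset.range m, extZ lam i := by
  rw [← Finset.sum_subset (Finset.range_mono hm) fun i _ hi => extZ_of_le lam (by simpa using hi),
    Finset.sum_range]
  exact Finset.sum_congr rfl fun i _ => (extZ_fin lam i).symm

variable {𝕜 : Type*} [RCLike 𝕜] {q : 𝕜}

/-- `∏_{i<n} (q;q)_{λ_i - λ_{i+1}}` -/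
noncomputable def sigNorm (q : 𝕜) {n : ℕ} (lam : Fin (n + 1) → ℤ) : 𝕜 :=
  ∏ i : Fin n, qPoch q q (lam i.castSucc - lam i.succ)

theorem horCoeff_eq {n : ℕ} (lam nu : Fin (n + 1) → ℤ) :
    horCoeff q lam nu = sigNorm q lam * ((∏ j, qPochInv q (nu j - lam j)) *
      ∏ i : Fin n, qPochInv q (lam i.castSucc - nu i.succ)) := by
  rw [horCoeff, sigNorm, Fin.prod_univ_succ (fun j => qPochInv q (nu j - lam j))]
  simp only [Finset.prod_mul_distrib]
  ring

theorem sigNorm_negSig {n : ℕ} (lam : Fin (n + 1) → ℤ) :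
    sigNorm q (negSig lam) = sigNorm q lam := by
  unfold sigNorm negSig
  rw [← Equiv.prod_comp Fin.revPerm]
  refine Finset.prod_congr rfl fun i _ => ?_
  simp only [Fin.revPerm_apply, Fin.rev_castSucc, Fin.rev_succ, Fin.rev_rev]
  congr 1
  ring

/-- If ν/λ is a horizontal strip, so is (-λ)/(-ν). The two coefficients share the 1/(q;q) factors
and differ only in whose norm ∏ (q;q)_{λ_i - λ_{i+1}} multiplies them. -/
theorem horCoeff_negSig {n : ℕ} (lam nu : Fin (n + 1) → ℤ) :
    horCoeff q lam nu * sigNorm q nu = sigNorm q lam * horCoeff q (negSig nu) (negSig lam) := by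
  have h1 : ∏ j, qPochInv q (negSig lam j - negSig nu j) = ∏ j, qPochInv q (nu j - lam j) := by
    rw [← Equiv.prod_comp Fin.revPerm]
    refine Finset.prod_congr rfl fun i _ => ?_
    simp only [negSig, Fin.revPerm_apply, Fin.rev_rev]
    congr 1
    ring
  have h2 : ∏ i : Fin n, qPochInv q (negSig nu i.castSucc - negSig lam i.succ) =
      ∏ i : Fin n, qPochInv q (lam i.castSucc - nu i.succ) := by
    rw [← Equiv.prod_comp Fin.revPerm]
    refine Finset.prod_congr rfl fun i _ => ?_
    simp only [negSig, Fin.revPerm_apply, Fin.rev_castSucc, Fin.rev_succ, Fin.rev_rev]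
    congr 1
    ring
  rw [horCoeff_eq, horCoeff_eq, sigNorm_negSig, h1, h2]
  ring

open Classical in
/-- `Q_ρ(α_0, …, α_{k-1})` for partitions `ρ` with at most `k` parts. -/
noncomputable def alphaWeight (q : 𝕜) (α : ℕ → 𝕜) (k : ℕ) {n : ℕ} (rho : Fin n → ℤ) : 𝕜 :=
  if IsPartition rho ∧ ∀ i, k ≤ i → extZ rho i = 0
    then whittakerQ q (resize k rho) fun i : Fin k => α i else 0

theorem alphaWeight_of_ne {α : ℕ → 𝕜} {k n : ℕ} {rho : Fin n → ℤ} (h : alphaWeight q α k rho ≠ 0) :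
    IsPartition rho ∧ ∀ i, k ≤ i → extZ rho i = 0 := by
  by_contra hc
  exact h (if_neg hc)

theorem normP_eq {n : ℕ} (lam : Fin n → ℤ) :
    normP q lam = ∏ i ∈ Finset.range n, qPoch q q (extZ lam i - extZ lam (i + 1)) := by
  rw [normP, Finset.prod_range]
  refine Finset.prod_congr rfl fun i _ => ?_
  rw [extZ_fin]
  by_cases h : (i : ℕ) + 1 < n
  · rw [dif_pos h, extZ, dif_pos h]
  · rw [dif_neg h, extZ, dif_neg h, sub_zero]

theorem skewP_eq_range {n : ℕ} (lam : Fin (n + 1) → ℤ) (mu : Fin n → ℤ) (a : 𝕜) :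
    skewP q lam mu a = a ^ ((∑ i, lam i) - ∑ i, mu i) *
      ((∏ i ∈ Finset.range n, qPoch q q (extZ lam i - extZ lam (i + 1))) *
        ((∏ i ∈ Finset.range n, qPochInv q (extZ lam i - extZ mu i)) *
          ∏ i ∈ Finset.range n, qPochInv q (extZ mu i - extZ lam (i + 1)))) := by
  rw [skewP]
  simp only [Finset.prod_range, ← Finset.prod_mul_distrib]
  congr 1
  refine Finset.prod_congr rfl fun i _ => ?_
  have h1 := extZ_fin lam i.castSucc
  have h2 := extZ_fin lam i.succ
  simp only [Fin.val_castSucc, Fin.val_succ] at h1 h2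
  rw [h1, h2, extZ_fin]
  ring

theorem horCoeff_eq_range {n : ℕ} (lam nu : Fin (n + 1) → ℤ) :
    horCoeff q lam nu = (∏ i ∈ Finset.range n, qPoch q q (extZ lam i - extZ lam (i + 1))) *
      ((∏ i ∈ Finset.range (n + 1), qPochInv q (extZ nu i - extZ lam i)) *
        ∏ i ∈ Finset.range n, qPochInv q (extZ lam i - extZ nu (i + 1))) := by
  rw [horCoeff_eq, sigNorm]
  simp only [Finset.prod_range, extZ_fin]
  have h1 : ∀ (ka : Fin (n + 1) → ℤ) (i : Fin n), ka i.castSucc = extZ ka i := fun ka i => by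
    rw [← extZ_fin ka i.castSucc, Fin.val_castSucc]
  have h2 : ∀ (ka : Fin (n + 1) → ℤ) (i : Fin n), ka i.succ = extZ ka (i + 1) := fun ka i => by
    rw [← extZ_fin ka i.succ, Fin.val_succ]
  simp only [h1, h2]

/-- The rows `0 ≤ ν ≤ ρ`. -/
noncomputable def downBox {n : ℕ} (rho : Fin n → ℤ) : Finset (Fin n → ℤ) :=
  Fintype.piFinset fun i => Finset.Icc 0 (rho i)

theorem mem_downBox {n : ℕ} {rho nu : Fin n → ℤ} :
    nu ∈ downBox rho ↔ ∀ i, 0 ≤ nu i ∧ nu i ≤ rho i := by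
  simp [downBox]

theorem mem_downBox_of_ne (hq0 : q ≠ 0) (hq : ‖q‖ < 1) {α : ℕ → 𝕜} {k n : ℕ}
    {rho nu : Fin (n + 1) → ℤ} (h : alphaWeight q α k nu * horCoeff q nu rho ≠ 0) :
    nu ∈ downBox rho ∧ IsHorStrip nu rho := by
  have h1 := alphaWeight_of_ne (left_ne_zero_of_mul h)
  have h2 : IsHorStrip nu rho := by
    by_contra hc
    exact right_ne_zero_of_mul h (horCoeff_eq_zero hq0 hq hc)
  exact ⟨mem_downBox.2 fun i => ⟨h1.1.2 i, h2.le i⟩, h2⟩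

theorem IsHorStrip.extZ_le {n : ℕ} {nu rho : Fin (n + 1) → ℤ} (h : IsHorStrip nu rho) (i : ℕ) :
    extZ nu i ≤ extZ rho i := by
  by_cases hi : i < n + 1
  · simp only [extZ, dif_pos hi]; exact h.le _
  · simp [extZ, hi]

theorem IsHorStrip.extZ_succ_le {n : ℕ} {nu rho : Fin (n + 1) → ℤ} (h : IsHorStrip nu rho) {i : ℕ}
    (hi : i < n) : extZ rho (i + 1) ≤ extZ nu i := by
  simp only [extZ, dif_pos (show i + 1 < n + 1 by omega), dif_pos (show i < n + 1 by omega)]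
  exact (h.2 ⟨i, hi⟩).2

theorem extZ_antitone {n : ℕ} {lam : Fin n → ℤ} (h : IsPartition lam) : Antitone (extZ lam) := by
  intro i j hij
  by_cases hj : j < n
  · simp only [extZ, dif_pos hj, dif_pos (hij.trans_lt hj)]
    exact h.1 hij
  · rw [extZ_of_le _ (not_lt.1 hj), extZ]
    split_ifs
    exacts [h.2 _, le_rfl]

theorem extZ_nonneg {n : ℕ} {lam : Fin n → ℤ} (h : IsPartition lam) (i : ℕ) : 0 ≤ extZ lam i := by
  rw [extZ]
  split_ifs
  exacts [h.2 _, le_rfl]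

theorem isPartition_of_extZ {n : ℕ} {lam : Fin n → ℤ} (h : Antitone (extZ lam)) : IsPartition lam := by
  refine ⟨fun i j hij => ?_, fun i => ?_⟩
  · rw [← extZ_fin lam i, ← extZ_fin lam j]; exact h hij
  · rw [← extZ_fin lam i, ← extZ_of_le lam le_rfl]; exact h i.2.le

/-- Branching of Q in its last variable, read as adding a horizontal strip: `skewP` times the ratio
of the norms is `horCoeff`. Rows have fixed length n + 1, and having at most k parts is expressed by
zeros. -/
theorem alphaWeight_succ (hq0 : q ≠ 0) (hq : ‖q‖ < 1) (α : ℕ → 𝕜) {k n : ℕ} (hk : k ≤ n)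
    (rho : Fin (n + 1) → ℤ) :
    alphaWeight q α (k + 1) rho = ∑ nu ∈ downBox rho, alphaWeight q α k nu * horCoeff q nu rho *
      α k ^ (∑ i, rho i - ∑ i, nu i) := by
  by_cases hr : IsPartition rho ∧ ∀ i, k + 1 ≤ i → extZ rho i = 0
  swap
  · rw [alphaWeight, if_neg hr]
    symm
    refine Finset.sum_eq_zero fun nu _ => mul_eq_zero_of_left ?_ _
    by_contra hne
    obtain ⟨h1, h2⟩ := alphaWeight_of_ne (left_ne_zero_of_mul hne)
    have hs := (mem_downBox_of_ne hq0 hq hne).2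
    have hrp : IsPartition rho := ⟨hs.antitone, fun i => (h1.2 i).trans (hs.le i)⟩
    refine hr ⟨hrp, fun i hi => ?_⟩
    by_cases hin : i < n + 1
    · obtain ⟨i, rfl⟩ : ∃ i', i = i' + 1 := ⟨i - 1, by omega⟩
      exact le_antisymm ((hs.extZ_succ_le (by omega)).trans (h2 i (by omega)).le) (extZ_nonneg hrp _)
    · exact extZ_of_le _ (not_lt.1 hin)
  · obtain ⟨hr1, hr2⟩ := hr
    have he : extZ (resize (k + 1) rho) = extZ rho := extZ_resize hr2
    rw [alphaWeight, if_pos ⟨hr1, hr2⟩, whittakerQ, whittakerP, Finset.sum_div]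
    have hcs : ∀ i : Fin k, resize (k + 1) rho i.castSucc = extZ rho i := fun i => rfl
    have hsu : ∀ i : Fin k, resize (k + 1) rho i.succ = extZ rho (i + 1) := fun i => by
      rw [resize, Fin.val_succ]
    have hpad : ∀ mu : Fin k → ℤ, extZ (resize (n + 1) mu) = extZ mu := fun mu =>
      extZ_resize fun i hi => extZ_of_le mu (by omega)
    -- Padding by zeros embeds the interlacing rows of length k among the rows below ρ, and the
    -- remaining rows have weight zero.
    refine Finset.sum_of_injOn (resize (n + 1)) ?_ ?_ ?_ ?_
    · intro mu _ mu' _ h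
      rw [← resize_of_extZ_eq (hpad mu), h, resize_of_extZ_eq (hpad mu')]
    · intro mu hmu
      have hmu := Fintype.mem_piFinset.1 hmu
      refine mem_downBox.2 fun i => ?_
      rw [resize, ← extZ_fin rho i]
      by_cases hi : (i : ℕ) < k
      · have := Finset.mem_Icc.1 (hmu ⟨i, hi⟩)
        rw [hcs, hsu] at this
        simp only [extZ, dif_pos hi] at this ⊢
        exact ⟨(extZ_nonneg hr1 _).trans this.1, this.2⟩
      · rw [extZ_of_le _ (not_lt.1 hi)]
        exact ⟨le_rfl, extZ_nonneg hr1 _⟩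
    · intro nu hnu hni
      refine mul_eq_zero_of_left ?_ _
      by_contra hne
      obtain ⟨h1, h2⟩ := alphaWeight_of_ne (left_ne_zero_of_mul hne)
      have hs := (mem_downBox_of_ne hq0 hq hne).2
      refine hni ⟨resize k nu, ?_, resize_of_extZ_eq (extZ_resize h2)⟩
      refine Finset.mem_coe.2 (Fintype.mem_piFinset.2 fun i => Finset.mem_Icc.2 ?_)
      rw [hcs, hsu]
      exact ⟨hs.extZ_succ_le (by omega), hs.extZ_le i⟩
    · intro mu hmu
      have hmu := Fintype.mem_piFinset.1 hmu
      have hmu1 : ∀ i, i < k → extZ rho (i + 1) ≤ extZ mu i ∧ extZ mu i ≤ extZ rho i := by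
        intro i hi
        have := Finset.mem_Icc.1 (hmu ⟨i, hi⟩)
        rw [hcs, hsu] at this
        simpa only [extZ, dif_pos hi] using this
      have hanti : Antitone (extZ mu) := by
        refine antitone_nat_of_succ_le fun i => ?_
        by_cases hi : i + 1 < k
        · exact (hmu1 _ hi).2.trans (hmu1 i (by omega)).1
        · rw [extZ_of_le mu (not_lt.1 hi)]
          by_cases hi' : i < k
          · exact (extZ_nonneg hr1 _).trans (hmu1 i hi').1
          · rw [extZ_of_le mu (not_lt.1 hi')]
      rw [alphaWeight, if_pos ⟨isPartition_of_extZ (by rw [hpad]; exact hanti), fun i hi => by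
        rw [hpad, extZ_of_le mu hi]⟩, resize_of_extZ_eq (hpad mu), whittakerQ, skewP_eq_range,
        horCoeff_eq_range, normP_eq, normP_eq, he, hpad,
        sum_eq_sum_range_extZ (resize (k + 1) rho) (m := n + 1) (by omega), he,
        sum_eq_sum_range_extZ mu (m := n + 1) (by omega),
        sum_eq_sum_range_extZ rho (m := n + 1) le_rfl,
        sum_eq_sum_range_extZ (resize (n + 1) mu) (m := n + 1) le_rfl, hpad]
      have hmz : ∀ i, k ≤ i → extZ mu i = 0 := fun i hi => extZ_of_le mu hi
      have e1 : ∏ i ∈ Finset.range n, qPoch q q (extZ mu i - extZ mu (i + 1)) =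
          ∏ i ∈ Finset.range k, qPoch q q (extZ mu i - extZ mu (i + 1)) := by
        refine (Finset.prod_subset (Finset.range_mono hk) fun i _ hi => ?_).symm
        have hi : k ≤ i := by simpa using hi
        rw [hmz i hi, hmz (i + 1) (by omega), sub_zero, qPoch_zero hq]
      have e2 : ∏ i ∈ Finset.range n, qPochInv q (extZ mu i - extZ rho (i + 1)) =
          ∏ i ∈ Finset.range k, qPochInv q (extZ mu i - extZ rho (i + 1)) := by
        refine (Finset.prod_subset (Finset.range_mono hk) fun i _ hi => ?_).symm
        have hi : k ≤ i := by simpa using hi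
        rw [hmz i hi, hr2 (i + 1) (by omega), sub_zero, qPochInv_zero hq]
      have e3 : ∏ i ∈ Finset.range (n + 1), qPochInv q (extZ rho i - extZ mu i) =
          (∏ i ∈ Finset.range k, qPochInv q (extZ rho i - extZ mu i)) *
            qPochInv q (extZ rho k) := by
        rw [← Finset.prod_subset (Finset.range_mono (show k + 1 ≤ n + 1 by omega)) fun i _ hi => by
          have hi : k + 1 ≤ i := by simpa using hi
          rw [hmz i (by omega), hr2 i (by omega), sub_zero, qPochInv_zero hq],
          Finset.prod_range_succ, hmz k le_rfl, sub_zero]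
      -- The last factor (q;q)_{ρ_k} of the norm of ρ, with zero-based index k, matches the factor
      -- 1/(q;q)_{ρ_k - μ_k} of `horCoeff`, as μ_k = 0.
      rw [e1, e2, e3, Finset.prod_range_succ, hr2 (k + 1) le_rfl, sub_zero]
      have n1 : ∏ i ∈ Finset.range k, qPoch q q (extZ mu i - extZ mu (i + 1)) ≠ 0 :=
        Finset.prod_ne_zero_iff.2 fun i _ => qPoch_ne_zero hq (sub_nonneg.2 (hanti (by omega)))
      have n2 : ∏ i ∈ Finset.range k, qPoch q q (extZ rho i - extZ rho (i + 1)) ≠ 0 :=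
        Finset.prod_ne_zero_iff.2 fun i _ =>
          qPoch_ne_zero hq (sub_nonneg.2 (extZ_antitone hr1 (by omega)))
      have n3 : qPoch q q (extZ rho k) ≠ 0 := qPoch_ne_zero hq (extZ_nonneg hr1 _)
      have n4 := qPoch_mul_qPochInv hq (extZ_nonneg hr1 k)
      rw [eq_inv_of_mul_eq_one_right n4]
      simp only [Fin.val_last, Fin.val_castSucc]
      field_simp

end Weights

/-! ### Evaluation of Q_λ(α,0). -/

section Averages

variable {q : ℝ}

theorem negSig_negSig {n : ℕ} (lam : Fin n → ℤ) : negSig (negSig lam) = lam := by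
  funext i; simp [negSig]

/-- The reflection `λ ↦ -λ` as an equivalence. -/
def negSigEquiv (n : ℕ) : (Fin n → ℤ) ≃ (Fin n → ℤ) :=
  ⟨negSig, negSig, negSig_negSig, negSig_negSig⟩

theorem sum_negSig {n : ℕ} (lam : Fin n → ℤ) : ∑ i, negSig lam i = -∑ i, lam i := by
  unfold negSig
  rw [Finset.sum_neg_distrib, ← Equiv.sum_comp Fin.revPerm]
  simp

theorem continuousOn_prod_qPochInf {q : ℂ} (hq : ‖q‖ < 1) {β : ℕ → ℂ} {k n : ℕ}
    (hβ : ∀ i < k, ‖β i‖ < 1) :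
    ContinuousOn (fun w : Fin n → ℂ => ∏ i ∈ Finset.range k, ∏ j, 1 / qPochInf (β i * w j) q)
      (unitTorus n) := by
  refine continuousOn_finsetProd _ fun i hi => continuousOn_finsetProd _ fun j _ => ?_
  refine ContinuousOn.div continuousOn_const
    ((continuous_qPochInf hq).comp (by fun_prop)).continuousOn fun w hw => ?_
  refine qPochInf_ne_zero_of_norm_lt hq ?_
  rw [norm_mul, hw j, mul_one]
  exact hβ i (Finset.mem_range.1 hi)

theorem alphaWeight_zero {𝕜 : Type*} [RCLike 𝕜] (q : 𝕜) (β : ℕ → 𝕜) {n : ℕ} (rho : Fin n → ℤ) :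
    alphaWeight q β 0 rho = if rho = 0 then 1 else 0 := by
  rw [alphaWeight]
  by_cases h : rho = 0
  · subst h
    rw [if_pos ⟨⟨fun _ _ _ => le_rfl, fun _ => le_rfl⟩, fun i _ => by simp [extZ]⟩, if_pos rfl]
    simp [whittakerQ, whittakerP, normP]
  · rw [if_neg, if_neg h]
    rintro ⟨-, h2⟩
    exact h (funext fun i => by rw [← extZ_fin rho i]; exact h2 _ (Nat.zero_le _))

/-- Induction on the number of parameters. The kernel of the last one is expanded and absorbed by
the Pieri rule; the reflected sum over strips is then the branching rule `alphaWeight_succ`. With no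
parameter left this is orthogonality. -/
theorem torusAvg_whittakerP_mul (hq0 : 0 < q) (hq1 : q < 1) (β : ℕ → ℂ) {k n : ℕ}
    (hk : k ≤ n + 1) (hβ : ∀ i < k, ‖β i‖ < 1) {lam : Fin (n + 1) → ℤ} (hlam : Antitone lam) :
    torusAvg (fun w => delta (q : ℂ) w * (whittakerP (q : ℂ) lam w *
      ∏ i ∈ Finset.range k, ∏ j, 1 / qPochInf (β i * w j) (q : ℂ))) =
      torusAvg (delta (q : ℂ) (n := n + 1)) * (sigNorm (q : ℂ) lam *
        alphaWeight (q : ℂ) β k (negSig lam)) := by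
  have hq := norm_ofReal_lt hq0 hq1
  have hqc : (q : ℂ) ≠ 0 := Complex.ofReal_ne_zero.2 hq0.ne'
  induction k generalizing lam with
  | zero =>
    simp only [Finset.range_zero, Finset.prod_empty, mul_one]
    rw [alphaWeight_zero]
    by_cases h : lam = 0
    · subst h
      have h1 : ∀ w : Fin (n + 1) → ℂ, whittakerP (q : ℂ) (0 : Fin (n + 1) → ℤ) w = 1 := fun w => by
        have := whittakerP_const hq 0 w
        simp only [zpow_zero, Finset.prod_const_one] at this
        exact this
      rw [if_pos (by funext i; simp [negSig])]
      simp only [h1, mul_one, sigNorm, Pi.zero_apply, sub_zero, qPoch_zero hq,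
        Finset.prod_const_one]
    · rw [torusAvg_whittakerP hq0 hq1 hlam h, if_neg, mul_zero, mul_zero]
      intro h0
      apply h
      rw [← negSig_negSig lam, h0]
      funext i
      simp [negSig]
  | succ k ih =>
    have hβ' : ∀ i < k, ‖β i‖ < 1 := fun i hi => hβ i (hi.trans k.lt_succ_self)
    set H : (Fin (n + 1) → ℤ) → (Fin (n + 1) → ℂ) → ℂ := fun nu w => delta (q : ℂ) w *
      (whittakerP (q : ℂ) nu w * ∏ i ∈ Finset.range k, ∏ j, 1 / qPochInf (β i * w j) (q : ℂ))
      with hH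
    have hHc : ∀ nu, ContinuousOn (H nu) (unitTorus (n + 1)) := fun nu =>
      (DifferentiableOn.continuousOn_unitTorus (differentiableOn_delta hq _)).mul
        ((DifferentiableOn.continuousOn_unitTorus (differentiableOn_whittakerP nu)).mul
          (continuousOn_prod_qPochInf hq hβ'))
    obtain ⟨B, hB⟩ := exists_norm_le_unitTorus (hHc lam)
    -- The series in powers of β_k converges uniformly on the torus because |β_k| < 1, so it may be
    -- averaged term by term.
    have hs := hasSum_torusAvg (f := fun m w => β k ^ m * gCoeff (q : ℂ) w m * H lam w)
      (g := fun w => delta (q : ℂ) w * (whittakerP (q : ℂ) lam w *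
        ∏ i ∈ Finset.range (k + 1), ∏ j, 1 / qPochInf (β i * w j) (q : ℂ)))
      (fun m => (continuousOn_const.mul (differentiable_gCoeff m).continuous.continuousOn).mul
        (hHc lam))
      ((summable_gCoeff_one hq0 hq1 (n + 1) (norm_nonneg (β k)) (hβ k k.lt_succ_self)).mul_right B)
      (fun m w hw => by
        rw [norm_mul, norm_mul, norm_pow]
        have h1 := norm_gCoeff_le hq0 hq1 hw m
        have h2 := hB w hw
        have h3 := (norm_nonneg _).trans h1
        gcongr)
      (fun w hw => by
        have h1 := (hasSum_gCoeff hqc hq (w := w) (c := β k) fun j => by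
          rw [norm_mul, hw j, mul_one]; exact hβ k k.lt_succ_self).mul_right (H lam w)
        rw [Finset.prod_range_succ]
        have h2 : delta (q : ℂ) w * (whittakerP (q : ℂ) lam w *
            ((∏ i ∈ Finset.range k, ∏ j, 1 / qPochInf (β i * w j) (q : ℂ)) *
              ∏ j, 1 / qPochInf (β k * w j) (q : ℂ))) =
            (∏ j, 1 / qPochInf (β k * w j) (q : ℂ)) * H lam w := by
          simp only [hH]
          ring
        rw [h2]
        exact h1)
    refine hs.unique ?_
    set rho := negSig lam with hrho
    have hterm : ∀ m : ℕ, torusAvg (fun w => β k ^ m * gCoeff (q : ℂ) w m * H lam w) =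
        torusAvg (delta (q : ℂ) (n := n + 1)) * (sigNorm (q : ℂ) lam * ∑ nu ∈ downBox rho,
          if ∑ i, rho i - ∑ i, nu i = (m : ℤ) then
            alphaWeight (q : ℂ) β k nu * horCoeff (q : ℂ) nu rho * β k ^ m else 0) := by
      intro m
      have h1 : torusAvg (fun w => β k ^ m * gCoeff (q : ℂ) w m * H lam w) =
          ∑ nu ∈ horBox lam m, (if ∑ i, nu i - ∑ i, lam i = m then
            β k ^ m * horCoeff (q : ℂ) lam nu else 0) * torusAvg (H nu) := by
        simp_rw [← torusAvg_const_mul]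
        rw [← torusAvg_sum]
        swap
        · exact fun nu _ => continuousOn_const.mul (hHc nu)
        refine torusAvg_congr fun w hw => ?_
        have hP := gCoeff_mul_whittakerP hqc hq hlam (unitTorus_subset _ hw) m
        rw [tsum_eq_sum (s := horBox lam m) fun nu hnu => by
          by_contra h
          exact hnu (by simpa using mem_horBox_of_ne hqc hq h)] at hP
        simp only [hH]
        calc _ = β k ^ m * (delta (q : ℂ) w * ((gCoeff (q : ℂ) w m * whittakerP (q : ℂ) lam w) *
              ∏ i ∈ Finset.range k, ∏ j, 1 / qPochInf (β i * w j) (q : ℂ))) := by ring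
          _ = _ := by
            rw [hP, Finset.sum_mul, Finset.mul_sum, Finset.mul_sum]
            refine Finset.sum_congr rfl fun nu _ => ?_
            split_ifs <;> ring
      have h2 : ∀ nu ∈ horBox lam m, (if ∑ i, nu i - ∑ i, lam i = m then
            β k ^ m * horCoeff (q : ℂ) lam nu else 0) * torusAvg (H nu) =
          torusAvg (delta (q : ℂ) (n := n + 1)) * (sigNorm (q : ℂ) lam *
            if ∑ i, rho i - ∑ i, negSig nu i = (m : ℤ) then
            alphaWeight (q : ℂ) β k (negSig nu) * horCoeff (q : ℂ) (negSig nu) rho * β k ^ m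
              else 0) := by
        intro nu hnu
        have hanti := (mem_horBox.1 hnu).1.antitone
        rw [ih (by omega) hβ' hanti, hrho, sum_negSig, sum_negSig,
          show -∑ i, lam i - -∑ i, nu i = ∑ i, nu i - ∑ i, lam i by ring]
        split_ifs
        · linear_combination (β k ^ m * torusAvg (delta (q : ℂ) (n := n + 1)) *
            alphaWeight (q : ℂ) β k (negSig nu)) * horCoeff_negSig (q := (q : ℂ)) lam nu
        · ring
      rw [h1, Finset.sum_congr rfl h2, ← Finset.mul_sum, ← Finset.mul_sum]
      congr 2
      -- The sum over strips above λ and the sum over rows below ρ = -λ are both extended to all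
      -- integer rows, where negation is a bijection.
      set f : (Fin (n + 1) → ℤ) → ℂ := fun nu => if ∑ i, rho i - ∑ i, nu i = (m : ℤ) then
        alphaWeight (q : ℂ) β k nu * horCoeff (q : ℂ) nu rho * β k ^ m else 0 with hf
      have e1 : ∑' nu, f (negSig nu) = ∑ nu ∈ horBox lam m, f (negSig nu) := by
        refine tsum_eq_sum fun nu hnu => ?_
        by_contra hne
        simp only [hf] at hne
        rw [ite_eq_right_iff, Classical.not_imp] at hne
        refine hnu (mem_horBox_of_size ?_ ?_)
        · by_contra hs
          have h3 := horCoeff_negSig (q := (q : ℂ)) lam nu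
          rw [horCoeff_eq_zero hqc hq hs, zero_mul] at h3
          refine right_ne_zero_of_mul (left_ne_zero_of_mul hne.2)
            ((mul_eq_zero.1 h3.symm).resolve_left (Finset.prod_ne_zero_iff.2 fun i _ => ?_))
          exact qPoch_ne_zero hq (sub_nonneg.2 (hlam (Fin.castSucc_le_succ i)))
        · have := hne.1
          rw [hrho, sum_negSig, sum_negSig] at this
          linarith
      have e2 : ∑' nu, f nu = ∑ nu ∈ downBox rho, f nu := by
        refine tsum_eq_sum fun nu hnu => ?_
        by_contra hne
        simp only [hf] at hne
        rw [ite_eq_right_iff, Classical.not_imp] at hne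
        exact hnu (mem_downBox_of_ne hqc hq (left_ne_zero_of_mul hne.2)).1
      exact e1.symm.trans (((negSigEquiv (n + 1)).tsum_eq f).trans e2)
    simp_rw [hterm]
    refine HasSum.mul_left _ (HasSum.mul_left _ ?_)
    rw [alphaWeight_succ hqc hq β (by omega)]
    refine hasSum_sum fun nu _ => ?_
    by_cases hne : alphaWeight (q : ℂ) β k nu * horCoeff (q : ℂ) nu rho = 0
    · simp only [hne, zero_mul, ite_self]
      exact hasSum_zero
    · have hs := (mem_downBox_of_ne hqc hq hne).2
      have h0 : 0 ≤ ∑ i, rho i - ∑ i, nu i := sub_nonneg.2 (Finset.sum_le_sum fun i _ => hs.le i)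
      obtain ⟨d, hd⟩ := Int.eq_ofNat_of_zero_le h0
      rw [hd, zpow_natCast]
      have h1 : ∀ m : ℕ, (if ((d : ℕ) : ℤ) = (m : ℤ) then
          alphaWeight (q : ℂ) β k nu * horCoeff (q : ℂ) nu rho * β k ^ m else 0) =
          if m = d then alphaWeight (q : ℂ) β k nu * horCoeff (q : ℂ) nu rho * β k ^ d else 0 := by
        intro m
        by_cases h : m = d
        · subst h; rw [if_pos rfl, if_pos rfl]
        · rw [if_neg h, if_neg fun h' => h (by exact_mod_cast h'.symm)]
      have h2 := hasSum_ite_eq d (alphaWeight (q : ℂ) β k nu * horCoeff (q : ℂ) nu rho * β k ^ d)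
      simp_rw [← h1] at h2
      exact h2

/-- The value of `Q_λ(α, 0)` in terms of the ordinary `q`-Whittaker functions. -/
theorem twoSidedQ_eq (hq0 : 0 < q) (hq1 : q < 1) {n : ℕ} {α : Fin n → ℂ} {β : ℕ → ℂ} {k : ℕ}
    (hk : k ≤ n) (hβ : ∀ i < k, ‖β i‖ < 1)
    (hαβ : ∀ w ∈ unitTorus n, ∏ i, ∏ j, 1 / qPochInf (α i * w j) (q : ℂ) =
      ∏ i ∈ Finset.range k, ∏ j, 1 / qPochInf (β i * w j) (q : ℂ))
    {lam : Fin n → ℤ} (hlam : Antitone lam) :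
    twoSidedQ (q : ℂ) lam α 0 = alphaWeight (q : ℂ) β k (negSig lam) := by
  have hq := norm_ofReal_lt hq0 hq1
  have hqc : (q : ℂ) ≠ 0 := Complex.ofReal_ne_zero.2 hq0.ne'
  have hpi : (2 * (Real.pi : ℂ) * Complex.I) ≠ 0 := Complex.two_pi_I_ne_zero
  have hfac : (n.factorial : ℂ) ≠ 0 := by exact_mod_cast n.factorial_ne_zero
  -- The Sklyanin product takes both orders of each pair i < j, so it equals the product over all
  -- ordered pairs of distinct indices.
  have hsk : ∀ z : Fin n → ℂ, sklyanin (q : ℂ) z =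
      1 / ((2 * (Real.pi : ℂ) * Complex.I) ^ n * (n.factorial : ℂ)) *
        delta (q : ℂ) fun i => 1 / z i := by
    intro z
    rw [sklyanin]
    congr 1
    have h1 : ∀ i j : Fin n, (1 / z i) / (1 / z j) = z j / z i := fun i j => by
      rw [one_div, one_div, div_inv_eq_mul, inv_mul_eq_div]
    simp only [delta, h1]
    have h2 : ∀ i : Fin n, (∏ j, if i = j then 1 else qPochInf (z j / z i) (q : ℂ)) =
        (∏ j ∈ Finset.Ioi i, qPochInf (z j / z i) (q : ℂ)) *
          ∏ j ∈ Finset.Iio i, qPochInf (z j / z i) (q : ℂ) := by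
      intro i
      rw [← Finset.prod_union]
      · rw [Finset.prod_ite, Finset.prod_const_one, one_mul]
        refine Finset.prod_congr ?_ fun _ _ => rfl
        ext j
        simp only [Finset.mem_filter, Finset.mem_univ, true_and, Finset.mem_union, Finset.mem_Ioi,
          Finset.mem_Iio]
        exact ne_iff_lt_or_gt
      · exact Finset.disjoint_left.2 fun j h1 h2 =>
          lt_asymm (Finset.mem_Ioi.1 h1) (Finset.mem_Iio.1 h2)
    rw [Finset.prod_congr rfl fun i _ => h2 i]
    simp only [Finset.prod_mul_distrib]
    rw [mul_comm]
    congr 1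
    exact Finset.prod_comm' (by simp)
  have hint : torusIntegral (fun z : Fin n → ℂ => (∏ i, 1 / z i) *
      whittakerP (q : ℂ) lam (fun i => 1 / z i) * twoSidedKernel (q : ℂ) z α 0 *
        sklyanin (q : ℂ) z) 0 1 = 1 / (n.factorial : ℂ) * torusAvg (fun w => delta (q : ℂ) w *
          (whittakerP (q : ℂ) lam w *
            ∏ i ∈ Finset.range k, ∏ j, 1 / qPochInf (β i * w j) (q : ℂ))) := by
    have h1 := torusIntegral_eq_torusAvg fun w : Fin n → ℂ =>
      1 / ((2 * (Real.pi : ℂ) * Complex.I) ^ n * (n.factorial : ℂ)) *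
        (delta (q : ℂ) w * (whittakerP (q : ℂ) lam w *
          ∏ i, ∏ j, 1 / qPochInf (α i * w j) (q : ℂ)))
    rw [torusAvg_const_mul, torusAvg_congr (g := fun w =>
      delta (q : ℂ) w * (whittakerP (q : ℂ) lam w *
        ∏ i ∈ Finset.range k, ∏ j, 1 / qPochInf (β i * w j) (q : ℂ)))
      fun w hw => by simp only [hαβ w hw]] at h1
    trans (2 * (Real.pi : ℂ) * Complex.I) ^ n *
      (1 / ((2 * (Real.pi : ℂ) * Complex.I) ^ n * (n.factorial : ℂ)) *
        torusAvg (fun w => delta (q : ℂ) w * (whittakerP (q : ℂ) lam w *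
          ∏ i ∈ Finset.range k, ∏ j, 1 / qPochInf (β i * w j) (q : ℂ))))
    · rw [← h1]
      congr 1
      funext z
      simp only [twoSidedKernel, hsk, Complex.ofReal_zero, mul_zero, Complex.exp_zero,
        Finset.prod_const_one, mul_one, mul_one_div]
      ring
    have := pow_ne_zero n hpi
    field_simp
  rw [twoSidedQ, hint]
  cases n with
  | zero =>
    obtain rfl : k = 0 := by omega
    rw [torusAvg_dim0, alphaWeight_zero, if_pos (Subsingleton.elim _ _)]
    simp [delta, whittakerP]
  | succ n =>
    -- The prefactor of Q_λ is (q;q)_∞^n divided by `sigNorm`; together with 1/(n+1)! it cancels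
    -- both constants exactly.
    rw [torusAvg_whittakerP_mul hq0 hq1 β hk hβ hlam, torusAvg_delta hq0 hq1]
    have h1 : (∏ i : Fin (n + 1), if h : (i : ℕ) + 1 < n + 1 then
        qPochInf ((q : ℂ) ^ (lam i - lam ⟨i + 1, h⟩ + 1)) (q : ℂ) else 1) =
        qPochInf (q : ℂ) q ^ n * ∏ i : Fin n, qPochInv (q : ℂ) (lam i.castSucc - lam i.succ) := by
      rw [Fin.prod_univ_castSucc]
      simp only [Fin.val_last, lt_irrefl, dite_false, mul_one]
      rw [← Fin.prod_const, ← Finset.prod_mul_distrib]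
      refine Finset.prod_congr rfl fun i _ => ?_
      rw [dif_pos (by simp), qPochInv, mul_div_cancel₀ _ (qPochInf_self_ne_zero hq), add_comm,
        zpow_one_add₀ hqc]
      rfl
    have h2 : (∏ i : Fin n, qPochInv (q : ℂ) (lam i.castSucc - lam i.succ)) *
        sigNorm (q : ℂ) lam = 1 := by
      rw [sigNorm, ← Finset.prod_mul_distrib]
      refine Finset.prod_eq_one fun i _ => ?_
      rw [mul_comm, qPoch_mul_qPochInv hq (sub_nonneg.2 (hlam (Fin.castSucc_le_succ i)))]
    have h3 := pow_ne_zero n (qPochInf_self_ne_zero hq)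
    rw [h1]
    calc _ = (qPochInf (q : ℂ) q ^ n * (1 / qPochInf (q : ℂ) q) ^ n) *
          ((1 / ((n + 1).factorial : ℂ)) * ((n + 1).factorial : ℂ)) *
          ((∏ i : Fin n, qPochInv (q : ℂ) (lam i.castSucc - lam i.succ)) *
            sigNorm (q : ℂ) lam) * alphaWeight (q : ℂ) β k (negSig lam) := by ring
      _ = _ := by
        rw [h2, one_div_mul_cancel hfac, ← mul_pow, mul_one_div_cancel (qPochInf_self_ne_zero hq),
          one_pow, one_mul, one_mul, one_mul]

end Averages

/-! ### Non-negativity of the weights. -/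

section Positivity

variable {q : ℝ}

theorem skewP_nonneg (hq0 : 0 < q) (hq1 : q < 1) {n : ℕ} (lam : Fin (n + 1) → ℤ) (mu : Fin n → ℤ)
    {a : ℝ} (ha : 0 ≤ a) : 0 ≤ skewP q lam mu a :=
  mul_nonneg (zpow_nonneg ha _) (Finset.prod_nonneg fun _ _ => mul_nonneg
    (mul_nonneg (qPoch_nonneg hq0 hq1 _) (qPochInv_nonneg hq0 hq1 _)) (qPochInv_nonneg hq0 hq1 _))

theorem whittakerP_nonneg (hq0 : 0 < q) (hq1 : q < 1) {n : ℕ} (lam : Fin n → ℤ) {x : Fin n → ℝ}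
    (hx : ∀ i, 0 ≤ x i) : 0 ≤ whittakerP q lam x := by
  induction n with
  | zero => exact zero_le_one
  | succ n ih =>
    rw [whittakerP]
    exact Finset.sum_nonneg fun mu _ => mul_nonneg (skewP_nonneg hq0 hq1 _ _ (hx _))
      (ih mu fun i => hx _)

theorem horCoeff_nonneg (hq0 : 0 < q) (hq1 : q < 1) {n : ℕ} (lam nu : Fin (n + 1) → ℤ) :
    0 ≤ horCoeff q lam nu :=
  mul_nonneg (qPochInv_nonneg hq0 hq1 _) (Finset.prod_nonneg fun _ _ => mul_nonneg
    (mul_nonneg (qPoch_nonneg hq0 hq1 _) (qPochInv_nonneg hq0 hq1 _)) (qPochInv_nonneg hq0 hq1 _))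

theorem alphaWeight_nonneg (hq0 : 0 < q) (hq1 : q < 1) {β : ℕ → ℝ} (hβ : ∀ i, 0 ≤ β i) (k : ℕ)
    {n : ℕ} (rho : Fin n → ℤ) : 0 ≤ alphaWeight q β k rho := by
  rw [alphaWeight]
  split_ifs
  · refine div_nonneg (whittakerP_nonneg hq0 hq1 _ fun i => hβ i) ?_
    rw [normP_eq]
    exact Finset.prod_nonneg fun _ _ => qPoch_nonneg hq0 hq1 _
  · exact le_rfl

end Positivity

/-! ### The Cauchy identity. -/

section Cauchy

variable {q : ℝ}

theorem tsum_horCoeff_whittakerP (hq0 : 0 < q) (hq1 : q < 1) {n : ℕ} {lam : Fin (n + 1) → ℤ}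
    (hlam : Antitone lam) {x : Fin (n + 1) → ℝ} (hx : ∀ j, 0 < x j) {c : ℝ} (hc : 0 ≤ c)
    (hcx : ∀ j, c * x j < 1) :
    ∑' nu, ENNReal.ofReal (horCoeff q lam nu * c ^ (∑ i, nu i - ∑ i, lam i) * whittakerP q nu x) =
      ENNReal.ofReal ((∏ j, 1 / qPochInf (c * x j) q) * whittakerP q lam x) := by
  have hq : ‖q‖ < 1 := by rwa [Real.norm_of_nonneg hq0.le]
  have hP := fun nu : Fin (n + 1) → ℤ => whittakerP_nonneg hq0 hq1 nu fun j => (hx j).le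
  set f : (Fin (n + 1) → ℤ) → ENNReal := fun nu =>
    ENNReal.ofReal (horCoeff q lam nu * c ^ (∑ i, nu i - ∑ i, lam i) * whittakerP q nu x) with hf
  -- Stratification by the size |ν| - |λ|, so that the Pieri rule applies for each m. With values in
  -- [0, ∞] the sums can be exchanged without a summability argument.
  have h1 : ∀ nu, f nu = ∑' m : ℕ, if ∑ i, nu i - ∑ i, lam i = (m : ℤ) then f nu else 0 := by
    intro nu
    by_cases hs : IsHorStrip lam nu
    · obtain ⟨d, hd⟩ := Int.eq_ofNat_of_zero_le (sub_nonneg.2 (Finset.sum_le_sum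
        fun i (_ : i ∈ Finset.univ) => hs.le i))
      rw [tsum_eq_single d]
      · rw [if_pos hd]
      · intro m hm
        rw [hd, if_neg fun h => hm (by exact_mod_cast h.symm)]
    · have : f nu = 0 := by
        simp only [hf]
        rw [horCoeff_eq_zero hq0.ne' hq hs, zero_mul, zero_mul, ENNReal.ofReal_zero]
      simp [this]
  have h2 : ∀ m : ℕ, ∑' nu, (if ∑ i, nu i - ∑ i, lam i = (m : ℤ) then f nu else 0) =
      ENNReal.ofReal (c ^ m * gCoeff q x m * whittakerP q lam x) := by
    intro m
    rw [mul_assoc, gCoeff_mul_whittakerP hq0.ne' hq hlam (fun j => (hx j).ne') m, ← tsum_mul_left,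
      ENNReal.ofReal_tsum_of_nonneg]
    · refine tsum_congr fun nu => ?_
      by_cases h : ∑ i, nu i - ∑ i, lam i = (m : ℤ)
      · simp only [hf, if_pos h]
        rw [h, zpow_natCast]
        congr 1
        ring
      · simp only [if_neg h, mul_zero, ENNReal.ofReal_zero]
    · intro nu
      refine mul_nonneg (pow_nonneg hc m) ?_
      split_ifs
      exacts [mul_nonneg (horCoeff_nonneg hq0 hq1 _ _) (hP nu), le_rfl]
    · exact (summable_hor hq0.ne' hq lam m _).mul_left _
  have h3 := (hasSum_gCoeff (w := x) (c := c) hq0.ne' hq fun j => by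
    rw [Real.norm_of_nonneg (mul_nonneg hc (hx j).le)]; exact hcx j).mul_right (whittakerP q lam x)
  rw [tsum_congr h1, ENNReal.tsum_comm, tsum_congr h2, ← ENNReal.ofReal_tsum_of_nonneg _ h3.summable,
    h3.tsum_eq]
  intro m
  refine mul_nonneg (mul_nonneg (pow_nonneg hc m) ?_) (hP lam)
  rw [gCoeff, gSeries, PowerSeries.coeff_prod]
  refine Finset.sum_nonneg fun l _ => Finset.prod_nonneg fun j _ => ?_
  rw [PowerSeries.coeff_mk]
  exact mul_nonneg (pow_nonneg (hx j).le _) (qPochInv_nonneg hq0 hq1 _)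

/-- The Cauchy identity for the `q`-Whittaker functions. -/
theorem tsum_alphaWeight_whittakerP (hq0 : 0 < q) (hq1 : q < 1) {β : ℕ → ℝ} (hβ : ∀ i, 0 ≤ β i)
    {k n : ℕ} (hk : k ≤ n) {x : Fin n → ℝ} (hx : ∀ j, 0 < x j) (hβx : ∀ i j, β i * x j < 1) :
    ∑' rho, ENNReal.ofReal (alphaWeight q β k rho * whittakerP q rho x) =
      ENNReal.ofReal (∏ i ∈ Finset.range k, ∏ j, 1 / qPochInf (β i * x j) q) := by
  have hq : ‖q‖ < 1 := by rwa [Real.norm_of_nonneg hq0.le]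
  have hP := fun rho : Fin n → ℤ => whittakerP_nonneg hq0 hq1 rho fun j => (hx j).le
  induction k with
  | zero =>
    rw [tsum_eq_single 0]
    · have := whittakerP_const hq 0 x
      rw [alphaWeight_zero, if_pos rfl, show (0 : Fin n → ℤ) = fun _ => 0 from rfl, this]
      simp
    · intro rho hrho
      rw [alphaWeight_zero, if_neg hrho, zero_mul, ENNReal.ofReal_zero]
  | succ k ih =>
    obtain ⟨n, rfl⟩ : ∃ n', n = n' + 1 := ⟨n - 1, by omega⟩
    have h1 : ∀ rho, ENNReal.ofReal (alphaWeight q β (k + 1) rho * whittakerP q rho x) =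
        ∑' nu, ENNReal.ofReal (alphaWeight q β k nu) * ENNReal.ofReal (horCoeff q nu rho *
          β k ^ (∑ i, rho i - ∑ i, nu i) * whittakerP q rho x) := by
      intro rho
      rw [alphaWeight_succ hq0.ne' hq β (by omega), Finset.sum_mul, ENNReal.ofReal_sum_of_nonneg]
      · rw [tsum_eq_sum (s := downBox rho)]
        · refine Finset.sum_congr rfl fun nu _ => ?_
          rw [← ENNReal.ofReal_mul (alphaWeight_nonneg hq0 hq1 hβ _ _)]
          congr 1
          ring
        · intro nu hnu
          by_contra hne
          refine hnu (mem_downBox_of_ne (q := q) (α := β) (k := k) hq0.ne' hq fun h => hne ?_).1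
          rw [← ENNReal.ofReal_mul (alphaWeight_nonneg hq0 hq1 hβ _ _), mul_assoc, ← mul_assoc, h,
            zero_mul, ENNReal.ofReal_zero]
      · exact fun nu _ => mul_nonneg (mul_nonneg (mul_nonneg (alphaWeight_nonneg hq0 hq1 hβ _ _)
          (horCoeff_nonneg hq0 hq1 _ _)) (zpow_nonneg (hβ k) _)) (hP rho)
    have h2 : ∀ nu, ∑' rho, ENNReal.ofReal (alphaWeight q β k nu) * ENNReal.ofReal (horCoeff q nu rho *
          β k ^ (∑ i, rho i - ∑ i, nu i) * whittakerP q rho x) =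
        ENNReal.ofReal (alphaWeight q β k nu * whittakerP q nu x) *
          ENNReal.ofReal (∏ j, 1 / qPochInf (β k * x j) q) := by
      intro nu
      rw [ENNReal.tsum_mul_left]
      by_cases h : alphaWeight q β k nu = 0
      · simp [h]
      · rw [tsum_horCoeff_whittakerP hq0 hq1 (alphaWeight_of_ne h).1.1 hx (hβ k) (hβx k),
          ← ENNReal.ofReal_mul (alphaWeight_nonneg hq0 hq1 hβ _ _),
          ← ENNReal.ofReal_mul (mul_nonneg (alphaWeight_nonneg hq0 hq1 hβ _ _) (hP nu))]
        congr 1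
        ring
    rw [tsum_congr h1, ENNReal.tsum_comm, tsum_congr h2, ENNReal.tsum_mul_right, ih (by omega),
      Finset.prod_range_succ, ← ENNReal.ofReal_mul]
    exact Finset.prod_nonneg fun i _ => Finset.prod_nonneg fun j _ =>
      (one_div_pos.2 (qPochInf_pos hq0 hq1 (hβx i j))).le

end Cauchy

/-! ### Total mass, reflection of arrays, and the process at time 0. -/

section Arrays

variable {q : ℝ}

/-- The sum over all arrays with a given top row is the iterated branching rule. Arrays outside the
cone contribute nothing, as `skewP` vanishes without interlacing. -/
theorem tsum_gtArray (hq0 : 0 < q) (hq1 : q < 1) {N : ℕ} {b : Fin N → ℝ} (hb : ∀ j, 0 ≤ b j)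
    (f : (Fin N → ℤ) → ENNReal) :
    ∑' x : GTArray N, ENNReal.ofReal (∏ j : Fin N, skewP q (x.upper j) (x.lower j) (b j)) *
      f x.top = ∑' lam, ENNReal.ofReal (whittakerP q lam b) * f lam := by
  have hq : ‖q‖ < 1 := by rwa [Real.norm_of_nonneg hq0.le]
  induction N with
  | zero =>
    have h1 : ∀ x y : GTArray 0, x = y := fun x y => funext fun n => funext fun i =>
      absurd i.2 (by omega)
    rw [tsum_eq_single (fun _ _ => 0 : GTArray 0) fun x hx => absurd (h1 _ _) hx,
      tsum_eq_single (fun _ => 0 : Fin 0 → ℤ) fun x hx => absurd (Subsingleton.elim _ _) hx]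
    rw [Finset.univ_eq_empty, Finset.prod_empty, whittakerP]
    congr 2
  | succ N ih =>
    let e := Fin.snocEquiv fun n : Fin (N + 2) => Fin (n : ℕ) → ℤ
    have hsk : ∀ (lam : Fin (N + 1) → ℤ) (y : GTArray N),
        ∏ j : Fin (N + 1), skewP q (GTArray.upper (N := N + 1) (e (lam, y)) j)
          (GTArray.lower (N := N + 1) (e (lam, y)) j) (b j) =
        (∏ j : Fin N, skewP q (y.upper j) (y.lower j) (b j.castSucc)) *
          skewP q lam y.top (b (Fin.last N)) := by
      intro lam y
      have hc : ∀ n : Fin (N + 1), e (lam, y) n.castSucc = y n := fun n =>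
        Fin.snoc_castSucc (α := fun n : Fin (N + 2) => Fin (n : ℕ) → ℤ) _ _ _
      have hl : e (lam, y) (Fin.last (N + 1)) = lam :=
        Fin.snoc_last (α := fun n : Fin (N + 2) => Fin (n : ℕ) → ℤ) _ _
      rw [Fin.prod_univ_castSucc]
      congr 1
      · refine Finset.prod_congr rfl fun j _ => ?_
        have h1 : GTArray.upper (N := N + 1) (e (lam, y)) j.castSucc = y.upper j := hc j.succ
        have h2 : GTArray.lower (N := N + 1) (e (lam, y)) j.castSucc = y.lower j := hc j.castSucc
        exact congrArg₂ (fun u v => skewP q u v (b j.castSucc)) h1 h2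
      · have h1 : GTArray.upper (N := N + 1) (e (lam, y)) (Fin.last N) = lam := hl
        have h2 : GTArray.lower (N := N + 1) (e (lam, y)) (Fin.last N) = y.top := hc (Fin.last N)
        exact congrArg₂ (fun u v => skewP q u v (b (Fin.last N))) h1 h2
    rw [← e.tsum_eq, ENNReal.tsum_prod']
    refine tsum_congr fun lam => ?_
    have htop : ∀ y : GTArray N, GTArray.top (N := N + 1) (e (lam, y)) = lam := fun y =>
      Fin.snoc_last (α := fun n : Fin (N + 2) => Fin (n : ℕ) → ℤ) _ _
    have h1 : ∀ y : GTArray N, ENNReal.ofReal (∏ j : Fin (N + 1),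
        skewP q (GTArray.upper (N := N + 1) (e (lam, y)) j)
          (GTArray.lower (N := N + 1) (e (lam, y)) j) (b j)) *
            f (GTArray.top (N := N + 1) (e (lam, y))) =
        ENNReal.ofReal (∏ j : Fin N, skewP q (y.upper j) (y.lower j) (b j.castSucc)) *
          ENNReal.ofReal (skewP q lam y.top (b (Fin.last N))) * f lam := by
      intro y
      rw [hsk, htop, ENNReal.ofReal_mul]
      exact Finset.prod_nonneg fun j _ => skewP_nonneg hq0 hq1 _ _ (hb _)
    refine (tsum_congr h1).trans ?_
    refine ENNReal.tsum_mul_right.trans (congrArg (· * f lam) ((ih (fun j => hb j.castSucc)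
      fun mu => ENNReal.ofReal (skewP q lam mu (b (Fin.last N)))).trans ?_))
    rw [whittakerP_succ hq0.ne' hq, ENNReal.ofReal_tsum_of_nonneg]
    · refine tsum_congr fun mu => ?_
      rw [mul_comm, ENNReal.ofReal_mul (skewP_nonneg hq0 hq1 _ _ (hb _))]
    · exact fun mu => mul_nonneg (skewP_nonneg hq0 hq1 _ _ (hb _))
        (whittakerP_nonneg hq0 hq1 _ fun i => hb _)
    · exact summable_skewP hq0.ne' hq lam _ _

/-- The ordinary `q`-Whittaker process with the first `k` of the parameters `β`. -/
noncomputable def alphaDensity (q : ℝ) {N : ℕ} (b : Fin N → ℝ) (β : ℕ → ℝ) (k : ℕ) (x : GTArray N) :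
    ℝ :=
  (∏ j : Fin N, skewP q (x.upper j) (x.lower j) (b j)) * alphaWeight q β k x.top /
    ∏ i ∈ Finset.range k, ∏ j, 1 / qPochInf (β i * b j) q

theorem prod_kernel_pos (hq0 : 0 < q) (hq1 : q < 1) {N : ℕ} {b : Fin N → ℝ} {β : ℕ → ℝ} (k : ℕ)
    (hβb : ∀ i j, β i * b j < 1) : 0 < ∏ i ∈ Finset.range k, ∏ j, 1 / qPochInf (β i * b j) q :=
  Finset.prod_pos fun i _ => Finset.prod_pos fun j _ => one_div_pos.2 (qPochInf_pos hq0 hq1 (hβb i j))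

theorem alphaDensity_nonneg (hq0 : 0 < q) (hq1 : q < 1) {N : ℕ} {b : Fin N → ℝ}
    (hb : ∀ j, 0 ≤ b j) {β : ℕ → ℝ} (hβ : ∀ i, 0 ≤ β i) (hβb : ∀ i j, β i * b j < 1) (k : ℕ)
    (x : GTArray N) : 0 ≤ alphaDensity q b β k x :=
  div_nonneg (mul_nonneg (Finset.prod_nonneg fun j _ => skewP_nonneg hq0 hq1 _ _ (hb j))
    (alphaWeight_nonneg hq0 hq1 hβ k _)) (prod_kernel_pos hq0 hq1 k hβb).le

theorem tsum_alphaDensity (hq0 : 0 < q) (hq1 : q < 1) {N : ℕ} {b : Fin N → ℝ} (hb : ∀ j, 0 < b j)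
    {β : ℕ → ℝ} (hβ : ∀ i, 0 ≤ β i) (hβb : ∀ i j, β i * b j < 1) {k : ℕ} (hk : k ≤ N) :
    ∑' x : GTArray N, ENNReal.ofReal (alphaDensity q b β k x) = 1 := by
  have hpos := prod_kernel_pos (q := q) hq0 hq1 k hβb
  have h1 : ∀ x : GTArray N, ENNReal.ofReal (alphaDensity q b β k x) =
      ENNReal.ofReal (∏ j : Fin N, skewP q (x.upper j) (x.lower j) (b j)) *
        ENNReal.ofReal (alphaWeight q β k x.top) *
          ENNReal.ofReal (∏ i ∈ Finset.range k, ∏ j, 1 / qPochInf (β i * b j) q)⁻¹ := by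
    intro x
    have h2 : 0 ≤ ∏ j : Fin N, skewP q (x.upper j) (x.lower j) (b j) :=
      Finset.prod_nonneg fun j _ => skewP_nonneg hq0 hq1 _ _ (hb j).le
    rw [← ENNReal.ofReal_mul h2, ← ENNReal.ofReal_mul (mul_nonneg h2
      (alphaWeight_nonneg hq0 hq1 hβ k _)), alphaDensity, div_eq_mul_inv]
  rw [tsum_congr h1, ENNReal.tsum_mul_right, tsum_gtArray hq0 hq1 (fun j => (hb j).le)
    fun lam => ENNReal.ofReal (alphaWeight q β k lam)]
  have h3 : ∀ lam : Fin N → ℤ, ENNReal.ofReal (whittakerP q lam b) *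
      ENNReal.ofReal (alphaWeight q β k lam) =
      ENNReal.ofReal (alphaWeight q β k lam * whittakerP q lam b) := fun lam => by
    rw [mul_comm, ENNReal.ofReal_mul (alphaWeight_nonneg hq0 hq1 hβ k _)]
  rw [tsum_congr h3, tsum_alphaWeight_whittakerP hq0 hq1 hβ hk hb hβb, ← ENNReal.ofReal_mul hpos.le,
    mul_inv_cancel₀ hpos.ne', ENNReal.ofReal_one]

theorem isPartition_of_interlaces {n : ℕ} {lam : Fin (n + 1) → ℤ} {mu : Fin n → ℤ}
    (hlam : ∀ i, 0 ≤ lam i) (h : Interlaces lam mu) : IsPartition mu :=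
  ⟨h.antitone, fun i => (hlam _).trans (h i).1⟩

/-- Interlacing bounds the entries of each row below by the last part of the next one, so
non-negativity descends from the top row. -/
theorem mem_gtConePartition_of_top {N : ℕ} {x : GTArray N}
    (hx : ∀ j : Fin N, Interlaces (x.upper j) (x.lower j)) (htop : IsPartition x.top) :
    x ∈ gtConePartition N := by
  refine ⟨fun n => ?_, hx⟩
  induction n using Fin.reverseInduction with
  | last => exact htop
  | cast j ih => exact isPartition_of_interlaces (lam := x.upper j) ih.2 (hx j)

theorem mem_gtConePartition_of_alphaDensity (hq0 : 0 < q) (hq1 : q < 1) {N : ℕ} {b : Fin N → ℝ}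
    {β : ℕ → ℝ} {k : ℕ} {x : GTArray N} (h : alphaDensity q b β k x ≠ 0) :
    x ∈ gtConePartition N ∧ ∀ i, k ≤ i → extZ x.top i = 0 := by
  have hq : ‖q‖ < 1 := by rwa [Real.norm_of_nonneg hq0.le]
  rw [alphaDensity, div_eq_mul_inv] at h
  have h1 := left_ne_zero_of_mul h
  have h2 := alphaWeight_of_ne (right_ne_zero_of_mul h1)
  refine ⟨mem_gtConePartition_of_top (fun j => ?_) h2.1, h2.2⟩
  by_contra hc
  exact Finset.prod_ne_zero_iff.1 (left_ne_zero_of_mul h1) j (Finset.mem_univ j)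
    (skewP_eq_zero hq0.ne' hq hc _)

theorem negGT_negGT {N : ℕ} (x : GTArray N) : negGT (negGT x) = x :=
  funext fun n => negSig_negSig (x n)

theorem interlaces_negSig {n : ℕ} {lam : Fin (n + 1) → ℤ} {mu : Fin n → ℤ} (h : Interlaces lam mu) :
    Interlaces (negSig lam) (negSig mu) := by
  intro i
  have := h i.rev
  simp only [negSig, Fin.rev_succ, Fin.rev_castSucc]
  omega

theorem antitone_negSig {n : ℕ} {lam : Fin n → ℤ} (h : Antitone lam) : Antitone (negSig lam) :=
  fun _ _ hij => neg_le_neg (h (Fin.rev_le_rev.2 hij))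

theorem negGT_mem_gtCone {N : ℕ} {x : GTArray N} (hx : x ∈ gtCone N) : negGT x ∈ gtCone N :=
  ⟨fun n => antitone_negSig (hx.1 n), fun j => interlaces_negSig (hx.2 j)⟩

theorem gtConePartition_subset (N : ℕ) : gtConePartition N ⊆ gtCone N :=
  fun _ hx => ⟨fun n => (hx.1 n).1, hx.2⟩

theorem negGtConePartition_subset (N : ℕ) : negGtConePartition N ⊆ gtCone N := by
  rintro _ ⟨x, hx, rfl⟩
  exact negGT_mem_gtCone (gtConePartition_subset N hx)

theorem mem_negGtConePartition {N : ℕ} {x : GTArray N} (hx : negGT x ∈ gtConePartition N) :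
    x ∈ negGtConePartition N := ⟨negGT x, hx, negGT_negGT x⟩

/-- Reflection exchanges the gaps λ_i - μ_i and μ_i - λ_{i+1} and reverses the sign of |λ| - |μ|,
which the inversion of a compensates. -/
theorem skewP_negSig {𝕜 : Type*} [RCLike 𝕜] {q : 𝕜} {n : ℕ} (lam : Fin (n + 1) → ℤ)
    (mu : Fin n → ℤ) (a : 𝕜) :
    skewP q (negSig lam) (negSig mu) (1 / a) = skewP q lam mu a := by
  rw [skewP, skewP, sum_negSig, sum_negSig, one_div, inv_zpow', ← Equiv.prod_comp Fin.revPerm]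
  congr 1
  · congr 1
    ring
  · refine Finset.prod_congr rfl fun i _ => ?_
    simp only [negSig, Fin.revPerm_apply, Fin.rev_castSucc, Fin.rev_succ, Fin.rev_rev]
    rw [show -lam i.succ - -lam i.castSucc = lam i.castSucc - lam i.succ by ring,
      show -lam i.succ - -mu i = mu i - lam i.succ by ring,
      show -mu i - -lam i.castSucc = lam i.castSucc - mu i by ring]
    ring

theorem ofReal_skewP (hq : ‖q‖ < 1) {n : ℕ} (lam : Fin (n + 1) → ℤ) (mu : Fin n → ℤ) (a : ℝ) :
    ((skewP q lam mu a : ℝ) : ℂ) = skewP (q : ℂ) lam mu (a : ℂ) := by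
  simp only [skewP, Complex.ofReal_mul, Complex.ofReal_prod, Complex.ofReal_zpow, ofReal_qPoch hq,
    ofReal_qPochInv hq]

theorem ofReal_whittakerP (hq : ‖q‖ < 1) {n : ℕ} (lam : Fin n → ℤ) (x : Fin n → ℝ) :
    ((whittakerP q lam x : ℝ) : ℂ) = whittakerP (q : ℂ) lam fun i => (x i : ℂ) := by
  induction n with
  | zero => simp [whittakerP]
  | succ n ih =>
    simp only [whittakerP, Complex.ofReal_sum, Complex.ofReal_mul, ofReal_skewP hq, ih]

theorem ofReal_whittakerQ (hq : ‖q‖ < 1) {n : ℕ} (lam : Fin n → ℤ) (x : Fin n → ℝ) :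
    ((whittakerQ q lam x : ℝ) : ℂ) = whittakerQ (q : ℂ) lam fun i => (x i : ℂ) := by
  simp only [whittakerQ, Complex.ofReal_div, ofReal_whittakerP hq, normP_eq, Complex.ofReal_prod,
    ofReal_qPoch hq]

theorem ofReal_alphaWeight (hq : ‖q‖ < 1) (β : ℕ → ℝ) (k : ℕ) {n : ℕ} (rho : Fin n → ℤ) :
    ((alphaWeight q β k rho : ℝ) : ℂ) = alphaWeight (q : ℂ) (fun i => (β i : ℂ)) k rho := by
  rw [alphaWeight, alphaWeight]
  split_ifs
  · exact ofReal_whittakerQ hq _ _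
  · exact Complex.ofReal_zero

/-- The two-sided process at time `0` in terms of the ordinary `q`-Whittaker process. -/
theorem twoSidedProcess_eq (hq0 : 0 < q) (hq1 : q < 1) {N : ℕ} {a α : Fin N → ℝ} {β : ℕ → ℝ} {k : ℕ}
    (hk : k ≤ N) (hβ : ∀ i < k, ‖β i‖ < 1)
    (hαβ : ∀ w : Fin N → ℂ, ∏ i, ∏ j, 1 / qPochInf ((α i : ℂ) * w j) (q : ℂ) =
      ∏ i ∈ Finset.range k, ∏ j, 1 / qPochInf ((β i : ℂ) * w j) (q : ℂ))
    {x : GTArray N} (hx : x ∈ gtCone N) :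
    twoSidedProcess q a α 0 x = ((alphaDensity q (fun j => 1 / a j) β k (negGT x) : ℝ) : ℂ) := by
  have hq : ‖q‖ < 1 := by rwa [Real.norm_of_nonneg hq0.le]
  have hQ := twoSidedQ_eq hq0 hq1 (α := fun i => (α i : ℂ)) (β := fun i => (β i : ℂ)) hk
    (fun i hi => by rw [Complex.norm_real]; exact hβ i hi) (fun w _ => hαβ w)
    (lam := x.top) (hx.1 (Fin.last N))
  have hker : twoSidedKernel (q : ℂ) (fun i => (a i : ℂ)) (fun i => (α i : ℂ)) 0 =
      ((∏ i ∈ Finset.range k, ∏ j, 1 / qPochInf (β i * (1 / a j)) q : ℝ) : ℂ) := by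
    have := hαβ fun j => 1 / (a j : ℂ)
    simp only [twoSidedKernel, Complex.ofReal_zero, mul_zero, Complex.exp_zero,
      Finset.prod_const_one, mul_one, Complex.ofReal_prod, Complex.ofReal_div, Complex.ofReal_one,
      ofReal_qPochInf hq, Complex.ofReal_mul]
    rw [← this]
    simp only [mul_one_div]
  have hsk : ∏ j : Fin N, skewP (q : ℂ) (x.upper j) (x.lower j) (a j : ℂ) =
      ((∏ j : Fin N, skewP q ((negGT x).upper j) ((negGT x).lower j) (1 / a j) : ℝ) : ℂ) := by
    rw [Complex.ofReal_prod]
    refine Finset.prod_congr rfl fun j _ => ?_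
    rw [ofReal_skewP hq, Complex.ofReal_div, Complex.ofReal_one]
    exact (skewP_negSig _ _ _).symm
  rw [twoSidedProcess, hker, hsk, hQ, alphaDensity, Complex.ofReal_div, Complex.ofReal_mul,
    ofReal_alphaWeight hq]
  rfl

end Arrays

/-! ### A single α: one-row arrays and telescoping. -/

section OneParameter

variable {q : ℝ}

theorem prod_div_telescope {N : ℕ} {f : Fin (N + 1) → ℝ} (hf : ∀ n, f n ≠ 0) :
    ∏ j : Fin N, f j.succ / f j.castSucc = f (Fin.last N) / f 0 := by
  induction N with
  | zero => simp [div_self (hf 0)]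
  | succ N ih =>
    rw [Fin.prod_univ_castSucc]
    have h := ih (f := fun n => f n.castSucc) fun n => hf _
    simp only [← Fin.succ_castSucc] at h ⊢
    rw [h, Fin.succ_last, Fin.castSucc_zero]
    have := hf (Fin.last N).castSucc
    field_simp

/-- Monotonicity is needed because c may be 0: splitting the power is then legitimate for
non-negative exponents, with 0^0 = 1. -/
theorem zpow_telescope {N : ℕ} {M : Fin (N + 1) → ℤ} (hM : ∀ j : Fin N, M j.castSucc ≤ M j.succ)
    (c : ℝ) : c ^ (M (Fin.last N) - M 0) = ∏ j : Fin N, c ^ (M j.succ - M j.castSucc) := by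
  have hmono : ∀ n, M 0 ≤ M n := by
    intro n
    induction n using Fin.induction with
    | zero => exact le_rfl
    | succ j ih => exact ih.trans (hM j)
  induction N with
  | zero => simp
  | succ N ih =>
    rw [Fin.prod_univ_castSucc]
    have h := ih (M := fun n => M n.castSucc) (fun j => hM j.castSucc) fun n => hmono _
    simp only [← Fin.succ_castSucc] at h ⊢
    rw [← h, Fin.succ_last, Fin.castSucc_zero, ← zpow_add']
    · congr 1; ring
    · have h1 := hmono (Fin.last N).castSucc
      have h2 := hM (Fin.last N)
      rw [Fin.succ_last] at h2
      omega

theorem sum_eq_extZ_zero {n : ℕ} {lam : Fin n → ℤ} (h : ∀ i, 1 ≤ i → extZ lam i = 0) :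
    ∑ i, lam i = extZ lam 0 := by
  rw [sum_eq_sum_range_extZ lam (m := n + 1) (by omega),
    Finset.sum_eq_single_of_mem 0 (by simp) fun i _ hi => h i (by omega)]

/-- The quotient (q;q)_{λ₁}/(q;q)_{μ₁} is isolated because it telescopes along the array and cancels
against the norm in Q of the top row. -/
theorem skewP_of_one_row (hq : ‖q‖ < 1) {n : ℕ} {lam : Fin (n + 1) → ℤ}
    {mu : Fin n → ℤ} (hl : ∀ i, 1 ≤ i → extZ lam i = 0) (hm : ∀ i, 1 ≤ i → extZ mu i = 0)
    (hl0 : 0 ≤ extZ lam 0) (hm0 : 0 ≤ extZ mu 0) (a : ℝ) :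
    skewP q lam mu a = a ^ (extZ lam 0 - extZ mu 0) * qPochInv q (extZ lam 0 - extZ mu 0) *
      (qPoch q q (extZ lam 0) / qPoch q q (extZ mu 0)) := by
  rw [skewP_eq_range, sum_eq_extZ_zero hl, sum_eq_extZ_zero hm, mul_assoc]
  congr 1
  cases n with
  | zero =>
    rw [extZ_of_le mu le_rfl, sub_zero, qPoch_zero hq]
    simp only [Finset.range_zero, Finset.prod_empty, mul_one, div_one]
    rw [mul_comm, qPoch_mul_qPochInv hq hl0]
  | succ n =>
    rw [Finset.prod_eq_single_of_mem 0 (by simp) fun i _ hi => by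
        rw [hl i (by omega), hl (i + 1) (by omega), sub_zero, qPoch_zero hq],
      Finset.prod_eq_single_of_mem 0 (by simp) fun i _ hi => by
        rw [hl i (by omega), hm i (by omega), sub_zero, qPochInv_zero hq],
      Finset.prod_eq_single_of_mem 0 (by simp) fun i _ hi => by
        rw [hm i (by omega), hl (i + 1) (by omega), sub_zero, qPochInv_zero hq],
      hl (0 + 1) le_rfl, sub_zero, sub_zero]
    have h1 := qPoch_mul_qPochInv hq hm0
    rw [eq_inv_of_mul_eq_one_right h1]
    ring

theorem extZ_lower_le {N : ℕ} {y : GTArray N} (hy : y ∈ gtConePartition N) (j : Fin N) (i : ℕ) :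
    extZ (y j.castSucc) i ≤ extZ (y j.succ) i := by
  have h1 := hy.2 j
  by_cases hi : i < (j : ℕ)
  · have h2 := (h1 ⟨i, hi⟩).2
    have e1 : extZ (y j.castSucc) i = y.lower j ⟨i, hi⟩ := extZ_fin (y.lower j) ⟨i, hi⟩
    have e2 : extZ (y j.succ) i = y.upper j (Fin.castSucc ⟨i, hi⟩) :=
      extZ_fin (y.upper j) (Fin.castSucc ⟨i, hi⟩)
    rw [e1, e2]
    exact h2
  · rw [extZ_of_le (y j.castSucc) (by simpa using hi)]
    exact extZ_nonneg (hy.1 _) i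

theorem alphaDensity_one (hq0 : 0 < q) (hq1 : q < 1) {N : ℕ} {a : Fin N → ℝ}
    {c : ℝ} {y : GTArray N} (hy : y ∈ gtConePartition N)
    (hy1 : ∀ n i, 1 ≤ i → extZ (y n) i = 0) :
    alphaDensity q (fun j => 1 / a j) (fun _ => c) 1 y =
      ∏ j : Fin N, qPoissonWeight q (c / a j) (extZ (y j.succ) 0 - extZ (y j.castSucc) 0) := by
  have hq : ‖q‖ < 1 := by rwa [Real.norm_of_nonneg hq0.le]
  have h0 : ∀ n, 0 ≤ extZ (y n) 0 := fun n => extZ_nonneg (hy.1 n) 0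
  have hz : extZ (y 0) 0 = 0 := extZ_of_le (y 0) le_rfl
  have hsk : ∏ j : Fin N, skewP q (y.upper j) (y.lower j) (1 / a j) =
      (∏ j : Fin N, (1 / a j) ^ (extZ (y j.succ) 0 - extZ (y j.castSucc) 0) *
        qPochInv q (extZ (y j.succ) 0 - extZ (y j.castSucc) 0)) *
        qPoch q q (extZ y.top 0) := by
    have h1 := prod_div_telescope (f := fun n => qPoch q q (extZ (y n) 0))
      fun n => qPoch_ne_zero hq (h0 n)
    simp only [hz, qPoch_zero hq, div_one] at h1
    rw [show qPoch q q (extZ y.top 0) = qPoch q q (extZ (y (Fin.last N)) 0) from rfl, ← h1,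
      ← Finset.prod_mul_distrib]
    exact Finset.prod_congr rfl fun j _ => skewP_of_one_row hq (hy1 j.succ) (hy1 j.castSucc)
      (h0 j.succ) (h0 j.castSucc) _
  have hw : alphaWeight q (fun _ => c) 1 y.top = c ^ extZ y.top 0 / qPoch q q (extZ y.top 0) := by
    have ht : ∀ i, 1 ≤ i → extZ y.top i = 0 := hy1 (Fin.last N)
    rw [alphaWeight, if_pos ⟨hy.1 (Fin.last N), ht⟩, whittakerQ, normP_eq, extZ_resize ht]
    simp only [Finset.range_one, Finset.prod_singleton, zero_add, ht 1 le_rfl, sub_zero]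
    congr 1
    rw [whittakerP, Finset.sum_eq_single_of_mem (fun i => i.elim0)
      (Fintype.mem_piFinset.2 fun i => i.elim0) fun mu _ hmu => absurd (Subsingleton.elim _ _) hmu]
    simp only [whittakerP, skewP, mul_one, Finset.univ_eq_empty, Finset.prod_empty, Finset.sum_empty,
      sub_zero]
    rw [Fin.sum_univ_one]
    rfl
  have hc := zpow_telescope (M := fun n => extZ (y n) 0) (fun j => extZ_lower_le hy j 0) c
  simp only [hz, sub_zero] at hc
  rw [alphaDensity, hsk, hw, show extZ y.top 0 = extZ (y (Fin.last N)) 0 from rfl, hc]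
  have h2 := qPoch_ne_zero hq (h0 (Fin.last N))
  simp only [Finset.range_one, Finset.prod_singleton, qPoissonWeight]
  simp only [one_div, Finset.prod_inv_distrib, div_inv_eq_mul, div_eq_mul_inv c, mul_zpow,
    Finset.prod_mul_distrib]
  field_simp

theorem diag_eq {N : ℕ} (x : GTArray N) (n : Fin (N + 1)) :
    x.diag n = -extZ (negGT x n) 0 := by
  refine Fin.cases ?_ (fun j => ?_) n
  · rw [show extZ (negGT x 0) 0 = 0 from extZ_of_le (negGT x 0) le_rfl]; rfl
  · have h : extZ (negGT x j.succ) 0 = negSig (x.upper j) 0 := extZ_fin (negSig (x.upper j)) 0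
    rw [h, negSig, neg_neg, Fin.rev_zero]
    rfl

theorem extZ_negGT_of_zero {N : ℕ} {x : GTArray N}
    (hx : ∀ (k : Fin N) (j : Fin (k : ℕ)), x.upper k j.castSucc = 0) (n : Fin (N + 1)) {i : ℕ}
    (hi : 1 ≤ i) : extZ (negGT x n) i = 0 := by
  by_cases hin : i < (n : ℕ)
  · obtain ⟨k, rfl⟩ := Fin.exists_succ_eq.2 (show n ≠ 0 by rintro rfl; simp at hin)
    obtain ⟨i, rfl⟩ : ∃ i', i = i' + 1 := ⟨i - 1, by omega⟩
    have hik : i < (k : ℕ) := by simpa using hin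
    have h : extZ (negGT x k.succ) (i + 1) = negSig (x.upper k) (Fin.succ ⟨i, hik⟩) :=
      extZ_fin (negSig (x.upper k)) (Fin.succ ⟨i, hik⟩)
    rw [h, negSig, Fin.rev_succ, hx, neg_zero]
  · exact extZ_of_le _ (not_lt.1 hin)

theorem zero_of_extZ_negGT {N : ℕ} {x : GTArray N}
    (hx : ∀ n i, 1 ≤ i → extZ (negGT x n) i = 0) (k : Fin N) (j : Fin (k : ℕ)) :
    x.upper k j.castSucc = 0 := by
  have h : extZ (negGT x k.succ) (Fin.succ j.rev) = negSig (x.upper k) (Fin.succ j.rev) :=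
    extZ_fin (negSig (x.upper k)) (Fin.succ j.rev)
  rw [hx _ _ (by simp), negSig, Fin.rev_succ, Fin.rev_rev] at h
  omega

theorem alphaDensity_one_eq (hq0 : 0 < q) (hq1 : q < 1) {N : ℕ} {a : Fin N → ℝ} {c : ℝ}
    {x : GTArray N} (hx : x ∈ gtCone N) :
    alphaDensity q (fun j => 1 / a j) (fun _ => c) 1 (negGT x) =
      (∏ j : Fin N, qPoissonWeight q (c / a j) (x.diag j.castSucc - x.diag j.succ)) *
        ∏ k : Fin N, ∏ j : Fin (k : ℕ), (if x.upper k j.castSucc = 0 then 1 else 0) := by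
  have hq : ‖q‖ < 1 := by rwa [Real.norm_of_nonneg hq0.le]
  have hd : ∀ j : Fin N, x.diag j.castSucc - x.diag j.succ =
      extZ (negGT x j.succ) 0 - extZ (negGT x j.castSucc) 0 := fun j => by
    rw [diag_eq, diag_eq]; ring
  by_cases hgood : ∀ (k : Fin N) (j : Fin (k : ℕ)), x.upper k j.castSucc = 0
  · have h1 : ∏ k : Fin N, ∏ j : Fin (k : ℕ), (if x.upper k j.castSucc = 0 then (1 : ℝ) else 0) = 1 :=
      Finset.prod_eq_one fun k _ => Finset.prod_eq_one fun j _ => if_pos (hgood k j)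
    rw [h1, mul_one]
    have hz := fun n i hi => extZ_negGT_of_zero hgood n (i := i) hi
    by_cases hy : negGT x ∈ gtConePartition N
    · rw [alphaDensity_one hq0 hq1 hy hz]
      exact Finset.prod_congr rfl fun j _ => by rw [hd]
    -- Here -x is not an array of partitions, so the right side must vanish too: non-zero q-Poisson
    -- weights would make the first parts of -x increase from 0, hence be non-negative, and -x would
    -- be an array of partitions.
    · have hL : alphaDensity q (fun j => 1 / a j) (fun _ => c) 1 (negGT x) = 0 := by
        by_contra hne
        exact hy (mem_gtConePartition_of_alphaDensity hq0 hq1 hne).1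
      rw [hL]
      symm
      by_contra hne
      rw [← ne_eq, Finset.prod_ne_zero_iff] at hne
      have hM : ∀ j : Fin N, extZ (negGT x j.castSucc) 0 ≤ extZ (negGT x j.succ) 0 := by
        intro j
        by_contra hlt
        refine hne j (Finset.mem_univ j) ?_
        rw [qPoissonWeight, hd, qPochInv_of_neg hq0.ne' hq (by omega), mul_zero, mul_zero]
      have hM0 : ∀ n, 0 ≤ extZ (negGT x n) 0 := by
        intro n
        induction n using Fin.induction with
        | zero => exact (extZ_of_le (negGT x 0) le_rfl).ge
        | succ j ih => exact ih.trans (hM j)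
      refine hy (mem_gtConePartition_of_top (negGT_mem_gtCone hx).2 (isPartition_of_extZ ?_))
      refine antitone_nat_of_succ_le fun i => ?_
      have h2 : extZ (negGT x).top (i + 1) = 0 := hz (Fin.last N) (i + 1) (by omega)
      rw [h2]
      cases i with
      | zero => exact hM0 (Fin.last N)
      | succ i => exact (hz (Fin.last N) (i + 1) (by omega)).ge
  · have h1 : ∏ k : Fin N, ∏ j : Fin (k : ℕ), (if x.upper k j.castSucc = 0 then (1 : ℝ) else 0) = 0 := by
      push Not at hgood
      obtain ⟨k, j, hkj⟩ := hgood
      exact Finset.prod_eq_zero (Finset.mem_univ k)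
        (Finset.prod_eq_zero (Finset.mem_univ j) (if_neg hkj))
    rw [h1, mul_zero]
    by_contra hne
    obtain ⟨hy, htop⟩ := mem_gtConePartition_of_alphaDensity hq0 hq1 hne
    -- With one parameter the top row has at most one non-zero part, and interlacing of partitions
    -- passes this down to every row.
    refine hgood (zero_of_extZ_negGT fun n i hi => ?_)
    induction n using Fin.reverseInduction with
    | last => exact htop i hi
    | cast j ih => exact le_antisymm ((extZ_lower_le hy j i).trans ih.le) (extZ_nonneg (hy.1 _) i)

end OneParameter

/-! ### The law of the diagonal increments. -/

section Law

variable {q : ℝ}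

theorem qPoissonWeight_nonneg (hq0 : 0 < q) (hq1 : q < 1) {b : ℝ} (hb0 : 0 ≤ b) (hb : b < 1)
    (n : ℤ) : 0 ≤ qPoissonWeight q b n :=
  mul_nonneg (qPochInf_pos hq0 hq1 hb).le (mul_nonneg (zpow_nonneg hb0 n) (qPochInv_nonneg hq0 hq1 n))

theorem isProbabilityMeasure_qPoissonMeasure (hq0 : 0 < q) (hq1 : q < 1) {b : ℝ} (hb0 : 0 ≤ b)
    (hb : b < 1) : IsProbabilityMeasure (qPoissonMeasure q b) := by
  have hq : ‖q‖ < 1 := by rwa [Real.norm_of_nonneg hq0.le]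
  have hs := (hasSum_qExp hq0.ne' hq (x := b) (by rwa [Real.norm_of_nonneg hb0])).mul_left
    (qPochInf b q)
  rw [mul_one_div_cancel (qPochInf_pos hq0 hq1 hb).ne'] at hs
  refine ⟨?_⟩
  rw [qPoissonMeasure, Measure.sum_apply _ MeasurableSet.univ]
  simp only [Measure.smul_apply, measure_univ, smul_eq_mul, mul_one]
  rw [← ENNReal.ofReal_tsum_of_nonneg
    (fun n : ℕ => qPoissonWeight_nonneg hq0 hq1 hb0 hb (n : ℤ))]
  · simp only [qPoissonWeight, zpow_natCast]
    rw [hs.tsum_eq, ENNReal.ofReal_one]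
  · simpa only [qPoissonWeight, zpow_natCast] using hs.summable

theorem sum_smul_dirac_apply {Ω : Type*} [MeasurableSpace Ω] [Countable Ω]
    [MeasurableSingletonClass Ω] (w : Ω → ENNReal) {S : Set Ω} {x₀ : Ω}
    (hx : ∀ x, x ∈ S → w x ≠ 0 → x = x₀) (hx₀ : x₀ ∈ S) :
    Measure.sum (fun x => w x • Measure.dirac x) S = w x₀ := by
  rw [Measure.sum_apply _ S.to_countable.measurableSet, tsum_eq_single x₀]
  · simp [hx₀]
  · intro x hne
    by_cases hS : x ∈ S
    · have : w x = 0 := by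
        by_contra h
        exact hne (hx x hS h)
      simp [this]
    · simp [hS]

theorem qPoissonMeasure_singleton (b : ℝ) (n : ℕ) :
    qPoissonMeasure q b {n} = ENNReal.ofReal (qPoissonWeight q b n) :=
  sum_smul_dirac_apply (fun n : ℕ => ENNReal.ofReal (qPoissonWeight q b n)) (x₀ := n)
    (fun _ h _ => h) rfl

/-- The array whose only non-zero entries are the diagonal ones, with increments `-y`. -/
def stepArray {N : ℕ} (y : Fin N → ℕ) : GTArray N := fun n i =>
  if (i : ℕ) + 1 = n then -∑ l ∈ Finset.range n, extZ (fun j => (y j : ℤ)) l else 0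

theorem extZ_natCast_nonneg {N : ℕ} (y : Fin N → ℕ) (l : ℕ) : 0 ≤ extZ (fun j => (y j : ℤ)) l := by
  rw [extZ]
  split_ifs
  exacts [Int.natCast_nonneg _, le_rfl]

theorem stepArray_le {N : ℕ} (y : Fin N → ℕ) (n : Fin (N + 1)) (i : Fin (n : ℕ)) :
    stepArray y n i ≤ 0 := by
  rw [stepArray]
  split_ifs
  exacts [neg_nonpos.2 (Finset.sum_nonneg fun l _ => extZ_natCast_nonneg y l), le_rfl]

theorem stepArray_upper_castSucc {N : ℕ} (y : Fin N → ℕ) (k : Fin N) (j : Fin (k : ℕ)) :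
    (stepArray y).upper k j.castSucc = 0 :=
  if_neg (by simp only [Fin.val_castSucc, Fin.val_succ]; omega)

theorem stepArray_mem {N : ℕ} (y : Fin N → ℕ) : stepArray y ∈ gtCone N := by
  refine ⟨fun n i j hij => ?_, fun k i => ⟨?_, ?_⟩⟩
  · by_cases hi : (i : ℕ) + 1 = n
    · have : i = j := Fin.ext (by have := j.2; have : (i : ℕ) ≤ j := hij; omega)
      rw [this]
    · rw [show stepArray y n i = 0 from if_neg hi]
      exact stepArray_le y n j
  · by_cases hi : (i : ℕ) + 1 = k
    · have h1 : (stepArray y).upper k i.succ =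
          -∑ l ∈ Finset.range (k + 1), extZ (fun j => (y j : ℤ)) l :=
        if_pos (by simp only [Fin.val_succ]; omega)
      have h2 : (stepArray y).lower k i = -∑ l ∈ Finset.range k, extZ (fun j => (y j : ℤ)) l :=
        if_pos hi
      rw [h1, h2, Finset.sum_range_succ]
      linarith [extZ_natCast_nonneg y k]
    · have h2 : (stepArray y).lower k i = 0 := if_neg hi
      rw [h2]
      exact stepArray_le y k.succ i.succ
  · rw [stepArray_upper_castSucc]
    exact stepArray_le y k.castSucc i

theorem diag_stepArray {N : ℕ} (y : Fin N → ℕ) (n : Fin (N + 1)) :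
    (stepArray y).diag n = -∑ l ∈ Finset.range n, extZ (fun j => (y j : ℤ)) l := by
  refine Fin.cases ?_ (fun j => ?_) n
  · simp [GTArray.diag]
  · exact if_pos (by simp)

theorem diag_sub_stepArray {N : ℕ} (y : Fin N → ℕ) (j : Fin N) :
    (stepArray y).diag j.castSucc - (stepArray y).diag j.succ = y j := by
  rw [diag_stepArray, diag_stepArray, Fin.val_succ, Fin.val_castSucc, Finset.sum_range_succ,
    show extZ (fun j => (y j : ℤ)) (j : ℕ) = y j from extZ_fin (fun j => (y j : ℤ)) j]
  ring

/-- Arrays with zero off-diagonal entries are parametrised by their diagonal increments, so each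
event {Y = y} contains a single array of positive mass. -/
theorem eq_stepArray {N : ℕ} {x : GTArray N} {y : Fin N → ℕ}
    (hx : ∀ (k : Fin N) (j : Fin (k : ℕ)), x.upper k j.castSucc = 0)
    (hxy : ∀ j : Fin N, x.diag j.castSucc - x.diag j.succ = y j) : x = stepArray y := by
  have hd : ∀ n, x.diag n = (stepArray y).diag n := by
    intro n
    induction n using Fin.induction with
    | zero => rfl
    | succ j ih =>
      have h1 := hxy j
      have h2 := diag_sub_stepArray y j
      omega
  funext n
  refine Fin.cases (funext fun i => absurd i.2 (by simp)) (fun k => ?_) n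
  have : x.upper k = (stepArray y).upper k := by
    funext i
    refine Fin.lastCases ?_ (fun j => ?_) i
    · exact hd k.succ
    · rw [hx, stepArray_upper_castSucc]
  exact this

/-- A measure on the Gelfand-Tsetlin cone with the density of part (ii) is the law of the random
initial condition of `q`-TASEP. -/
theorem isQPoissonInitial (hq0 : 0 < q) (hq1 : q < 1) {N : ℕ} {b : Fin N → ℝ} (hb0 : ∀ j, 0 ≤ b j)
    (hb : ∀ j, b j < 1) (w : gtCone N → ENNReal)
    (hw : ∀ x : gtCone N, w x = ENNReal.ofReal ((∏ j : Fin N, qPoissonWeight q (b j)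
      ((x : GTArray N).diag j.castSucc - (x : GTArray N).diag j.succ)) *
        ∏ k : Fin N, ∏ j : Fin (k : ℕ),
          (if (x : GTArray N).upper k j.castSucc = 0 then 1 else 0)))
    (hprob : IsProbabilityMeasure (Measure.sum fun x : gtCone N => w x • Measure.dirac x)) :
    IsQPoissonInitial (Measure.sum fun x : gtCone N => w x • Measure.dirac x) q b
      fun j x => (x : GTArray N).particle j := by
  have hq : ‖q‖ < 1 := by rwa [Real.norm_of_nonneg hq0.le]
  set μ := Measure.sum fun x : gtCone N => w x • Measure.dirac x with hμ
  have hpois := fun j => isProbabilityMeasure_qPoissonMeasure hq0 hq1 (hb0 j) (hb j)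
  have hsupp : ∀ x : gtCone N, w x ≠ 0 →
      (∀ (k : Fin N) (j : Fin (k : ℕ)), (x : GTArray N).upper k j.castSucc = 0) ∧
      ∀ j : Fin N, 0 ≤ (x : GTArray N).diag j.castSucc - (x : GTArray N).diag j.succ := by
    intro x hx
    rw [hw, ne_eq, ENNReal.ofReal_eq_zero, not_le] at hx
    have h1 := hx.ne'
    refine ⟨fun k j => ?_, fun j => ?_⟩
    · by_contra hne
      exact Finset.prod_ne_zero_iff.1 (Finset.prod_ne_zero_iff.1 (right_ne_zero_of_mul h1) k
        (Finset.mem_univ k)) j (Finset.mem_univ j) (if_neg hne)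
    · by_contra hne
      refine Finset.prod_ne_zero_iff.1 (left_ne_zero_of_mul h1) j (Finset.mem_univ j) ?_
      rw [qPoissonWeight, qPochInv_of_neg hq0.ne' hq (not_le.1 hne), mul_zero, mul_zero]
  -- Truncation at 0 matters only on a null set, since the increments are non-negative wherever the
  -- weight is non-zero.
  set Y : Fin N → gtCone N → ℕ := fun j x =>
    ((x : GTArray N).diag j.castSucc - (x : GTArray N).diag j.succ).toNat with hY
  have hYm : ∀ j, Measurable (Y j) := fun j => Measurable.of_discrete
  -- The joint law agrees with the product measure on singletons of a countable space; this yields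
  -- the marginals, and then independence.
  have hlaw : μ.map (fun x j => Y j x) = Measure.pi fun j => qPoissonMeasure q (b j) := by
    rw [Measure.ext_iff_singleton]
    intro y
    rw [Measure.pi_singleton, Measure.map_apply (measurable_pi_lambda _ hYm)
      (MeasurableSet.singleton y)]
    simp only [qPoissonMeasure_singleton]
    rw [← ENNReal.ofReal_prod_of_nonneg fun j _ => qPoissonWeight_nonneg hq0 hq1 (hb0 j) (hb j) _,
      hμ, sum_smul_dirac_apply w (x₀ := ⟨stepArray y, stepArray_mem y⟩), hw]
    · congr 1
      simp only [diag_sub_stepArray, stepArray_upper_castSucc, if_true, Finset.prod_const_one,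
        mul_one]
    · intro x hx hwx
      obtain ⟨h1, h2⟩ := hsupp x hwx
      refine Subtype.ext (eq_stepArray h1 fun j => ?_)
      rw [← Int.toNat_of_nonneg (h2 j)]
      exact_mod_cast congrFun hx j
    · funext j
      simp only [diag_sub_stepArray, Int.toNat_natCast]
  have hmarg : ∀ j, μ.map (Y j) = qPoissonMeasure q (b j) := by
    intro j
    have h1 := (measurePreserving_eval (fun j => qPoissonMeasure q (b j)) j).map_eq
    rw [← hlaw, Measure.map_map (measurable_pi_apply j) (measurable_pi_lambda _ hYm)] at h1
    exact h1
  refine ⟨Y, hYm, ?_, hmarg, ?_⟩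
  · rw [ProbabilityTheory.iIndepFun_iff_map_fun_eq_pi_map fun j => (hYm j).aemeasurable, hlaw]
    simp only [hmarg]
  · rw [hμ, Measure.ae_sum_iff]
    intro x
    by_cases hx : w x = 0
    · rw [hx, zero_smul]
      simp
    · obtain ⟨h1, h2⟩ := hsupp x hx
      refine Measure.ae_smul_measure ?_ _
      rw [ae_dirac_eq]
      refine ⟨fun i hi => ?_, fun i j hij => ?_⟩
      · simp only [hY]
        rw [Int.toNat_of_nonneg (h2 i)]
        have h3 : (x : GTArray N).diag i.castSucc = 0 := by
          rw [show i.castSucc = 0 from Fin.ext hi]; rfl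
        have h4 : (x : GTArray N).diag i.succ = (x : GTArray N).upper i (Fin.last i) := rfl
        rw [h3, h4, GTArray.particle]
        omega
      · simp only [hY]
        rw [Int.toNat_of_nonneg (h2 j)]
        have h3 : (x : GTArray N).diag j.castSucc = (x : GTArray N).upper i (Fin.last i) := by
          rw [show j.castSucc = i.succ from Fin.ext hij]; rfl
        have h4 : (x : GTArray N).diag j.succ = (x : GTArray N).upper j (Fin.last j) := rfl
        rw [h3, h4, GTArray.particle, GTArray.particle]
        omega

end Law

/-! ### Assembly of the statement. -/

theorem hasSum_of_tsum_ofReal_eq_one {ι : Type*} {f : ι → ℝ} (hf : ∀ x, 0 ≤ f x)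
    (h : ∑' x, ENNReal.ofReal (f x) = 1) : HasSum f 1 := by
  have h1 := ENNReal.hasSum_toReal (f := fun x => ENNReal.ofReal (f x)) (by rw [h]; simp)
  simp only [ENNReal.toReal_ofReal (hf _)] at h1
  have h2 := ENNReal.ofReal_tsum_of_nonneg hf h1.summable
  rw [h, ENNReal.ofReal_eq_one] at h2
  rwa [h2] at h1

/-- The reflection `x ↦ -x` as an equivalence. -/
def negGTEquiv (N : ℕ) : GTArray N ≃ GTArray N := ⟨negGT, negGT, negGT_negGT, negGT_negGT⟩

end QWhittaker

theorem propositionp2 (N : ℕ) (q : ℝ) (hq0 : 0 < q) (hq1 : q < 1)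
    (a α : Fin N → ℝ) (ha : ∀ j, 0 < a j)
    (hα0 : ∀ i, 0 ≤ α i) (hα1 : ∀ i, α i < 1) (hαa : ∀ i j, α i < a j) :
    -- outside the negated cone of partitions the density at time 0 vanishes
    (∀ x ∈ QWhittaker.gtCone N, x ∉ QWhittaker.negGtConePartition N →
      QWhittaker.twoSidedProcess q a α 0 x = 0) ∧
    -- on it, the density is the q-Whittaker process with pure alpha-specialisation
    (∀ x ∈ QWhittaker.gtCone N, QWhittaker.negGT x ∈ QWhittaker.gtConePartition N →
      QWhittaker.twoSidedProcess q a α 0 x =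
        (∏ j : Fin N, QWhittaker.skewP (q : ℂ) ((QWhittaker.negGT x).upper j)
            ((QWhittaker.negGT x).lower j) (1 / (a j : ℂ))) *
          QWhittaker.whittakerQ (q : ℂ) (QWhittaker.negGT x).top (fun i => (α i : ℂ)) /
          QWhittaker.twoSidedKernel (q : ℂ) (fun i => (a i : ℂ)) (fun i => (α i : ℂ)) 0 ∧
      QWhittaker.twoSidedProcess q a α 0 x =
        ((QWhittaker.alphaProcess q (fun j => 1 / a j) α (QWhittaker.negGT x) : ℝ) : ℂ)) ∧
    -- it is a probability density on the negated cone of partitions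
    QWhittaker.negGtConePartition N ⊆ QWhittaker.gtCone N ∧
    (∀ x ∈ QWhittaker.gtCone N, (QWhittaker.twoSidedProcess q a α 0 x).im = 0 ∧
      0 ≤ (QWhittaker.twoSidedProcess q a α 0 x).re) ∧
    HasSum (fun x : QWhittaker.negGtConePartition N =>
      QWhittaker.twoSidedProcess q a α 0 (x : QWhittaker.GTArray N)) 1 ∧
    MeasureTheory.IsProbabilityMeasure (QWhittaker.twoSidedMeasure q a α 0) ∧
    -- the case in which only one of the alphas may be nonzero
    (∀ i₀ : Fin N, (∀ k, k ≠ i₀ → α k = 0) →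
      (∀ x ∈ QWhittaker.gtCone N, QWhittaker.twoSidedProcess q a α 0 x =
        (((∏ j : Fin N, QWhittaker.qPoissonWeight q (α i₀ / a j)
            (x.diag j.castSucc - x.diag j.succ)) *
          ∏ k : Fin N, ∏ j : Fin (k : ℕ), (if x.upper k j.castSucc = 0 then 1 else 0) : ℝ) : ℂ)) ∧
      QWhittaker.IsQPoissonInitial (QWhittaker.twoSidedMeasure q a α 0) q
        (fun j => α i₀ / a j) (fun j x => (x : QWhittaker.GTArray N).particle j)) := by
  have hq : ‖q‖ < 1 := by rwa [Real.norm_of_nonneg hq0.le]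
  have hker : ∀ {c : ℝ} (j : Fin N), (∀ j, c < a j) → c * (1 / a j) < 1 := fun j hc => by
    rw [mul_one_div, div_lt_one (ha j)]; exact hc j
  have hb : ∀ j, 0 < 1 / a j := fun j => one_div_pos.2 (ha j)
  -- The parameters are extended by zeros to a sequence, the form used in the inductions on their
  -- number.
  set β : ℕ → ℝ := fun i => if h : i < N then α ⟨i, h⟩ else 0 with hβ
  have hβfin : ∀ i : Fin N, β i = α i := fun i => dif_pos i.2
  have hβ0 : ∀ i, 0 ≤ β i := fun i => by
    simp only [hβ]
    split_ifs
    exacts [hα0 _, le_rfl]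
  have hβ1 : ∀ i, β i < 1 := fun i => by
    simp only [hβ]
    split_ifs
    exacts [hα1 _, one_pos]
  have hβa : ∀ i j, β i * (1 / a j) < 1 := fun i j => hker j fun j => by
    simp only [hβ]
    split_ifs
    exacts [hαa _ _, ha j]
  have hproc : ∀ x ∈ QWhittaker.gtCone N, QWhittaker.twoSidedProcess q a α 0 x =
      ((QWhittaker.alphaDensity q (fun j => 1 / a j) β N (QWhittaker.negGT x) : ℝ) : ℂ) :=
    fun x hx => QWhittaker.twoSidedProcess_eq hq0 hq1 le_rfl
      (fun i _ => by rw [Real.norm_of_nonneg (hβ0 i)]; exact hβ1 i)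
      (fun w => by rw [Finset.prod_range]; simp only [hβfin]) hx
  have hnn := QWhittaker.alphaDensity_nonneg hq0 hq1 (fun j => (hb j).le) hβ0 hβa N
  have htot := QWhittaker.tsum_alphaDensity hq0 hq1 hb hβ0 hβa le_rfl
  rw [← (QWhittaker.negGTEquiv N).tsum_eq] at htot
  have hsupp : ∀ x, QWhittaker.alphaDensity q (fun j => 1 / a j) β N (QWhittaker.negGT x) ≠ 0 →
      x ∈ QWhittaker.negGtConePartition N := fun x hx => QWhittaker.mem_negGtConePartition
    (QWhittaker.mem_gtConePartition_of_alphaDensity hq0 hq1 hx).1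
  have hmeas : MeasureTheory.IsProbabilityMeasure (QWhittaker.twoSidedMeasure q a α 0) := by
    refine ⟨?_⟩
    rw [QWhittaker.twoSidedMeasure, MeasureTheory.Measure.sum_apply _ MeasurableSet.univ]
    simp only [MeasureTheory.Measure.smul_apply, MeasureTheory.measure_univ, smul_eq_mul, mul_one]
    rw [← htot, ← tsum_subtype_eq_of_support_subset (s := QWhittaker.gtCone N)]
    · exact tsum_congr fun x => by rw [hproc x x.2, Complex.ofReal_re]; rfl
    · intro x hx
      refine QWhittaker.negGtConePartition_subset N (hsupp x fun h => hx ?_)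
      exact (congrArg ENNReal.ofReal h).trans ENNReal.ofReal_zero
  refine ⟨fun x hx hx' => ?_, fun x hx hx' => ?_, QWhittaker.negGtConePartition_subset N,
    fun x hx => ?_, ?_, hmeas, fun i₀ hi₀ => ?_⟩
  · rw [hproc x hx, Complex.ofReal_eq_zero]
    by_contra hne
    exact hx' (hsupp x hne)
  · have hw : QWhittaker.alphaWeight q β N (QWhittaker.negGT x).top =
        QWhittaker.whittakerQ q (QWhittaker.negGT x).top α := by
      rw [QWhittaker.alphaWeight, if_pos ⟨hx'.1 (Fin.last N), fun i hi => QWhittaker.extZ_of_le _ hi⟩,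
        QWhittaker.resize_of_extZ_eq rfl]
      simp only [hβfin]
    have hk : QWhittaker.twoSidedKernel (q : ℂ) (fun i => (a i : ℂ)) (fun i => (α i : ℂ)) 0 =
        ((∏ i ∈ Finset.range N, ∏ j, 1 / QWhittaker.qPochInf (β i * (1 / a j)) q : ℝ) : ℂ) := by
      rw [Finset.prod_range]
      simp only [QWhittaker.twoSidedKernel, hβfin, Complex.ofReal_zero, mul_zero, Complex.exp_zero,
        Finset.prod_const_one, mul_one, Complex.ofReal_prod, Complex.ofReal_div, Complex.ofReal_one,
        QWhittaker.ofReal_qPochInf hq, mul_one_div]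
    constructor
    · rw [hproc x hx, hk, QWhittaker.alphaDensity, hw, Complex.ofReal_div, Complex.ofReal_mul,
        QWhittaker.ofReal_whittakerQ hq, Complex.ofReal_prod]
      simp only [QWhittaker.ofReal_skewP hq, Complex.ofReal_div, Complex.ofReal_one]
    · rw [hproc x hx, QWhittaker.alphaDensity, hw, QWhittaker.alphaProcess, QWhittaker.cauchyKernel,
        Finset.prod_range, Finset.prod_comm]
      simp only [hβfin, mul_comm (α _)]
  · rw [hproc x hx, Complex.ofReal_im, Complex.ofReal_re]
    exact ⟨rfl, hnn _⟩
  · have h1 : HasSum (fun x => QWhittaker.alphaDensity q (fun j => 1 / a j) β N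
        (QWhittaker.negGT x)) 1 :=
      QWhittaker.hasSum_of_tsum_ofReal_eq_one (fun x => hnn _) htot
    rw [← hasSum_subtype_iff_of_support_subset (s := QWhittaker.negGtConePartition N)
      fun x hx => hsupp x hx, ← Complex.hasSum_ofReal, Complex.ofReal_one] at h1
    refine h1.congr_fun fun x => ?_
    exact hproc x (QWhittaker.negGtConePartition_subset N x.2)
  · have hαi : ∀ j, α i₀ * (1 / a j) < 1 := fun j => hker j (hαa i₀)
    have hform : ∀ x ∈ QWhittaker.gtCone N, QWhittaker.twoSidedProcess q a α 0 x =
        (((∏ j : Fin N, QWhittaker.qPoissonWeight q (α i₀ / a j)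
            (x.diag j.castSucc - x.diag j.succ)) *
          ∏ k : Fin N, ∏ j : Fin (k : ℕ), (if x.upper k j.castSucc = 0 then 1 else 0) : ℝ) : ℂ) := by
      intro x hx
      -- The zero parameters contribute factors (0;q)_∞ = 1, so the kernel is that of the single
      -- parameter α i₀, wherever it stands in the list.
      rw [QWhittaker.twoSidedProcess_eq hq0 hq1 (β := fun _ => α i₀) (k := 1)
        (Nat.one_le_iff_ne_zero.2 fun h => (h ▸ i₀).elim0)
        (fun i _ => by rw [Real.norm_of_nonneg (hα0 i₀)]; exact hα1 i₀) (fun w => ?_) hx,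
        QWhittaker.alphaDensity_one_eq hq0 hq1 hx]
      rw [Finset.range_one, Finset.prod_singleton]
      refine Finset.prod_eq_single_of_mem i₀ (Finset.mem_univ _) fun i _ hi => ?_
      rw [hi₀ i hi]
      exact Finset.prod_eq_one fun j _ => by
        rw [Complex.ofReal_zero, zero_mul, QWhittaker.qPochInf_zero, div_one]
    refine ⟨hform, ?_⟩
    refine QWhittaker.isQPoissonInitial hq0 hq1 (fun j => div_nonneg (hα0 i₀) (ha j).le)
      (fun j => by rw [← mul_one_div]; exact hαi j) _ (fun x => ?_) hmeas
    rw [hform x x.2, Complex.ofReal_re]
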